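/- All manifolds and maps are smooth ($C^\infty$), manifolds are finite-dimensional, Hausdorff and second countable, and may have boundary; submanifolds are embedded. For a submanifold $S\subset M$ contained in the interior of $M$, let $NS=TM|_S/TS$ be its normal bundle with projection $\mathrm{pr}_S\colon NS\to S$. A *tubular neighbourhood embedding* for $S$ is a diffeomorphism $\Phi\colon\widetilde U\to U$ from an open neighbourhood $\widetilde U\subset NS$ of the zero section onto an open set $U\subset M$ with $\Phi(0_p)=p$ for all $p\in S$ and whose linear approximation $NS\to NS$ along $S$ in the normal direction is the identity. A *defining function* for a hypersurface $S$ on an open set $V\supset S$ is a smooth $z\colon V\to\mathbb R$ with $z^{-1}(0)=S$ and $dz\neq0$ along $S$; a local defining function is the same near a point of $S$. If $g$ is a smooth function vanishing on $S$ with $dg|_S=0$, its Hessian along $S$ descends to $NS$, and $Q_g(v)=\tfrac12\mathrm{Hess}_p(g)(v,v)$ ($v\in N_pS$) denotes the quadratic part of $g$. Let $f\colon (X,D)\to (Y,Z)$ be a *fibrating boundary map*, that is: $f\colon X\to Y$ is a smooth map, $D\subset X$ is a submanifold of codimension at least $2$, $Z\subset Y$ is a hypersurface, $f^{-1}(Z)=D$,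 the normal Hessian $\mathrm{Sym}^2(ND)\to f^*(NZ)$ of $f$ along $D$ is definite (i.e. for every $p\in D$ and every local defining function $z$ of $Z$ near $f(p)$, $\mathrm{Hess}_p(z\circ f)$ is positive definite or negative definite on $N_pD$), and $f|_D\colon D\to Z$ is a submersion. Assume that $D$ is compact and that $D$ and $f(D)$ lie in the interiors of $X$ and $Y$. Let $D_j$ be a connected component of $D$ such that $Z_j:=f(D_j)$ is coorientable (its normal bundle is orientable). **Proposition.** There exist an open set $V\supset Z_j$ in $Y$, a defining function $z\colon V\to\mathbb R$ for $Z_j$, and tubular neighbourhood embeddings $\Phi_{D_j}\colon\widetilde U\to U\subset X$ for $D_j$ and $\Phi_{Z_j}\colon\widetilde V\to V\subset Y$ for $Z_j$ with $f(U)\subset V$, such that $$\Phi_{D_j}^*f^*(z)=Q_{f^*(z)}\quad\text{on }\widetilde U,\qquad \mathrm{pr}_{Z_j}\circ\Phi_{Z_j}^{-1}\circ f\circ\Phi_{D_j}=f|_{D_j}\circ\mathrm{pr}_{D_j}\quad\text{on }\widetilde U .$$ -/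

import Mathlib

open Set Filter Topology
open scoped Manifold ContDiff

noncomputable section

section SubmanifoldNotions

variable {E : Type*} [NormedAddCommGroup E] [NormedSpace ℝ E]
  {H : Type*} [TopologicalSpace H] (I : ModelWithCorners ℝ E H)
  {M : Type*} [TopologicalSpace M] [ChartedSpace H M]

/-- `h : M → F` is a defining map for the subset `S` on the open set `V`: it is smooth on `V`,
inside `V` the set `S` is the zero set of `h`, and `h` is submersive along `S ∩ V`.
For `F = ℝ` and a hypersurface `S` this is a (local) defining function of `S`. -/
structure IsDefiningMap {F : Type*} [NormedAddCommGroup F] [NormedSpace ℝ F]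
    (S V : Set M) (h : M → F) : Prop where
  isOpen : IsOpen V
  smooth : ContMDiffOn I 𝓘(ℝ, F) ∞ h V
  zero_iff : ∀ x ∈ V, (x ∈ S ↔ h x = 0)
  submersive : ∀ x ∈ V ∩ S, Function.Surjective (mfderiv I 𝓘(ℝ, F) h x)

/-- Near `p`, the set `S` is an embedded submanifold of codimension `c`. -/
def IsSubmanifoldAt (c : ℕ) (S : Set M) (p : M) : Prop :=
  ∃ (V : Set M) (h : M → EuclideanSpace ℝ (Fin c)), p ∈ V ∧ IsDefiningMap I S V h

/-- The tangent space `T_p S ⊆ T_p M` of a submanifold `S`: the vectors annihilated by `dg` for all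
real functions `g` that are smooth at `p` and vanish on `S` near `p`. -/
def subTangent (S : Set M) (p : M) : Submodule ℝ (TangentSpace I p) where
  carrier := {v | ∀ g : M → ℝ, ContMDiffAt I 𝓘(ℝ, ℝ) ∞ g p → (∀ᶠ x in 𝓝[S] p, g x = 0) →
    mfderiv I 𝓘(ℝ, ℝ) g p v = 0}
  add_mem' := fun ha hb g hg h0 => by rw [map_add, ha g hg h0, hb g hg h0, add_zero]
  zero_mem' := fun g _ _ => map_zero _
  smul_mem' := fun c v hv g hg h0 => by rw [map_smul, hv g hg h0, smul_zero]

/-- The normal space `N_p S = T_p M / T_p S`. -/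
abbrev SubNormalSpace (S : Set M) (p : M) : Type _ := TangentSpace I p ⧸ subTangent I S p

/-- The class in `N_p S` of a tangent vector of `M` at `p`. -/
def normalClass (S : Set M) (p : M) (v : TangentSpace I p) : SubNormalSpace I S p :=
  (subTangent I S p).mkQ v

/-- The total space of the normal bundle `N S = TM|_S / TS`; the bundle projection is `base`. -/
structure NormalBundle (S : Set M) where
  base : S
  vec : SubNormalSpace I S (base : M)

variable {I}

/-- The quotient map `TM|_S → N S`. -/
def toNormal {S : Set M} (v : TangentBundle I M) (hv : v.proj ∈ S) : NormalBundle I S :=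
  ⟨⟨v.proj, hv⟩, normalClass I S v.proj v.snd⟩

variable (I)

/-- The Hessian of `g : M → ℝ` at `p`, computed in the preferred chart at `p` (through which
`T_p M` is identified with the model space `E`). It is used only at interior critical points `p`
of `g`, where it is independent of the chart. -/
def hessianAt (g : M → ℝ) (p : M) (v w : TangentSpace I p) : ℝ :=
  fderiv ℝ (fderiv ℝ (g ∘ (extChartAt I p).symm)) (extChartAt I p p) v w

/-- A function on the tangent vectors at a point, which is a quadratic form descending to the
normal space of `S`, is definite there: it is positive on all nonzero normal vectors, or negative
on all of them. -/
def IsNormallyDefinite (S : Set M) (p : M) (q : TangentSpace I p → ℝ) : Prop :=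
  (∀ v, v ∉ subTangent I S p → 0 < q v) ∨ (∀ v, v ∉ subTangent I S p → q v < 0)

variable [IsManifold I ∞ M]

/-- The topology of the normal bundle: the quotient topology for `TM|_S → N S`. -/
instance normalBundleTopology (S : Set M) : TopologicalSpace (NormalBundle I S) :=
  TopologicalSpace.coinduced
    (fun v : {v : TangentBundle I M // v.proj ∈ S} => toNormal v.1 v.2) inferInstance

variable {I}

/-- `Φ` is smooth on `U ⊆ N S`. As `TM|_S → N S` is a surjective submersion, this means that the
composite of `Φ` with this quotient map is smooth on the preimage of `U` in `TM|_S`. (For subsets of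
a manifold which are embedded submanifolds, `ContMDiffOn` is smoothness on the submanifold.) -/
def SmoothFromNormal {S : Set M} (U : Set (NormalBundle I S)) (Φ : NormalBundle I S → M) : Prop :=
  ∃ F : TangentBundle I M → M,
    ContMDiffOn I.tangent I ∞ F {v | ∃ hv : v.proj ∈ S, toNormal v hv ∈ U} ∧
    ∀ (v : TangentBundle I M) (hv : v.proj ∈ S), toNormal v hv ∈ U → F v = Φ (toNormal v hv)

/-- `Ψ : M → N S` is smooth on the open set `V ⊆ M`. As `TM|_S → N S` is a surjective submersion,
this means that `Ψ` has local smooth lifts to `TM|_S`. -/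
def SmoothToNormal {S : Set M} (V : Set M) (Ψ : M → NormalBundle I S) : Prop :=
  ∀ x ∈ V, ∃ (W : Set M) (σ : M → TangentBundle I M), IsOpen W ∧ x ∈ W ∧ W ⊆ V ∧
    ContMDiffOn I I.tangent ∞ σ W ∧
    ∀ y ∈ W, ∃ hy : (σ y).proj ∈ S, toNormal (σ y) hy = Ψ y

/-- `Φ : Ut → U` is a tubular neighbourhood embedding for the submanifold `S ⊆ M`: a diffeomorphism
from an open neighbourhood `Ut` of the zero section of `N S` onto an open subset `U` of `M`, which
is the identity on the zero section and whose linear approximation `N S → N S` in the normal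
direction is the identity. -/
structure IsTubularEmbedding (S : Set M) (Ut : Set (NormalBundle I S)) (U : Set M)
    (Φ : NormalBundle I S → M) : Prop where
  isOpen_source : IsOpen Ut
  isOpen_target : IsOpen U
  zero_mem : ∀ p : S, (⟨p, 0⟩ : NormalBundle I S) ∈ Ut
  map_zero : ∀ p : S, Φ ⟨p, 0⟩ = p
  mapsTo : MapsTo Φ Ut U
  smooth : SmoothFromNormal Ut Φ
  smooth_inverse : ∃ Ψ : M → NormalBundle I S, SmoothToNormal U Ψ ∧ MapsTo Ψ U Ut ∧
    InvOn Ψ Φ Ut U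
  normal_derivative : ∀ (p : S) (v : TangentSpace I (p : M)), ∃ w : TangentSpace I (p : M),
    normalClass I S (p : M) w = normalClass I S (p : M) v ∧
    HasMFDerivAt 𝓘(ℝ, ℝ) I (fun t : ℝ => Φ ⟨p, t • normalClass I S (p : M) v⟩) 0
      (ContinuousLinearMap.toSpanSingleton ℝ (w : E))

variable (I)

/-- A hypersurface `S` is coorientable: its normal line bundle is orientable, i.e. there is a
continuous vector field along `S` that is nowhere tangent to `S`. -/
def IsCoorientable (S : Set M) : Prop :=
  ∃ ξ : ∀ x : M, TangentSpace I x,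
    ContinuousOn (fun x => (⟨x, ξ x⟩ : TangentBundle I M)) S ∧ ∀ x ∈ S, ξ x ∉ subTangent I S x

end SubmanifoldNotions

section BoundaryMaps

variable {E : Type*} [NormedAddCommGroup E] [NormedSpace ℝ E]
  {H : Type*} [TopologicalSpace H] (I : ModelWithCorners ℝ E H)
  {X : Type*} [TopologicalSpace X] [ChartedSpace H X]
  {E' : Type*} [NormedAddCommGroup E'] [NormedSpace ℝ E']
  {H' : Type*} [TopologicalSpace H'] (J : ModelWithCorners ℝ E' H')
  {Y : Type*} [TopologicalSpace Y] [ChartedSpace H' Y]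

/-- A boundary map `f : (X, D) → (Y, Z)`: a smooth strong map of pairs, with `D` a submanifold of
codimension at least two and `Z` a hypersurface, whose normal Hessian `Sym² ND → f^* NZ` is definite
along `D`. A local defining function `z` of `Z` trivializes `NZ` through `dz`, and the normal
Hessian then becomes the Hessian of `z ∘ f`; changing `z` multiplies it by a nonzero number. -/
structure IsBoundaryMap (f : X → Y) (D : Set X) (Z : Set Y) : Prop where
  smooth : ContMDiff I J ∞ f
  preimage_eq : f ⁻¹' Z = D
  source_submanifold : ∀ p ∈ D, ∃ c : ℕ, 2 ≤ c ∧ IsSubmanifoldAt I c D p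
  target_hypersurface : ∀ y ∈ Z, IsSubmanifoldAt J 1 Z y
  normal_hessian_definite : ∀ p ∈ D, ∀ (V : Set Y) (z : Y → ℝ), f p ∈ V → IsDefiningMap J Z V z →
    IsNormallyDefinite I D p (fun v => hessianAt I (z ∘ f) p v v)

/-- A fibrating boundary map: a boundary map whose restriction `D → Z` is submersive. -/
structure IsFibratingBoundaryMap (f : X → Y) (D : Set X) (Z : Set Y) : Prop
    extends IsBoundaryMap I J f D Z where
  fibrating : ∀ p ∈ D, ∀ w ∈ subTangent J Z (f p), ∃ v ∈ subTangent I D p, mfderiv I J f p v = w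

end BoundaryMaps

end

/-!
Fix the component `S = D_j` and its image `T = Z_j`. Components of `D` are open in `D`, and as `f`
restricts to a submersion `D → Z`, the set `T` is open in `Z`; so `S` and `T` are compact
submanifolds. A coorientation allows local defining functions of `T` to be chosen with consistent
signs, and their sum with cutoffs is a defining function `z` (`IsCoorientable.exists_isDefiningAt`).
The function `g = z ∘ f` is critical along `S`, because its zero set has codimension at least two,
and its normal Hessian, definite at each point, has constant sign on the connected set `S`. Replacing
`z` by `-z` makes it positive (`IsFibratingBoundaryMap.exists_isFibredMinimum`).

Tubular neighbourhoods are described by equations instead of exponential maps. Let `π` be a smooth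
retraction of a neighbourhood of `S` onto `S`, and `w` a map to a vector space, vanishing on `S`,
whose derivatives along `S` are injective on normal spaces and such that `w x` lies in the range of
the derivative `dw` at `π x`. Then the equations `π x = p` and `w x = dw_p v` define a tubular
neighbourhood embedding `[v] ↦ x` (`IsTubularData.exists_isTubularEmbedding`). For the hypersurface
`T` one takes `w = z`.

Retractions are glued by interpolating in coordinates of the fibres; applied to the fibres
`{s ∈ S | f s = π (f x)}` this yields a retraction `ρ` onto `S` lifting a given retraction `π` onto
`T`, that is with `f ∘ ρ = π ∘ f` (`exists_lift_retraction`). Using `ρ` and `π` in the two tubular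
neighbourhoods makes `f` compatible with the bundle projections.

It remains to choose `w` for `S` such that `g` becomes its Hessian; this is the Morse–Bott lemma
relative to the retraction `ρ` (`exists_isTubularData_hessian`). The normal bundle of `S` is embedded
in a trivial bundle with Euclidean fibre, which gives a first map `v` with all properties required of
`w`. By Hadamard's lemma, and because the conditions are convex, `g x = ½ ⟨G x (v x), v x⟩` for a
smooth family of symmetric operators `G x`, positive along `S` and compatible with the projection to
the normal spaces. Put `N x = G (ρ x)`, let `A x` be the square root close to the identity of
`(N x)⁻¹ G x`, and `w x = A x (v x)`. Square roots close to the identity are unique, hence `A x` is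
self-adjoint for the form `N x` and preserves the normal spaces, so that
`g x = ½ ⟨N x (w x), w x⟩`. As `dw = dv` along `S`, the right-hand side is half the normal Hessian of
`g` at `ρ x`, evaluated at the normal vector corresponding to `x`.
-/

-- needed to find norms on iterated spaces of continuous linear maps
set_option maxSynthPendingDepth 3


/-! ### Germs of smooth maps and the inverse function theorem -/

section SmoothNear

variable {E : Type*} [NormedAddCommGroup E] [NormedSpace ℝ E]
  {H : Type*} [TopologicalSpace H] {I : ModelWithCorners ℝ E H}
  {M : Type*} [TopologicalSpace M] [ChartedSpace H M]
  {E' : Type*} [NormedAddCommGroup E'] [NormedSpace ℝ E']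
  {H' : Type*} [TopologicalSpace H'] {J : ModelWithCorners ℝ E' H'}
  {N : Type*} [TopologicalSpace N] [ChartedSpace H' N]
  {E'' : Type*} [NormedAddCommGroup E''] [NormedSpace ℝ E'']
  {H'' : Type*} [TopologicalSpace H''] {K : ModelWithCorners ℝ E'' H''}
  {P : Type*} [TopologicalSpace P] [ChartedSpace H'' P]
  {F : Type*} [NormedAddCommGroup F] [NormedSpace ℝ F]
  {G : Type*} [NormedAddCommGroup G] [NormedSpace ℝ G]

variable (I J) in
/-- `f` is smooth on some neighbourhood of `p`. This is stronger than `ContMDiffAt I J ∞ f p`, which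
only provides a neighbourhood for each finite order of differentiability. -/
def SmoothNear (f : M → N) (p : M) : Prop := ∀ᶠ x in 𝓝 p, ContMDiffAt I J ∞ f x

theorem SmoothNear.contMDiffAt {f : M → N} {p : M} (h : SmoothNear I J f p) :
    ContMDiffAt I J ∞ f p := h.self_of_nhds

theorem SmoothNear.continuousAt {f : M → N} {p : M} (h : SmoothNear I J f p) :
    ContinuousAt f p := h.contMDiffAt.continuousAt

theorem SmoothNear.mdifferentiableAt {f : M → N} {p : M} (h : SmoothNear I J f p) :
    MDifferentiableAt I J f p := h.contMDiffAt.mdifferentiableAt (by simp)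

theorem SmoothNear.eventually {f : M → N} {p : M} (h : SmoothNear I J f p) :
    ∀ᶠ x in 𝓝 p, SmoothNear I J f x := eventually_eventually_nhds.2 h

theorem SmoothNear.congr {f g : M → N} {p : M} (h : SmoothNear I J f p)
    (hfg : ∀ᶠ x in 𝓝 p, g x = f x) : SmoothNear I J g p := by
  filter_upwards [h, eventually_eventually_nhds.2 hfg] with x hx hx'
  exact hx.congr_of_eventuallyEq hx'

theorem SmoothNear.comp {f : M → N} {g : N → P} {p : M} (hg : SmoothNear J K g (f p))
    (hf : SmoothNear I J f p) : SmoothNear I K (fun x => g (f x)) p := by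
  filter_upwards [hf, hf.continuousAt.eventually hg] with x hx hx'
  exact ContMDiffAt.comp x hx' hx

/-- Variant of `SmoothNear.comp` in which the value of the inner map is given separately. -/
theorem SmoothNear.comp_of_eq {f : M → N} {g : N → P} {p : M} {q : N} (hg : SmoothNear J K g q)
    (hf : SmoothNear I J f p) (hq : f p = q) : SmoothNear I K (fun x => g (f x)) p := by
  subst hq; exact hg.comp hf

theorem ContMDiff.smoothNear {f : M → N} (h : ContMDiff I J ∞ f) (p : M) : SmoothNear I J f p :=
  Eventually.of_forall h

theorem ContMDiffOn.smoothNear {f : M → N} {U : Set M} (h : ContMDiffOn I J ∞ f U)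
    {p : M} (hU : U ∈ 𝓝 p) : SmoothNear I J f p := by
  filter_upwards [eventually_mem_nhds_iff.2 hU] with x hx
  exact h.contMDiffAt hx

theorem smoothNear_const (c : N) (p : M) : SmoothNear I J (fun _ => c) p :=
  contMDiff_const.smoothNear p

theorem ContDiff.smoothNear {f : F → G} (h : ContDiff ℝ ∞ f) (p : F) :
    SmoothNear 𝓘(ℝ, F) 𝓘(ℝ, G) f p := h.contMDiff.smoothNear p

theorem smoothNear_iff_contDiffAt {f : F → G} {p : F} :
    SmoothNear 𝓘(ℝ, F) 𝓘(ℝ, G) f p ↔ ∀ᶠ x in 𝓝 p, ContDiffAt ℝ ∞ f x := by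
  simp only [SmoothNear, contMDiffAt_iff_contDiffAt]

theorem SmoothNear.prodMk {f : M → F} {g : M → G} {p : M} (hf : SmoothNear I 𝓘(ℝ, F) f p)
    (hg : SmoothNear I 𝓘(ℝ, G) g p) : SmoothNear I 𝓘(ℝ, F × G) (fun x => (f x, g x)) p := by
  filter_upwards [hf, hg] with x hx hx' using hx.prodMk_space hx'

theorem SmoothNear.clm (L : F →L[ℝ] G) {f : M → F} {p : M} (hf : SmoothNear I 𝓘(ℝ, F) f p) :
    SmoothNear I 𝓘(ℝ, G) (fun x => L (f x)) p :=
  SmoothNear.comp (L.contDiff.smoothNear _) hf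

theorem SmoothNear.clm_apply {A : M → F →L[ℝ] G} {f : M → F} {p : M}
    (hA : SmoothNear I 𝓘(ℝ, F →L[ℝ] G) A p) (hf : SmoothNear I 𝓘(ℝ, F) f p) :
    SmoothNear I 𝓘(ℝ, G) (fun x => A x (f x)) p := by
  filter_upwards [hA, hf] with x hx hx' using hx.clm_apply hx'

theorem SmoothNear.clm_comp {L : Type*} [NormedAddCommGroup L] [NormedSpace ℝ L]
    {A : M → F →L[ℝ] G} {B : M → L →L[ℝ] F} {p : M}
    (hA : SmoothNear I 𝓘(ℝ, F →L[ℝ] G) A p) (hB : SmoothNear I 𝓘(ℝ, L →L[ℝ] F) B p) :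
    SmoothNear I 𝓘(ℝ, L →L[ℝ] G) (fun x => (A x).comp (B x)) p := by
  filter_upwards [hA, hB] with x hx hx' using hx.clm_comp hx'

theorem SmoothNear.add {f g : M → F} {p : M} (hf : SmoothNear I 𝓘(ℝ, F) f p)
    (hg : SmoothNear I 𝓘(ℝ, F) g p) : SmoothNear I 𝓘(ℝ, F) (fun x => f x + g x) p := by
  filter_upwards [hf, hg] with x hx hx' using hx.add hx'

theorem SmoothNear.sub {f g : M → F} {p : M} (hf : SmoothNear I 𝓘(ℝ, F) f p)
    (hg : SmoothNear I 𝓘(ℝ, F) g p) : SmoothNear I 𝓘(ℝ, F) (fun x => f x - g x) p := by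
  filter_upwards [hf, hg] with x hx hx' using hx.sub hx'

theorem SmoothNear.smul {χ : M → ℝ} {g : M → F} {p : M} (hf : SmoothNear I 𝓘(ℝ, ℝ) χ p)
    (hg : SmoothNear I 𝓘(ℝ, F) g p) : SmoothNear I 𝓘(ℝ, F) (fun x => χ x • g x) p := by
  filter_upwards [hf, hg] with x hx hx' using hx.smul hx'

/-- The derivative of a map between vector spaces which is smooth near `p` is smooth near `p`. -/
theorem SmoothNear.fderiv {f : F → G} {p : F} (hf : SmoothNear 𝓘(ℝ, F) 𝓘(ℝ, G) f p) :
    SmoothNear 𝓘(ℝ, F) 𝓘(ℝ, F →L[ℝ] G) (fderiv ℝ f) p := by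
  rw [smoothNear_iff_contDiffAt] at *
  filter_upwards [hf] with x hx
  exact hx.fderiv_right (by simp)

/-- Inversion of linear maps is smooth at every point where the map is invertible. -/
theorem SmoothNear.clm_inverse [CompleteSpace F] {A : M → F →L[ℝ] G} {p : M}
    (hA : SmoothNear I 𝓘(ℝ, F →L[ℝ] G) A p) (hp : (A p).IsInvertible) :
    SmoothNear I 𝓘(ℝ, G →L[ℝ] F) (fun x => (A x).inverse) p := by
  refine SmoothNear.comp (g := ContinuousLinearMap.inverse) ?_ hA
  obtain ⟨e, he⟩ := hp
  have : range ((↑) : (F ≃L[ℝ] G) → F →L[ℝ] G) ∈ 𝓝 (A p) := by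
    rw [← he]; exact ContinuousLinearEquiv.nhds e
  rw [smoothNear_iff_contDiffAt]
  filter_upwards [this] with B hB
  obtain ⟨e', rfl⟩ := hB
  exact contDiffAt_map_inverse e'

/-- Invertibility of a linear map is an open condition. -/
theorem SmoothNear.eventually_isInvertible [CompleteSpace F] {A : M → F →L[ℝ] G} {p : M}
    (hA : ContinuousAt A p) (hp : (A p).IsInvertible) :
    ∀ᶠ x in 𝓝 p, (A x).IsInvertible := by
  obtain ⟨e, he⟩ := hp
  have : range ((↑) : (F ≃L[ℝ] G) → F →L[ℝ] G) ∈ 𝓝 (A p) := by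
    rw [← he]; exact ContinuousLinearEquiv.nhds e
  filter_upwards [hA.eventually this] with x hx
  exact hx

theorem smoothNear_extChartAt [IsManifold I ∞ M] (p : M) :
    SmoothNear I 𝓘(ℝ, E) (extChartAt I p) p :=
  ContMDiffOn.smoothNear (contMDiffOn_extChartAt (I := I) (x := p))
    ((chartAt H p).open_source.mem_nhds (mem_chart_source H p))

theorem extChartAt_target_mem_nhds_of_isInteriorPoint {p : M} (hp : I.IsInteriorPoint p) :
    (extChartAt I p).target ∈ 𝓝 (extChartAt I p p) := by
  have h1 := extChartAt_target_mem_nhdsWithin (I := I) p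
  rwa [nhdsWithin_eq_nhds.2 (range_mem_nhds_isInteriorPoint hp)] at h1

theorem smoothNear_extChartAt_symm [IsManifold I ∞ M] {p : M} (hp : I.IsInteriorPoint p) :
    SmoothNear 𝓘(ℝ, E) I (extChartAt I p).symm (extChartAt I p p) :=
  ContMDiffOn.smoothNear (contMDiffOn_extChartAt_symm p)
    (extChartAt_target_mem_nhds_of_isInteriorPoint hp)

variable (I) in
/-- The manifold derivative of a map to a vector space, as a linear map between the model spaces. -/
noncomputable def vderiv (f : M → F) (p : M) : E →L[ℝ] F := mfderiv I 𝓘(ℝ, F) f p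

variable (I) in
/-- The manifold derivative of a map from a vector space, as a linear map between the model
spaces. -/
noncomputable def cderiv (θ : F → M) (y : F) : F →L[ℝ] E := mfderiv 𝓘(ℝ, F) I θ y

theorem vderiv_eq_fderiv_of_isInteriorPoint {f : M → F} {p : M} (hp : I.IsInteriorPoint p)
    (hf : MDifferentiableAt I 𝓘(ℝ, F) f p) :
    vderiv I f p = fderiv ℝ (f ∘ (extChartAt I p).symm) (extChartAt I p p) := by
  refine hf.mfderiv.trans ?_
  exact fderivWithin_of_mem_nhds (range_mem_nhds_isInteriorPoint hp)

theorem fderiv_comp_eq {f : M → G} {θ : F → M} {y : F} (hf : MDifferentiableAt I 𝓘(ℝ, G) f (θ y))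
    (hθ : MDifferentiableAt 𝓘(ℝ, F) I θ y) (b : F) :
    fderiv ℝ (fun y => f (θ y)) y b = vderiv I f (θ y) (cderiv I θ y b) := by
  have h := mfderiv_comp y hf hθ
  rw [mfderiv_eq_fderiv] at h
  exact DFunLike.congr_fun h b

theorem vderiv_comp_eq {f : N → F} {q : M → N} {x : M} (hf : MDifferentiableAt J 𝓘(ℝ, F) f (q x))
    (hq : MDifferentiableAt I J q x) (u : TangentSpace I x) :
    vderiv I (fun x => f (q x)) x u = vderiv J f (q x) (mfderiv I J q x u) := by
  have h := mfderiv_comp x hf hq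
  exact DFunLike.congr_fun h u

theorem vderiv_fderiv_comp {f : F → G} {q : M → F} {x : M} (hf : DifferentiableAt ℝ f (q x))
    (hq : MDifferentiableAt I 𝓘(ℝ, F) q x) (u : E) :
    vderiv I (fun x => f (q x)) x u = fderiv ℝ f (q x) (vderiv I q x u) := by
  have h := mfderiv_comp x hf.mdifferentiableAt hq
  rw [mfderiv_eq_fderiv] at h
  exact DFunLike.congr_fun h u

theorem vderiv_prodMk {f : M → F} {g : M → G} {x : M} (hf : MDifferentiableAt I 𝓘(ℝ, F) f x)
    (hg : MDifferentiableAt I 𝓘(ℝ, G) g x) (u : E) :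
    vderiv I (fun x => (f x, g x)) x u = (vderiv I f x u, vderiv I g x u) := by
  have h1 : MDifferentiableAt I 𝓘(ℝ, F × G) (fun x => (f x, g x)) x := hf.prodMk_space hg
  have e1 := vderiv_fderiv_comp (f := Prod.fst) differentiableAt_fst h1 u
  have e2 := vderiv_fderiv_comp (f := Prod.snd) differentiableAt_snd h1 u
  rw [fderiv_fst] at e1
  rw [fderiv_snd] at e2
  exact Prod.ext e1.symm e2.symm

theorem vderiv_clm (L : F →L[ℝ] G) {q : M → F} {x : M} (hq : MDifferentiableAt I 𝓘(ℝ, F) q x)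
    (u : E) : vderiv I (fun x => L (q x)) x u = L (vderiv I q x u) := by
  rw [vderiv_fderiv_comp L.differentiableAt hq, L.fderiv]

theorem vderiv_congr {f g : M → F} {x : M} (h : ∀ᶠ y in 𝓝 x, f y = g y) :
    vderiv I f x = vderiv I g x :=
  Filter.EventuallyEq.mfderiv_eq h

theorem vderiv_const (c : F) (x : M) : vderiv I (fun _ : M => c) x = 0 := mfderiv_const

/-- If `θ` is locally a left inverse of `f`, its derivative is a left inverse of that of `f`. -/
theorem cderiv_vderiv_of_leftInverse {f : M → F} {θ : F → M} {x : M}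
    (hf : MDifferentiableAt I 𝓘(ℝ, F) f x) (hθ : MDifferentiableAt 𝓘(ℝ, F) I θ (f x))
    (h : ∀ᶠ y in 𝓝 x, θ (f y) = y) (u : E) : cderiv I θ (f x) (vderiv I f x u) = u := by
  have h1 := mfderiv_comp x hθ hf
  have h2 : mfderiv I I (θ ∘ f) x = mfderiv I I id x := Filter.EventuallyEq.mfderiv_eq h
  rw [mfderiv_id] at h2
  have h3 := h1.symm.trans h2
  exact DFunLike.congr_fun h3 u

/-- The inverse function theorem for germs of smooth maps between vector spaces. -/
theorem exists_smoothNear_inverse [CompleteSpace F] {f : F → G} {a : F}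
    (hf : SmoothNear 𝓘(ℝ, F) 𝓘(ℝ, G) f a) (hf' : (fderiv ℝ f a).IsInvertible) :
    ∃ g : G → F, g (f a) = a ∧ SmoothNear 𝓘(ℝ, G) 𝓘(ℝ, F) g (f a) ∧ (∀ᶠ x in 𝓝 a, g (f x) = x) ∧
      ∀ᶠ y in 𝓝 (f a), f (g y) = y := by
  obtain ⟨e, he⟩ := hf'
  have hfa : ContDiffAt ℝ ∞ f a := contMDiffAt_iff_contDiffAt.1 hf.contMDiffAt
  have hd : HasFDerivAt f (e : F →L[ℝ] G) a := by
    rw [he]; exact (hfa.differentiableAt (by simp)).hasFDerivAt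
  set Φ := hfa.toOpenPartialHomeomorph f hd (by simp) with hΦ
  have ha : a ∈ Φ.source := hfa.mem_toOpenPartialHomeomorph_source hd (by simp)
  have hcoe : (Φ : F → G) = f := rfl
  have hfa' : f a ∈ Φ.target := Φ.map_source ha
  have hsa : Φ.symm (f a) = a := Φ.left_inv ha
  have hcs : ContinuousAt Φ.symm (f a) := Φ.continuousAt_symm hfa'
  refine ⟨Φ.symm, hsa, ?_, Φ.eventually_left_inverse ha, Φ.eventually_right_inverse hfa'⟩
  rw [smoothNear_iff_contDiffAt] at hf ⊢
  have hinv : ∀ᶠ x in 𝓝 a, (_root_.fderiv ℝ f x).IsInvertible := by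
    refine SmoothNear.eventually_isInvertible
      (A := _root_.fderiv ℝ f) (p := a) ?_ ⟨e, he⟩
    exact (hfa.fderiv_right (m := ∞) (by simp)).continuousAt
  have h1 := hcs.eventually (by rw [hsa]; exact hf.and hinv)
  filter_upwards [h1, Φ.open_target.mem_nhds hfa'] with y hy hyt
  obtain ⟨e', he'⟩ := hy.2
  refine Φ.contDiffAt_symm (f₀' := e') hyt ?_ hy.1
  rw [he']
  exact (hy.1.differentiableAt (by simp)).hasFDerivAt

/-- The inverse function theorem for a germ of a smooth map from a manifold, at an interior point,
to a vector space. -/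
theorem exists_smoothNear_inverse_of_bijective [IsManifold I ∞ M] [FiniteDimensional ℝ E]
    [FiniteDimensional ℝ F]
    {f : M → F} {p : M} (hp : I.IsInteriorPoint p) (hf : SmoothNear I 𝓘(ℝ, F) f p)
    (hf' : Function.Bijective (vderiv I f p)) :
    ∃ g : F → M, g (f p) = p ∧ SmoothNear 𝓘(ℝ, F) I g (f p) ∧ (∀ᶠ x in 𝓝 p, g (f x) = x) ∧
      ∀ᶠ y in 𝓝 (f p), f (g y) = y := by
  set φ := extChartAt I p
  have hφp : φ.symm (φ p) = p := extChartAt_to_inv p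
  have hs : SmoothNear 𝓘(ℝ, E) 𝓘(ℝ, F) (fun y => f (φ.symm y)) (φ p) :=
    hf.comp_of_eq (smoothNear_extChartAt_symm hp) hφp
  rw [vderiv_eq_fderiv_of_isInteriorPoint hp hf.mdifferentiableAt] at hf'
  have hinv : (fderiv ℝ (fun y => f (φ.symm y)) (φ p)).IsInvertible :=
    ⟨(LinearEquiv.ofBijective _ hf').toContinuousLinearEquiv, by ext; rfl⟩
  obtain ⟨g, hg0, hg, hgl, hgr⟩ := exists_smoothNear_inverse hs hinv
  simp only [hφp] at hg0 hg hgr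
  refine ⟨fun y => φ.symm (g y), by simp only [hg0, hφp],
    (smoothNear_extChartAt_symm hp).comp_of_eq hg hg0, ?_, hgr⟩
  filter_upwards [(continuousAt_extChartAt (I := I) p).eventually hgl,
    extChartAt_source_mem_nhds (I := I) p] with x hx hxs
  have h2 : φ.symm (φ x) = x := φ.left_inv hxs
  have hx' : g (f (φ.symm (φ x))) = φ x := hx
  rw [h2] at hx'
  rw [hx', h2]

end SmoothNear


/-! ### Adapted coordinates for submanifolds -/

section Coordinates

variable {E : Type*} [NormedAddCommGroup E] [NormedSpace ℝ E]
  {H : Type*} [TopologicalSpace H] {I : ModelWithCorners ℝ E H}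
  {M : Type*} [TopologicalSpace M] [ChartedSpace H M]
  {B : Type*} [NormedAddCommGroup B] [NormedSpace ℝ B]
  {K : Type*} [NormedAddCommGroup K] [NormedSpace ℝ K]
  {F : Type*} [NormedAddCommGroup F] [NormedSpace ℝ F]

variable (I) in
/-- `(h, k)` is a system of smooth coordinates near `p`, with inverse `θ`. -/
structure IsLocalCoordinates (p : M) (h : M → B) (k : M → K) (θ : B × K → M) : Prop where
  smooth_fst : SmoothNear I 𝓘(ℝ, B) h p
  smooth_snd : SmoothNear I 𝓘(ℝ, K) k p
  smooth_inv : SmoothNear 𝓘(ℝ, B × K) I θ (h p, k p)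
  left_inv : ∀ᶠ x in 𝓝 p, θ (h x, k x) = x
  right_inv : ∀ᶠ y in 𝓝 (h p, k p), h (θ y) = y.1 ∧ k (θ y) = y.2

namespace IsLocalCoordinates

variable {p : M} {h : M → B} {k : M → K} {θ : B × K → M}

theorem smooth_prod (c : IsLocalCoordinates I p h k θ) :
    SmoothNear I 𝓘(ℝ, B × K) (fun x => (h x, k x)) p := c.smooth_fst.prodMk c.smooth_snd

theorem inv_self (c : IsLocalCoordinates I p h k θ) : θ (h p, k p) = p := c.left_inv.self_of_nhds

theorem tendsto_inv (c : IsLocalCoordinates I p h k θ) : Tendsto θ (𝓝 (h p, k p)) (𝓝 p) := by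
  have := c.smooth_inv.continuousAt.tendsto
  rwa [c.inv_self] at this

/-- Coordinates near `p` are coordinates near all points near `p`. -/
theorem eventually (c : IsLocalCoordinates I p h k θ) :
    ∀ᶠ x in 𝓝 p, IsLocalCoordinates I x h k θ := by
  have hc := c.smooth_prod.continuousAt
  filter_upwards [c.smooth_fst.eventually, c.smooth_snd.eventually,
    hc.eventually c.smooth_inv.eventually, eventually_eventually_nhds.2 c.left_inv,
    hc.eventually (eventually_eventually_nhds.2 c.right_inv)] with x h1 h2 h3 h4 h5
  exact ⟨h1, h2, h3, h4, h5⟩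

theorem cderiv_vderiv (c : IsLocalCoordinates I p h k θ) (u : E) :
    cderiv I θ (h p, k p) (vderiv I h p u, vderiv I k p u) = u := by
  have := cderiv_vderiv_of_leftInverse (f := fun x => (h x, k x)) c.smooth_prod.mdifferentiableAt
    c.smooth_inv.mdifferentiableAt c.left_inv u
  rwa [vderiv_prodMk c.smooth_fst.mdifferentiableAt c.smooth_snd.mdifferentiableAt] at this

theorem vderiv_fst_cderiv (c : IsLocalCoordinates I p h k θ) (y : B × K) :
    vderiv I h p (cderiv I θ (h p, k p) y) = y.1 := by
  have h1 := fderiv_comp_eq (f := h) (θ := θ) (y := (h p, k p))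
    (by rw [c.inv_self]; exact c.smooth_fst.mdifferentiableAt) c.smooth_inv.mdifferentiableAt y
  rw [c.inv_self] at h1
  have h2 : (fun y => h (θ y)) =ᶠ[𝓝 (h p, k p)] Prod.fst := c.right_inv.mono fun y hy => hy.1
  rw [← h1, h2.fderiv_eq, fderiv_fst]
  rfl

theorem vderiv_snd_cderiv (c : IsLocalCoordinates I p h k θ) (y : B × K) :
    vderiv I k p (cderiv I θ (h p, k p) y) = y.2 := by
  have h1 := fderiv_comp_eq (f := k) (θ := θ) (y := (h p, k p))
    (by rw [c.inv_self]; exact c.smooth_snd.mdifferentiableAt) c.smooth_inv.mdifferentiableAt y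
  rw [c.inv_self] at h1
  have h2 : (fun y => k (θ y)) =ᶠ[𝓝 (h p, k p)] Prod.snd := c.right_inv.mono fun y hy => hy.2
  rw [← h1, h2.fderiv_eq, fderiv_snd]
  rfl

end IsLocalCoordinates

/-- A submersion germ at an interior point is the first part of a coordinate system. -/
theorem exists_isLocalCoordinates [IsManifold I ∞ M] [FiniteDimensional ℝ E]
    [FiniteDimensional ℝ B] {p : M} (hp : I.IsInteriorPoint p) {h : M → B}
    (hs : SmoothNear I 𝓘(ℝ, B) h p) (hsurj : Function.Surjective (vderiv I h p)) :
    ∃ (K : Submodule ℝ E) (k : M → K) (θ : B × K → M), IsLocalCoordinates I p h k θ := by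
  set L := vderiv I h p with hL
  obtain ⟨Pr, hPr⟩ := Submodule.ClosedComplemented.of_finiteDimensional L.ker
  set φ := extChartAt I p with hφ
  have hφs : SmoothNear I 𝓘(ℝ, E) φ p := smoothNear_extChartAt p
  have hdφ : vderiv I φ p = ContinuousLinearMap.id ℝ E := by
    rw [vderiv_eq_fderiv_of_isInteriorPoint hp hφs.mdifferentiableAt]
    have : (φ ∘ (extChartAt I p).symm) =ᶠ[𝓝 (extChartAt I p p)] id := by
      filter_upwards [extChartAt_target_mem_nhds_of_isInteriorPoint hp] with y hy
      exact φ.right_inv hy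
    rw [this.fderiv_eq, fderiv_id]
  have hks : SmoothNear I 𝓘(ℝ, L.ker) (fun x => Pr (φ x)) p := hφs.clm Pr
  have hdk (u : E) : vderiv I (fun x => Pr (φ x)) p u = Pr u := by
    rw [vderiv_clm Pr hφs.mdifferentiableAt, hdφ]; rfl
  have hbij : Function.Bijective (vderiv I (fun x => (h x, Pr (φ x))) p) := by
    have e (u : E) : vderiv I (fun x => (h x, Pr (φ x))) p u = (L u, Pr u) := by
      rw [vderiv_prodMk hs.mdifferentiableAt hks.mdifferentiableAt, hdk]
    constructor
    · rw [injective_iff_map_eq_zero]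
      intro u hu
      rw [e, Prod.mk_eq_zero] at hu
      exact congrArg Subtype.val ((hPr ⟨u, hu.1⟩).symm.trans hu.2)
    · rintro ⟨b, κ⟩
      obtain ⟨u, rfl⟩ := hsurj b
      refine ⟨u - (Pr u : E) + κ, ?_⟩
      have h1 : L (Pr u : E) = 0 := (Pr u).2
      have h2 : L (κ : E) = 0 := κ.2
      rw [e]
      simp [map_add, map_sub, hPr, h1, h2]
  obtain ⟨θ, -, hθ, hl, hr⟩ := exists_smoothNear_inverse_of_bijective hp (hs.prodMk hks) hbij
  exact ⟨L.ker, fun x => Pr (φ x), θ, hs, hks, hθ, hl, hr.mono fun y hy => Prod.ext_iff.1 hy⟩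

variable (I) in
/-- `h` is a defining map of `S` near the point `p` of `S`: it is smooth and submersive there, and
`S` is its zero set. -/
structure IsDefiningAt (S : Set M) (h : M → B) (p : M) : Prop where
  mem : p ∈ S
  smooth : SmoothNear I 𝓘(ℝ, B) h p
  zero_iff : ∀ᶠ x in 𝓝 p, (x ∈ S ↔ h x = 0)
  surjective : Function.Surjective (vderiv I h p)

theorem IsDefiningMap.isDefiningAt {S V : Set M} {h : M → B} (hh : IsDefiningMap I S V h) {p : M}
    (hV : p ∈ V) (hp : p ∈ S) : IsDefiningAt I S h p where
  mem := hp
  smooth := hh.smooth.smoothNear (hh.isOpen.mem_nhds hV)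
  zero_iff := by
    filter_upwards [hh.isOpen.mem_nhds hV] with x hx using hh.zero_iff x hx
  surjective := hh.submersive p ⟨hV, hp⟩

theorem IsSubmanifoldAt.exists_isDefiningAt {c : ℕ} {S : Set M} {p : M}
    (hS : IsSubmanifoldAt I c S p) (hp : p ∈ S) :
    ∃ h : M → EuclideanSpace ℝ (Fin c), IsDefiningAt I S h p :=
  let ⟨_, h, hpV, hh⟩ := hS
  ⟨h, hh.isDefiningAt hpV hp⟩

/-- A smooth map vanishing on `S` has derivative zero on the tangent space of `S`. -/
theorem vderiv_eq_zero_of_mem_subTangent {S : Set M} {p : M} {f : M → F}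
    (hf : ContMDiffAt I 𝓘(ℝ, F) ∞ f p) (h0 : ∀ᶠ x in 𝓝[S] p, f x = 0) {v : TangentSpace I p}
    (hv : v ∈ subTangent I S p) : vderiv I f p v = 0 := by
  refine SeparatingDual.eq_zero_of_forall_dual_eq_zero (R := ℝ) fun L => ?_
  refine (vderiv_clm L (hf.mdifferentiableAt (by simp)) v).symm.trans ?_
  exact hv (fun x => L (f x)) (L.contDiff.contMDiff.contMDiffAt.comp p hf)
    (h0.mono fun x hx => by rw [hx, map_zero])

namespace IsDefiningAt

variable {S : Set M} {h : M → B} {p : M} {k : M → K} {θ : B × K → M}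

theorem map_eq_zero (hd : IsDefiningAt I S h p) : h p = 0 := hd.zero_iff.self_of_nhds.1 hd.mem

/-- The points with vanishing first coordinate lie on `S`. -/
theorem eventually_inv_mem (hd : IsDefiningAt I S h p) (c : IsLocalCoordinates I p h k θ) :
    ∀ᶠ κ in 𝓝 (k p), θ (0, κ) ∈ S := by
  have h1 : ∀ᶠ y in 𝓝 (h p, k p), y.1 = 0 → θ y ∈ S := by
    filter_upwards [c.tendsto_inv.eventually hd.zero_iff, c.right_inv] with y hy hy' h0
    rw [hy, hy'.1, h0]
  have h2 : Tendsto (fun κ => ((0 : B), κ)) (𝓝 (k p)) (𝓝 (h p, k p)) := by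
    rw [hd.map_eq_zero]; exact (Continuous.prodMk_right (0 : B)).continuousAt
  exact (h2.eventually h1).mono fun κ hκ => hκ rfl

/-- The derivative of a map vanishing on `S` kills the tangential coordinate directions. -/
theorem vderiv_cderiv_tangential (hd : IsDefiningAt I S h p) (c : IsLocalCoordinates I p h k θ)
    {f : M → F} (hf : MDifferentiableAt I 𝓘(ℝ, F) f p) (h0 : ∀ᶠ x in 𝓝 p, x ∈ S → f x = 0)
    (κ : K) : vderiv I f p (cderiv I θ (h p, k p) (0, κ)) = 0 := by
  have h1 := fderiv_comp_eq (f := f) (θ := θ) (y := (h p, k p)) (by rwa [c.inv_self])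
    c.smooth_inv.mdifferentiableAt (0, κ)
  rw [c.inv_self] at h1
  rw [← h1]
  have hdiff : DifferentiableAt ℝ (fun y => f (θ y)) (h p, k p) := by
    have : MDifferentiableAt 𝓘(ℝ, B × K) 𝓘(ℝ, F) (fun y => f (θ y)) (h p, k p) :=
      MDifferentiableAt.comp (I' := I) (h p, k p) (by rwa [c.inv_self])
        c.smooth_inv.mdifferentiableAt
    exact this.differentiableAt
  have h2 : HasFDerivAt (fun κ => f (θ (0, κ)))
      ((fderiv ℝ (fun y => f (θ y)) (h p, k p)).comp (ContinuousLinearMap.inr ℝ B K)) (k p) := by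
    have h3 := hdiff.hasFDerivAt
    rw [hd.map_eq_zero] at h3 ⊢
    exact h3.comp (k p) (hasFDerivAt_prodMk_right (0 : B) (k p))
  have h4 : (fun κ => f (θ (0, κ))) =ᶠ[𝓝 (k p)] fun _ => 0 := by
    have h5 : Tendsto (fun κ => θ ((0 : B), κ)) (𝓝 (k p)) (𝓝 p) := by
      have := c.tendsto_inv
      rw [hd.map_eq_zero] at this
      exact this.comp (Continuous.prodMk_right (0 : B)).continuousAt
    filter_upwards [hd.eventually_inv_mem c, h5.eventually h0] with κ h6 h7 using h7 h6
  have h8 := h2.unique ((hasFDerivAt_const (0 : F) (k p)).congr_of_eventuallyEq h4)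
  exact DFunLike.congr_fun h8 κ

/-- The tangent space of a submanifold is the kernel of the derivative of a defining map. -/
theorem mem_subTangent_iff [IsManifold I ∞ M] [FiniteDimensional ℝ E] [FiniteDimensional ℝ B]
    (hd : IsDefiningAt I S h p) (hp : I.IsInteriorPoint p) (v : TangentSpace I p) :
    v ∈ subTangent I S p ↔ vderiv I h p v = 0 := by
  constructor
  · exact vderiv_eq_zero_of_mem_subTangent hd.smooth.contMDiffAt
      ((hd.zero_iff.filter_mono nhdsWithin_le_nhds).mp
        (eventually_mem_nhdsWithin.mono fun x hx hx' => hx'.1 hx))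
  · intro hv g hg h0
    obtain ⟨K, k, θ, c⟩ := exists_isLocalCoordinates hp hd.smooth hd.surjective
    have h1 := hd.vderiv_cderiv_tangential c (hg.mdifferentiableAt (by simp))
      (eventually_nhdsWithin_iff.1 h0) (vderiv I k p v)
    have h2 := c.cderiv_vderiv v
    rw [hv] at h2
    rw [h2] at h1
    exact h1

theorem eventually [IsManifold I ∞ M] [FiniteDimensional ℝ E] [FiniteDimensional ℝ B]
    (hd : IsDefiningAt I S h p) (hp : I.IsInteriorPoint p) :
    ∀ᶠ x in 𝓝 p, x ∈ S → IsDefiningAt I S h x := by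
  obtain ⟨K, k, θ, c⟩ := exists_isLocalCoordinates hp hd.smooth hd.surjective
  filter_upwards [c.eventually, eventually_eventually_nhds.2 hd.zero_iff] with x hc hz hx
  exact ⟨hx, hc.smooth_fst, hz, fun b => ⟨_, hc.vderiv_fst_cderiv (b, 0)⟩⟩

/-- If `f` vanishes on `S` and its derivative at `p ∈ S` kills tangent vectors of `S` only, then `S`
is the zero set of `f` near `p`. -/
theorem eventually_mem_of_ker_le [IsManifold I ∞ M] [FiniteDimensional ℝ E]
    [FiniteDimensional ℝ B] [FiniteDimensional ℝ F] (hd : IsDefiningAt I S h p)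
    (hp : I.IsInteriorPoint p) {f : M → F} (hf : SmoothNear I 𝓘(ℝ, F) f p)
    (h0 : ∀ᶠ x in 𝓝 p, x ∈ S → f x = 0)
    (hker : ∀ v : TangentSpace I p, vderiv I f p v = 0 → v ∈ subTangent I S p) :
    ∀ᶠ x in 𝓝 p, f x = 0 → x ∈ S := by
  obtain ⟨K, k, θ, c⟩ := exists_isLocalCoordinates hp hd.smooth hd.surjective
  have htan := hd.vderiv_cderiv_tangential c hf.mdifferentiableAt h0
  set N : B →L[ℝ] F := ((vderiv I f p).comp (cderiv I θ (h p, k p))).comp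
    (ContinuousLinearMap.inl ℝ B K) with hN
  have hNinj : LinearMap.ker (N : B →ₗ[ℝ] F) = ⊥ := by
    rw [LinearMap.ker_eq_bot']
    intro b hb
    have h1 := (hd.mem_subTangent_iff hp _).1 (hker _ hb)
    exact (c.vderiv_fst_cderiv (b, 0)).symm.trans h1
  obtain ⟨L, hL⟩ := LinearMap.exists_leftInverse_of_injective (N : B →ₗ[ℝ] F) hNinj
  set L' : F →L[ℝ] B := LinearMap.toContinuousLinearMap L
  have hLN (b : B) : L' (N b) = b := LinearMap.congr_fun hL b
  -- `(L' ∘ f, k)` is injective near `p`, and agrees at `x` and at `θ (0, k x) ∈ S` if `f x = 0`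
  have hs : SmoothNear I 𝓘(ℝ, B × K) (fun x => (L' (f x), k x)) p :=
    (hf.clm L').prodMk c.smooth_snd
  have hder (y : B × K) :
      vderiv I (fun x => (L' (f x), k x)) p (cderiv I θ (h p, k p) y) = y := by
    rw [vderiv_prodMk (hf.clm L').mdifferentiableAt c.smooth_snd.mdifferentiableAt,
      vderiv_clm L' hf.mdifferentiableAt, c.vderiv_snd_cderiv]
    refine Prod.ext ?_ rfl
    have hy : y = (y.1, 0) + (0, y.2) := by simp
    calc L' (vderiv I f p (cderiv I θ (h p, k p) y))
        = L' (N y.1) := by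
          conv_lhs => rw [hy]
          rw [map_add, map_add, htan, add_zero]; rfl
      _ = y.1 := hLN _
  have hbij : Function.Bijective (vderiv I (fun x => (L' (f x), k x)) p) := by
    refine ⟨?_, fun y => ⟨_, hder y⟩⟩
    rw [injective_iff_map_eq_zero]
    intro u hu
    have h1 := hder (vderiv I h p u, vderiv I k p u)
    rw [c.cderiv_vderiv, hu] at h1
    rw [← c.cderiv_vderiv u, ← h1, map_zero]
  obtain ⟨g, -, -, hg, -⟩ := exists_smoothNear_inverse_of_bijective hp hs hbij
  have ht : Tendsto (fun x => θ ((0 : B), k x)) (𝓝 p) (𝓝 p) := by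
    have h1 := c.tendsto_inv
    rw [hd.map_eq_zero] at h1
    exact (h1.comp (Continuous.prodMk_right (0 : B)).continuousAt).comp c.smooth_snd.continuousAt
  have hr : ∀ᶠ x in 𝓝 p, k (θ (0, k x)) = k x := by
    have h1 := c.right_inv
    rw [hd.map_eq_zero] at h1
    exact (((Continuous.prodMk_right (0 : B)).continuousAt.comp
      c.smooth_snd.continuousAt).eventually h1).mono fun x hx => hx.2
  filter_upwards [hg, ht.eventually hg, hr, c.smooth_snd.continuousAt.eventually
    (hd.eventually_inv_mem c), ht.eventually h0] with x h1 h2 h3 h4 h5 h6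
  rw [h5 h4, h3, ← h6, h1] at h2
  exact h2 ▸ h4

end IsDefiningAt

/-! ### The Hessian of a function quadratic in a vanishing map -/

theorem SmoothNear.hasFDerivAt {f : E → F} {x : E} (hf : SmoothNear 𝓘(ℝ, E) 𝓘(ℝ, F) f x) :
    HasFDerivAt f (_root_.fderiv ℝ f x) x := hf.mdifferentiableAt.differentiableAt.hasFDerivAt

theorem SmoothNear.clm_flip {G : Type*} [NormedAddCommGroup G] [NormedSpace ℝ G]
    {A : M → F →L[ℝ] G →L[ℝ] ℝ} {p : M} (hA : SmoothNear I 𝓘(ℝ, F →L[ℝ] G →L[ℝ] ℝ) A p) :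
    SmoothNear I 𝓘(ℝ, G →L[ℝ] F →L[ℝ] ℝ) (fun x => (A x).flip) p := by
  have h : ContDiff ℝ ∞ (fun A : F →L[ℝ] G →L[ℝ] ℝ => A.flip) :=
    IsBoundedLinearMap.contDiff ⟨⟨fun _ _ => rfl, fun _ _ => rfl⟩, 1, one_pos, fun A => by
      rw [one_mul, ContinuousLinearMap.opNorm_flip]⟩
  exact (h.smoothNear (A p)).comp hA

/-- At a zero of `v`, the second derivative of `½ M(v, v)` is the pullback of `M` by the derivative
of `v`. -/
theorem fderiv_fderiv_half_quadratic {g : E → ℝ} {A : E → F →L[ℝ] F →L[ℝ] ℝ} {v : E → F} {y : E}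
    (hA : SmoothNear 𝓘(ℝ, E) 𝓘(ℝ, F →L[ℝ] F →L[ℝ] ℝ) A y) (hv : SmoothNear 𝓘(ℝ, E) 𝓘(ℝ, F) v y)
    (hv0 : v y = 0) (hg : ∀ᶠ x in 𝓝 y, g x = (1 / 2 : ℝ) * A x (v x) (v x)) (e : E) :
    fderiv ℝ (fderiv ℝ g) y e e = A y (fderiv ℝ v y e) (fderiv ℝ v y e) := by
  obtain ⟨q, hq⟩ : ∃ q : E → F →L[ℝ] ℝ, ∀ x, q x = A x (v x) := ⟨_, fun _ => rfl⟩
  have hqs : SmoothNear 𝓘(ℝ, E) 𝓘(ℝ, F →L[ℝ] ℝ) q y := (hA.clm_apply hv).congr (by simp [hq])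
  have hq0 : q y = 0 := by rw [hq, hv0, map_zero]
  have hqe : fderiv ℝ q y e = A y (fderiv ℝ v y e) := by
    have h1 : q = fun x => A x (v x) := funext hq
    rw [h1, (hA.hasFDerivAt.clm_apply hv.hasFDerivAt).fderiv]
    simp only [ContinuousLinearMap.comp_apply, hv0, map_zero, add_zero]
  have h1 : fderiv ℝ g =ᶠ[𝓝 y] fun x => (1 / 2 : ℝ) •
      ((q x).comp (fderiv ℝ v x) + (fderiv ℝ q x).flip (v x)) := by
    filter_upwards [eventually_eventually_nhds.2 hg, hqs.eventually, hv.eventually] with x h2 h3 h4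
    have h5 : g =ᶠ[𝓝 x] fun x => (1 / 2 : ℝ) • (q x (v x)) :=
      h2.mono fun x hx => by simp only [hx, hq, smul_eq_mul]
    rw [h5.fderiv_eq]
    exact ((h3.hasFDerivAt.clm_apply h4.hasFDerivAt).const_smul (1 / 2 : ℝ)).fderiv
  have h3 := hqs.hasFDerivAt.clm_comp hv.fderiv.hasFDerivAt
  have h4 := hqs.fderiv.clm_flip.hasFDerivAt.clm_apply hv.hasFDerivAt
  have h5 := (h3.add h4).const_smul (1 / 2 : ℝ)
  rw [h1.fderiv_eq]
  refine (congrArg (fun L => L e e) h5.fderiv).trans ?_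
  simp [hq0, hv0, hqe]
  ring

theorem hessianAt_half_quadratic [IsManifold I ∞ M] {g : M → ℝ} {A : M → F →L[ℝ] F →L[ℝ] ℝ}
    {v : M → F} {p : M} (hp : I.IsInteriorPoint p)
    (hA : SmoothNear I 𝓘(ℝ, F →L[ℝ] F →L[ℝ] ℝ) A p) (hv : SmoothNear I 𝓘(ℝ, F) v p)
    (hv0 : v p = 0) (hg : ∀ᶠ x in 𝓝 p, g x = (1 / 2 : ℝ) * A x (v x) (v x))
    (u : TangentSpace I p) :
    hessianAt I g p u u = A p (vderiv I v p u) (vderiv I v p u) := by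
  have hs := smoothNear_extChartAt_symm hp
  have hpp : (extChartAt I p).symm (extChartAt I p p) = p := extChartAt_to_inv p
  have hc := hs.continuousAt.tendsto
  rw [hpp] at hc
  have h := fderiv_fderiv_half_quadratic (hA.comp_of_eq hs hpp) (hv.comp_of_eq hs hpp)
    (by rw [hpp, hv0]) (hc.eventually hg) (u : E)
  rw [vderiv_eq_fderiv_of_isInteriorPoint hp hv.mdifferentiableAt]
  rw [hpp] at h
  exact h

end Coordinates


/-! ### Cutoffs and patching by convexity -/

section Cutoff

variable {E : Type*} [NormedAddCommGroup E] [NormedSpace ℝ E]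
  {H : Type*} [TopologicalSpace H] (I : ModelWithCorners ℝ E H)
  {M : Type*} [TopologicalSpace M] [ChartedSpace H M]
  {F : Type*} [NormedAddCommGroup F] [NormedSpace ℝ F]

/-- The product of a map smooth near each point of `U` with a cutoff supported in `U` is smooth. -/
theorem ContMDiff.smul_of_tsupport_subset {χ : M → ℝ} (hχ : ContMDiff I 𝓘(ℝ, ℝ) ∞ χ) {U : Set M}
    (hU : tsupport χ ⊆ U) {f : M → F} (hf : ∀ x ∈ U, ContMDiffAt I 𝓘(ℝ, F) ∞ f x) :
    ContMDiff I 𝓘(ℝ, F) ∞ (fun x => χ x • f x) := by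
  refine contMDiff_of_tsupport fun x hx => ?_
  exact (hχ x).smul (hf x (hU (closure_mono (Function.support_smul_subset_left χ f) hx)))

variable [FiniteDimensional ℝ E] [IsManifold I ∞ M] [T2Space M]

theorem exists_smooth_cutoff {p : M} {U : Set M} (hU : U ∈ 𝓝 p) :
    ∃ χ : M → ℝ, ContMDiff I 𝓘(ℝ, ℝ) ∞ χ ∧ (∀ᶠ x in 𝓝 p, χ x = 1) ∧ tsupport χ ⊆ U ∧
      ∀ x, 0 ≤ χ x := by
  obtain ⟨χ, -, hχ⟩ := (SmoothBumpFunction.nhds_basis_tsupport (I := I) p).mem_iff.1 hU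
  exact ⟨χ, χ.contMDiff, χ.eventuallyEq_one, hχ, fun x => χ.nonneg⟩

/-- Every smooth germ is the germ of a smooth map defined everywhere. -/
theorem SmoothNear.exists_contMDiff {f : M → F} {p : M} (hf : SmoothNear I 𝓘(ℝ, F) f p) :
    ∃ g : M → F, ContMDiff I 𝓘(ℝ, F) ∞ g ∧ ∀ᶠ x in 𝓝 p, g x = f x := by
  obtain ⟨χ, hχ, h1, hU, -⟩ := exists_smooth_cutoff I hf
  exact ⟨_, hχ.smul_of_tsupport_subset I hU fun x hx => hx, h1.mono fun x hx => by
    rw [hx, one_smul]⟩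

/-- Local solutions of convex constraints near a compact set can be patched. -/
theorem exists_smoothNear_forall_mem_convex [SigmaCompactSpace M] {S : Set M}
    (hS : IsCompact S) {t : M → Set F} (ht : ∀ x, Convex ℝ (t x))
    (hloc : ∀ p ∈ S, ∃ g : M → F, SmoothNear I 𝓘(ℝ, F) g p ∧ ∀ᶠ x in 𝓝 p, g x ∈ t x) :
    ∃ g : M → F, ContMDiff I 𝓘(ℝ, F) ∞ g ∧ ∀ p ∈ S, ∀ᶠ x in 𝓝 p, g x ∈ t x := by
  have : LocallyCompactSpace M := Manifold.locallyCompact_of_finiteDimensional I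
  set U : Set M := {p | ∃ g : M → F, SmoothNear I 𝓘(ℝ, F) g p ∧ ∀ᶠ x in 𝓝 p, g x ∈ t x}
  have hU : IsOpen U := by
    rw [isOpen_iff_mem_nhds]
    rintro p ⟨g, hg, hgt⟩
    filter_upwards [hg.eventually, eventually_eventually_nhds.2 hgt] with x h1 h2
    exact ⟨g, h1, h2⟩
  obtain ⟨V, hV, hSV, hVU⟩ := hS.exists_isOpen_closure_subset (hU.mem_nhdsSet.2 hloc)
  classical
  obtain ⟨g, hg⟩ := exists_contMDiffMap_forall_mem_convex_of_local I (n := ⊤)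
    (t := fun x => {y | x ∈ V → y ∈ t x}) (F := F) (fun x => by
      by_cases hx : x ∈ V
      · simpa [hx] using ht x
      · simpa [hx] using convex_univ) (fun x => by
      by_cases hx : x ∈ closure V
      · obtain ⟨g, hg, hgt⟩ := hVU hx
        exact ⟨_, hg.and hgt, g, fun y hy => hy.1.contMDiffWithinAt, fun y hy _ => hy.2⟩
      · exact ⟨_, isClosed_closure.isOpen_compl.mem_nhds hx, fun _ => 0, contMDiffOn_const,
          fun y hy hy' => absurd (subset_closure hy') hy⟩)
  exact ⟨g, g.contMDiff, fun p hp => by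
    filter_upwards [hV.mem_nhds (hSV hp)] with x hx using hg x hx⟩

end Cutoff

/-! ### Hadamard's lemma -/

section Hadamard

universe u

/-- Integrals depending smoothly on a parameter. The derivative is again such an integral, which
gives the claim by induction on the order; as the induction replaces `W` by `V →L[ℝ] W`, the two
spaces live in one universe. -/
theorem contDiff_intervalIntegral_of_contDiff {V W : Type u} [NormedAddCommGroup V]
    [NormedSpace ℝ V] [FiniteDimensional ℝ V] [NormedAddCommGroup W] [NormedSpace ℝ W]
    [CompleteSpace W] {f : V → ℝ → W} (hf : ContDiff ℝ ∞ (fun q : V × ℝ => f q.1 q.2)) :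
    ContDiff ℝ ∞ (fun x => ∫ t in (0 : ℝ)..1, f x t) := by
  rw [contDiff_infty]
  intro n
  induction n generalizing W with
  | zero =>
    exact contDiff_zero.2
      (intervalIntegral.continuous_parametric_intervalIntegral_of_continuous' hf.continuous 0 1)
  | succ n ih =>
    rw [Nat.cast_succ, contDiff_succ_iff_hasFDerivAt]
    set f' : V → ℝ → V →L[ℝ] W := fun x t =>
      (fderiv ℝ (fun q : V × ℝ => f q.1 q.2) (x, t)).comp (ContinuousLinearMap.inl ℝ V ℝ)
    have hf' : ContDiff ℝ ∞ (fun q : V × ℝ => f' q.1 q.2) :=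
      (hf.fderiv_right (by simp)).clm_comp contDiff_const
    refine ⟨fun x => ∫ t in (0 : ℝ)..1, f' x t, ih hf', fun x₀ => ?_⟩
    have hc (x : V) : Continuous (f x) := hf.continuous.comp (Continuous.prodMk_right x)
    have hc' (x : V) : Continuous (f' x) := hf'.continuous.comp (Continuous.prodMk_right x)
    have hK : IsCompact (Metric.closedBall x₀ 1 ×ˢ Icc (0 : ℝ) 1) :=
      (isCompact_closedBall x₀ 1).prod isCompact_Icc
    obtain ⟨C, hC⟩ := hK.exists_bound_of_continuousOn hf'.continuous.continuousOn
    refine intervalIntegral.hasFDerivAt_integral_of_dominated_of_fderiv_le (F := f) (F' := f')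
      (bound := fun _ => C) (Metric.closedBall_mem_nhds x₀ one_pos)
      (Eventually.of_forall fun x => (hc x).aestronglyMeasurable)
      ((hc x₀).intervalIntegrable 0 1) (hc' x₀).aestronglyMeasurable ?_
      intervalIntegrable_const ?_
    · refine Eventually.of_forall fun t ht x hx => hC (x, t) ⟨hx, ?_⟩
      rw [uIoc_of_le zero_le_one] at ht
      exact ⟨ht.1.le, ht.2⟩
    · refine Eventually.of_forall fun t _ x _ => ?_
      exact ((hf.differentiable (by simp)) (x, t)).hasFDerivAt.comp (f := fun e => (e, t)) x
        (hasFDerivAt_prodMk_left x t)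

/-- A function on `B × K` vanishing to first order along `0 × K` near `κ₀` is, near `(0, κ₀)`, half
of a quadratic form in the first variable depending smoothly on the point. -/
theorem ContDiff.exists_half_quadratic {B K : Type*} [NormedAddCommGroup B] [NormedSpace ℝ B]
    [FiniteDimensional ℝ B] [NormedAddCommGroup K] [NormedSpace ℝ K] [FiniteDimensional ℝ K]
    {G : B × K → ℝ} (hG : ContDiff ℝ ∞ G) {κ₀ : K} (h0 : ∀ᶠ κ in 𝓝 κ₀, G (0, κ) = 0)
    (h1 : ∀ᶠ κ in 𝓝 κ₀, fderiv ℝ G (0, κ) = 0) :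
    ∃ A : B × K → B →L[ℝ] B →L[ℝ] ℝ, ContDiff ℝ ∞ A ∧ (∀ y u v, A y u v = A y v u) ∧
      ∀ᶠ y in 𝓝 ((0 : B), κ₀), G y = (1 / 2 : ℝ) * A y y.1 y.1 := by
  set D := fderiv ℝ (fderiv ℝ G) with hD
  have hDs : ContDiff ℝ ∞ D := (hG.fderiv_right (m := ∞) (by simp)).fderiv_right (by simp)
  -- the remainder of Taylor's formula of order two on the segment from `(0, κ)` to `(β, κ)`
  set C : B × K → (B × K) →L[ℝ] (B × K) →L[ℝ] ℝ := fun y =>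
    ∫ t in (0 : ℝ)..1, (1 - t) • D (t • y.1, y.2) with hC
  have hint : ContDiff ℝ ∞ (fun q : (B × K) × ℝ => (1 - q.2) • D (q.2 • q.1.1, q.1.2)) :=
    (contDiff_const.sub contDiff_snd).smul (hDs.comp
      ((contDiff_snd.smul (contDiff_fst.comp contDiff_fst)).prodMk
        (contDiff_snd.comp contDiff_fst)))
  have hCs : ContDiff ℝ ∞ C := contDiff_intervalIntegral_of_contDiff hint
  have hci (y : B × K) : IntervalIntegrable (fun t : ℝ => (1 - t) • D (t • y.1, y.2))
      MeasureTheory.volume 0 1 :=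
    (hint.continuous.comp (Continuous.prodMk_right y)).intervalIntegrable 0 1
  have hCapp (y u v : B × K) :
      C y u v = ∫ t in (0 : ℝ)..1, (1 - t) * D (t • y.1, y.2) u v := by
    have e1 := ContinuousLinearMap.intervalIntegral_comp_comm
      ((ContinuousLinearMap.apply ℝ ℝ v).comp
        (ContinuousLinearMap.apply ℝ ((B × K) →L[ℝ] ℝ) u)) (hci y)
    exact e1.symm
  set ι := ContinuousLinearMap.inl ℝ B K
  refine ⟨fun y => (2 : ℝ) • ((ContinuousLinearMap.compL ℝ B (B × K) ℝ).flip ι).comp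
    ((C y).comp ι), ?_, ?_, ?_⟩
  · have e1 : ContDiff ℝ ∞ fun y => (C y).comp ι := hCs.clm_comp contDiff_const
    exact (contDiff_const.clm_comp e1).const_smul (2 : ℝ)
  · intro y u v
    change (2 : ℝ) * C y (ι u) (ι v) = (2 : ℝ) * C y (ι v) (ι u)
    rw [hCapp, hCapp]
    congr 2
    funext t
    congr 1
    exact (hG.contDiffAt (x := (t • y.1, y.2))).isSymmSndFDerivAt
      (by simp only [minSmoothness_of_isRCLikeNormedField]; norm_cast) (ι u) (ι v)
  · have ht : Tendsto Prod.snd (𝓝 ((0 : B), κ₀)) (𝓝 κ₀) := continuous_snd.continuousAt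
    filter_upwards [ht.eventually h0, ht.eventually h1] with y h2 h3
    change G y = (1 / 2 : ℝ) * ((2 : ℝ) * C y (ι y.1) (ι y.1))
    have h4 := map_add_eq_sum_add_integral_iteratedFDeriv (f := G) (x := (0, y.2))
      (y := (y.1, 0)) (n := 1) (fun t _ => (hG.of_le (by norm_cast)).contDiffAt)
    rw [hCapp]
    simp only [Nat.reduceAdd, Finset.sum_range_succ, Finset.sum_range_zero,
      iteratedFDeriv_zero_apply, iteratedFDeriv_one_apply, iteratedFDeriv_two_apply, h2, h3,
      Prod.mk_add_mk, zero_add, add_zero, Prod.smul_mk, smul_zero, zero_apply,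
      Nat.factorial_one, Nat.cast_one, inv_one, pow_one, smul_eq_mul, mul_zero, one_mul] at h4
    rw [← mul_assoc, show (1 / 2 : ℝ) * 2 = 1 by norm_num, one_mul]
    exact h4

variable {E : Type*} [NormedAddCommGroup E] [NormedSpace ℝ E] [FiniteDimensional ℝ E]
  {H : Type*} [TopologicalSpace H] {I : ModelWithCorners ℝ E H}
  {M : Type*} [TopologicalSpace M] [ChartedSpace H M] [IsManifold I ∞ M]
  {B : Type*} [NormedAddCommGroup B] [NormedSpace ℝ B] [FiniteDimensional ℝ B]

/-- A function vanishing to first order along `S` is locally half of a quadratic form in a defining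
map of `S`. -/
theorem IsDefiningAt.exists_half_quadratic {S : Set M} {b : M → B} {p : M}
    (hd : IsDefiningAt I S b p) (hp : I.IsInteriorPoint p) {g : M → ℝ}
    (hg : SmoothNear I 𝓘(ℝ, ℝ) g p) (h0 : ∀ᶠ x in 𝓝 p, x ∈ S → g x = 0)
    (h1 : ∀ᶠ x in 𝓝 p, x ∈ S → vderiv I g x = 0) :
    ∃ A : M → B →L[ℝ] B →L[ℝ] ℝ, SmoothNear I 𝓘(ℝ, B →L[ℝ] B →L[ℝ] ℝ) A p ∧
      (∀ x u v, A x u v = A x v u) ∧ ∀ᶠ x in 𝓝 p, g x = (1 / 2 : ℝ) * A x (b x) (b x) := by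
  obtain ⟨K, k, θ, c⟩ := exists_isLocalCoordinates hp hd.smooth hd.surjective
  have hb := hd.map_eq_zero
  have hθ := c.tendsto_inv
  have hθs := c.smooth_inv
  have hmem := hd.eventually_inv_mem c
  have hpp := c.inv_self
  rw [hb] at hθ hθs hpp
  have hs : SmoothNear 𝓘(ℝ, B × K) 𝓘(ℝ, ℝ) (fun y => g (θ y)) ((0 : B), k p) :=
    hg.comp_of_eq hθs hpp
  obtain ⟨G, hG, hGe⟩ := hs.exists_contMDiff
  rw [contMDiff_iff_contDiff] at hG
  have ht : Tendsto (fun κ => ((0 : B), κ)) (𝓝 (k p)) (𝓝 ((0 : B), k p)) :=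
    (Continuous.prodMk_right (0 : B)).continuousAt
  obtain ⟨A, hA, hsymm, hAG⟩ := hG.exists_half_quadratic (κ₀ := k p) (by
      filter_upwards [ht.eventually hGe, hmem, ht.eventually (hθ.eventually h0)] with κ h2 h3 h4
      rw [h2, h4 h3]) (by
      filter_upwards [ht.eventually (eventually_eventually_nhds.2 hGe), hmem,
        ht.eventually (hθ.eventually h1), ht.eventually (hθ.eventually hg.eventually),
        ht.eventually hθs.eventually] with κ h2 h3 h4 h5 h6
      refine ContinuousLinearMap.ext fun y => ?_
      rw [Filter.EventuallyEq.fderiv_eq h2, fderiv_comp_eq h5.mdifferentiableAt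
        h6.mdifferentiableAt, h4 h3]
      rfl)
  have hcs := c.smooth_prod
  have hct : Tendsto (fun x => (b x, k x)) (𝓝 p) (𝓝 (0, k p)) := by
    have := hcs.continuousAt.tendsto
    rwa [hb] at this
  refine ⟨fun x => A (b x, k x), (hA.smoothNear _).comp hcs, fun x => hsymm _, ?_⟩
  filter_upwards [hct.eventually hAG, hct.eventually hGe, c.left_inv] with x h2 h3 h4
  rw [← h2, h3, h4]

end Hadamard

/-! ### Square roots of linear maps near the identity -/

section SquareRoot

variable {F : Type*} [NormedAddCommGroup F] [NormedSpace ℝ F] [FiniteDimensional ℝ F]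

variable (F) in
/-- Near the identity, squaring of linear endomorphisms has a smooth local inverse. -/
theorem exists_smooth_local_sqrt :
    ∃ s : (F →L[ℝ] F) → F →L[ℝ] F, s 1 = 1 ∧
      SmoothNear 𝓘(ℝ, F →L[ℝ] F) 𝓘(ℝ, F →L[ℝ] F) s 1 ∧ (∀ᶠ T in 𝓝 1, s T * s T = T) ∧
      ∀ᶠ A in 𝓝 1, s (A * A) = A := by
  have hsm : ContDiff ℝ ∞ (fun A : F →L[ℝ] F => A * A) := contDiff_id.mul contDiff_id
  have hd : HasFDerivAt (fun A : F →L[ℝ] F => A * A)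
      ((2 : ℝ) • ContinuousLinearMap.id ℝ (F →L[ℝ] F)) 1 := by
    refine ((hasFDerivAt_id (𝕜 := ℝ) (1 : F →L[ℝ] F)).mul'
      (hasFDerivAt_id (1 : F →L[ℝ] F))).congr_fderiv ?_
    refine ContinuousLinearMap.ext fun A => ?_
    change (1 : F →L[ℝ] F) * A + A * (1 : F →L[ℝ] F) = (2 : ℝ) • A
    rw [one_mul, mul_one, two_smul]
  have hinv : (fderiv ℝ (fun A : F →L[ℝ] F => A * A) 1).IsInvertible := by
    rw [hd.fderiv]
    refine ⟨ContinuousLinearEquiv.smulLeft (Units.mk0 (2 : ℝ) two_ne_zero), ?_⟩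
    rfl
  obtain ⟨s, h1, h2, h3, h4⟩ := exists_smoothNear_inverse (hsm.smoothNear 1) hinv
  rw [one_mul] at h1 h2 h4
  exact ⟨s, h1, h2, h4, h3⟩

end SquareRoot


/-! ### Smooth retractions compatible with a map -/

section Retraction

variable {E : Type*} [NormedAddCommGroup E] [NormedSpace ℝ E]
  {H : Type*} [TopologicalSpace H] {I : ModelWithCorners ℝ E H}
  {M : Type*} [TopologicalSpace M] [ChartedSpace H M]
  {K : Type*} [NormedAddCommGroup K] [NormedSpace ℝ K]
  {Y : Type*}

variable (I) in
/-- Near `p`, the map `r` is a smooth retraction onto `S` satisfying `f ∘ r = q`. -/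
def IsRetractionAt (S : Set M) (f q : M → Y) (r : M → M) (p : M) : Prop :=
  ∀ᶠ x in 𝓝 p, ContMDiffAt I I ∞ r x ∧ r x ∈ S ∧ f (r x) = q x ∧ (x ∈ S → r x = x)

theorem IsRetractionAt.smoothNear {S : Set M} {f q : M → Y} {r : M → M} {p : M}
    (h : IsRetractionAt I S f q r p) : SmoothNear I I r p := h.mono fun _ hx => hx.1

theorem IsRetractionAt.map_self {S : Set M} {f q : M → Y} {r : M → M} {p : M}
    (h : IsRetractionAt I S f q r p) (hp : p ∈ S) : r p = p := h.self_of_nhds.2.2.2 hp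

theorem IsRetractionAt.tendsto {S : Set M} {f q : M → Y} {r : M → M} {p : M}
    (h : IsRetractionAt I S f q r p) (hp : p ∈ S) : Tendsto r (𝓝 p) (𝓝 p) := by
  have := h.smoothNear.continuousAt.tendsto
  rwa [h.map_self hp] at this

theorem IsRetractionAt.congr {S : Set M} {f q : M → Y} {r r' : M → M} {p : M}
    (h : IsRetractionAt I S f q r p) (hr : ∀ᶠ x in 𝓝 p, r' x = r x) :
    IsRetractionAt I S f q r' p := by
  filter_upwards [h, eventually_eventually_nhds.2 hr] with x hx hx'
  rw [hx'.self_of_nhds]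
  exact ⟨hx.1.congr_of_eventuallyEq hx', hx.2⟩

variable (I) in
/-- A local parametrization, near `p`, of the fibres `{s ∈ S | f s = q x}` by an open subset of a
vector space: `Θ (x, ·)` parametrizes the fibre belonging to `x`, and `k` is its inverse. -/
structure IsFibreChart (S : Set M) (f q : M → Y) (k : M → K) (Θ : M × K → M) (p : M) : Prop where
  smooth_coord : SmoothNear I 𝓘(ℝ, K) k p
  smooth_param : SmoothNear (I.prod 𝓘(ℝ, K)) I Θ (p, k p)
  param_mem : ∀ᶠ y in 𝓝 (p, k p), Θ y ∈ S ∧ f (Θ y) = q y.1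
  param_coord : ∀ᶠ y in 𝓝 (p, p), y.2 ∈ S → f y.2 = q y.1 → Θ (y.1, k y.2) = y.2

namespace IsFibreChart

variable {S : Set M} {f q : M → Y} {k : M → K} {Θ : M × K → M} {p : M}

theorem eventually (h : IsFibreChart I S f q k Θ p) :
    ∀ᶠ x in 𝓝 p, IsFibreChart I S f q k Θ x := by
  have h1 : Tendsto (fun x => (x, k x)) (𝓝 p) (𝓝 (p, k p)) :=
    continuousAt_id.prodMk h.smooth_coord.continuousAt
  have h2 : Tendsto (fun x => (x, x)) (𝓝 p) (𝓝 (p, p)) := continuousAt_id.prodMk continuousAt_id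
  filter_upwards [h.smooth_coord.eventually, h1.eventually h.smooth_param.eventually,
    h1.eventually (eventually_eventually_nhds.2 h.param_mem),
    h2.eventually (eventually_eventually_nhds.2 h.param_coord)] with x a b c d
  exact ⟨a, b, c, d⟩

/-- Every smooth choice of the fibre coordinate which is the right one on `S` gives a retraction. -/
theorem isRetractionAt (h : IsFibreChart I S f q k Θ p) (hfq : ∀ x ∈ S, f x = q x) {κ : M → K}
    (hκ : SmoothNear I 𝓘(ℝ, K) κ p) (hκp : κ p = k p) (hκS : ∀ᶠ x in 𝓝 p, x ∈ S → κ x = k x) :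
    IsRetractionAt I S f q (fun x => Θ (x, κ x)) p := by
  have h1 : Tendsto (fun x => (x, κ x)) (𝓝 p) (𝓝 (p, k p)) := by
    rw [← hκp]; exact continuousAt_id.prodMk hκ.continuousAt
  have h2 : Tendsto (fun x => (x, x)) (𝓝 p) (𝓝 (p, p)) := continuousAt_id.prodMk continuousAt_id
  filter_upwards [hκ, h1.eventually h.smooth_param, h1.eventually h.param_mem,
    h2.eventually h.param_coord, hκS] with x a b c d e
  refine ⟨ContMDiffAt.comp x b (contMDiffAt_id.prodMk a), c.1, c.2, fun hx => ?_⟩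
  rw [e hx]
  exact d hx (hfq x hx)

end IsFibreChart

/-- Retractions onto a compact set `S` compatible with a map exist if they exist locally in the form
of fibre charts: two retractions can be interpolated in the coordinate of a fibre chart. -/
theorem exists_isRetractionAt [FiniteDimensional ℝ E] [IsManifold I ∞ M] [T2Space M]
    {S : Set M} (hS : IsCompact S) {f q : M → Y} (hfq : ∀ x ∈ S, f x = q x)
    (hloc : ∀ p ∈ S, ∃ (K : Submodule ℝ E) (k : M → K) (Θ : M × K → M),
      IsFibreChart I S f q k Θ p) :
    ∃ r : M → M, ∀ p ∈ S, IsRetractionAt I S f q r p := by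
  -- in the compactness induction, every retraction near a subset `T` of `S` can be modified to one
  -- near the union of `T` with the set in question
  suffices h : ∀ T ⊆ S, (∃ r : M → M, ∀ p ∈ T, IsRetractionAt I S f q r p) →
      ∃ r : M → M, ∀ p ∈ T ∪ S ∩ S, IsRetractionAt I S f q r p by
    obtain ⟨r, hr⟩ := h ∅ (empty_subset _) ⟨id, fun p hp => hp.elim⟩
    exact ⟨r, fun p hp => hr p (Or.inr ⟨hp, hp⟩)⟩
  refine hS.induction_on (p := fun t => ∀ T ⊆ S,
    (∃ r : M → M, ∀ p ∈ T, IsRetractionAt I S f q r p) →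
      ∃ r : M → M, ∀ p ∈ T ∪ t ∩ S, IsRetractionAt I S f q r p) ?_ ?_ ?_ ?_
  · intro T _ hT
    simpa using hT
  · intro s t hst ht T hTS hT
    obtain ⟨r, hr⟩ := ht T hTS hT
    exact ⟨r, fun p hp => hr p (hp.imp id fun h => ⟨hst h.1, h.2⟩)⟩
  · intro s t hs ht T hTS hT
    obtain ⟨r, hr⟩ := ht _ (union_subset hTS inter_subset_right) (hs T hTS hT)
    refine ⟨r, fun p hp => hr p ?_⟩
    rcases hp with hp | ⟨hp | hp, hp'⟩
    · exact Or.inl (Or.inl hp)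
    · exact Or.inl (Or.inr ⟨hp, hp'⟩)
    · exact Or.inr ⟨hp, hp'⟩
  · intro p hp
    obtain ⟨K, k, Θ, hc⟩ := hloc p hp
    obtain ⟨χ, hχ, hχ1, hχU, -⟩ := exists_smooth_cutoff I hc.eventually
    refine ⟨_, mem_nhdsWithin_of_mem_nhds (eventually_eventually_nhds.2 hχ1), ?_⟩
    rintro T hTS ⟨r₁, hr₁⟩
    classical
    -- where `χ` vanishes, `r₁ x` need not lie in the domain of the fibre chart
    refine ⟨fun x => if χ x = 0 then r₁ x else
      Θ (x, (1 - χ x) • k (r₁ x) + χ x • k x), fun x₀ hx₀ => ?_⟩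
    by_cases hT : x₀ ∈ T
    · by_cases hsupp : x₀ ∈ tsupport χ
      · have hc' : IsFibreChart I S f q k Θ x₀ := hχU hsupp
        have hr := hr₁ x₀ hT
        have hxS := hTS hT
        have hχs : SmoothNear I 𝓘(ℝ, ℝ) χ x₀ := hχ.smoothNear x₀
        have hkr : SmoothNear I 𝓘(ℝ, K) (fun x => k (r₁ x)) x₀ :=
          hc'.smooth_coord.comp_of_eq hr.smoothNear (hr.map_self hxS)
        have hκ : SmoothNear I 𝓘(ℝ, K) (fun x => (1 - χ x) • k (r₁ x) + χ x • k x) x₀ :=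
          (((smoothNear_const (1 : ℝ) x₀).sub hχs).smul hkr).add (hχs.smul hc'.smooth_coord)
        refine (hc'.isRetractionAt hfq hκ ?_ ?_).congr ?_
        · rw [hr.map_self hxS, ← add_smul, sub_add_cancel, one_smul]
        · filter_upwards [hr] with x hx hx'
          rw [hx.2.2.2 hx', ← add_smul, sub_add_cancel, one_smul]
        · have ht : Tendsto (fun x => (x, r₁ x)) (𝓝 x₀) (𝓝 (x₀, x₀)) :=
            tendsto_id.prodMk_nhds (hr.tendsto hxS)
          filter_upwards [ht.eventually hc'.param_coord, hr] with x h1 h2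
          split_ifs with h0
          · rw [h0, sub_zero, one_smul, zero_smul, add_zero, h1 h2.2.1 h2.2.2.1]
          · rfl
      · refine (hr₁ x₀ hT).congr ?_
        filter_upwards [(isClosed_tsupport χ).isOpen_compl.mem_nhds hsupp] with x hx
        rw [if_pos (image_eq_zero_of_notMem_tsupport hx)]
    · have hx := hx₀.resolve_left hT
      have h1 : ∀ᶠ x in 𝓝 x₀, χ x = 1 := hx.1
      have hc' : IsFibreChart I S f q k Θ x₀ := hχU (subset_tsupport χ (by
        rw [Function.mem_support, h1.self_of_nhds]; exact one_ne_zero))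
      refine (hc'.isRetractionAt hfq hc'.smooth_coord rfl (Eventually.of_forall fun _ _ => rfl)).congr
        ?_
      filter_upwards [h1] with x hx
      rw [if_neg (by rw [hx]; exact one_ne_zero), hx, sub_self, zero_smul, one_smul, zero_add]

end Retraction


/-! ### Tubular neighbourhoods from retractions -/

section TangentMaps

variable {E : Type*} [NormedAddCommGroup E] [NormedSpace ℝ E]
  {H : Type*} [TopologicalSpace H] {I : ModelWithCorners ℝ E H}
  {M : Type*} [TopologicalSpace M] [ChartedSpace H M]
  {E' : Type*} [NormedAddCommGroup E'] [NormedSpace ℝ E']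
  {H' : Type*} [TopologicalSpace H'] {J : ModelWithCorners ℝ E' H'}
  {N : Type*} [TopologicalSpace N] [ChartedSpace H' N]
  {F : Type*} [NormedAddCommGroup F] [NormedSpace ℝ F]

theorem SmoothNear.tangentMap [IsManifold I ∞ M] [IsManifold J ∞ N] {f : M → N} {p : M}
    (hf : SmoothNear I J f p) {v : TangentBundle I M} (hv : v.proj = p) :
    SmoothNear I.tangent J.tangent (tangentMap I J f) v := by
  have : IsManifold I 1 M := .of_le (n := ∞) (by norm_cast)
  have : IsManifold J 1 N := .of_le (n := ∞) (by norm_cast)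
  obtain ⟨U, hU, hUo, hpU⟩ := eventually_nhds_iff.1 hf
  have h1 : ContMDiffOn I J ∞ f U := fun x hx => (hU x hx).contMDiffWithinAt
  have h2 := h1.contMDiffOn_tangentMapWithin (m := ∞) (by simp) hUo.uniqueMDiffOn
  have ho : IsOpen (Bundle.TotalSpace.proj ⁻¹' U : Set (TangentBundle I M)) :=
    hUo.preimage (FiberBundle.continuous_proj E (TangentSpace I))
  refine (h2.congr fun u hu => ?_).smoothNear (ho.mem_nhds (show v.proj ∈ U by rwa [hv]))
  have hu' : u.proj ∈ U := hu
  exact (tangentMapWithin_eq_tangentMap (hUo.uniqueMDiffWithinAt hu')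
    ((hU _ hu').mdifferentiableAt (by simp))).symm

/-- The derivative of a smooth map to a vector space, as a function on the tangent bundle. -/
theorem SmoothNear.vderiv_apply [IsManifold I ∞ M] {f : M → F} {p : M}
    (hf : SmoothNear I 𝓘(ℝ, F) f p) {v : TangentBundle I M} (hv : v.proj = p) :
    SmoothNear I.tangent 𝓘(ℝ, F) (fun u : TangentBundle I M => vderiv I f u.proj u.2) v :=
  SmoothNear.comp (J := 𝓘(ℝ, F).tangent) (g := fun u : TangentBundle 𝓘(ℝ, F) F => u.2)
    ((contMDiff_snd_tangentBundle_modelSpace F 𝓘(ℝ, F)).smoothNear _) (hf.tangentMap hv)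

theorem smoothNear_proj [IsManifold I ∞ M] (v : TangentBundle I M) :
    SmoothNear I.tangent I (fun u : TangentBundle I M => u.proj) v :=
  (Bundle.contMDiff_proj (TangentSpace I)).smoothNear v

theorem SmoothNear.tangentMk {a b : M → F} {p : M} (ha : SmoothNear I 𝓘(ℝ, F) a p)
    (hb : SmoothNear I 𝓘(ℝ, F) b p) :
    SmoothNear I 𝓘(ℝ, F).tangent (fun x => (⟨a x, b x⟩ : TangentBundle 𝓘(ℝ, F) F)) p := by
  filter_upwards [ha, hb] with x hx hx'
  refine (Bundle.contMDiffAt_totalSpace (E := TangentSpace 𝓘(ℝ, F))).2 ⟨hx, ?_⟩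
  convert! hx' with y
  simp

end TangentMaps

section Tubular

variable {E : Type*} [NormedAddCommGroup E] [NormedSpace ℝ E]
  {H : Type*} [TopologicalSpace H] {I : ModelWithCorners ℝ E H}
  {M : Type*} [TopologicalSpace M] [ChartedSpace H M]
  {B : Type*} [NormedAddCommGroup B] [NormedSpace ℝ B]
  {K : Type*} [NormedAddCommGroup K] [NormedSpace ℝ K]
  {F : Type*} [NormedAddCommGroup F] [NormedSpace ℝ F]

variable (I) in
/-- Data describing the pair `(π, w)` near `x₁`: in terms of a coordinate `k` on `S` and a linear
map `C`, the map `J` recovers a point from its projection to `S` and its normal coordinate. -/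
structure IsNormalChart (S : Set M) (π : M → M) (w : M → F) (k : M → K) (C : F →L[ℝ] B)
    (J : B × K → M) (x₁ : M) : Prop where
  smooth_coord : SmoothNear I 𝓘(ℝ, K) k (π x₁)
  smooth_inv : SmoothNear 𝓘(ℝ, B × K) I J (C (w x₁), k (π x₁))
  left_inv : ∀ᶠ x in 𝓝 x₁, J (C (w x), k (π x)) = x
  right_inv : ∀ᶠ z in 𝓝 (π x₁, C (w x₁)), z.1 ∈ S → ∀ v : E, C (vderiv I w z.1 v) = z.2 →
    π (J (z.2, k z.1)) = z.1 ∧ w (J (z.2, k z.1)) = vderiv I w z.1 v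

theorem IsNormalChart.eventually {S : Set M} {π : M → M} {w : M → F} {k : M → K} {C : F →L[ℝ] B}
    {J : B × K → M} {x₁ : M} (h : IsNormalChart I S π w k C J x₁) (hπ : ContinuousAt π x₁)
    (hw : ContinuousAt w x₁) : ∀ᶠ x in 𝓝 x₁, IsNormalChart I S π w k C J x := by
  have hC : ContinuousAt (fun x => C (w x)) x₁ := C.continuous.continuousAt.comp hw
  have h1 : ContinuousAt (fun x => (C (w x), k (π x))) x₁ :=
    hC.prodMk (ContinuousAt.comp (f := π) h.smooth_coord.continuousAt hπ)
  have h2 : ContinuousAt (fun x => (π x, C (w x))) x₁ := hπ.prodMk hC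
  filter_upwards [hπ.eventually h.smooth_coord.eventually, h1.eventually h.smooth_inv.eventually,
    eventually_eventually_nhds.2 h.left_inv,
    h2.eventually (eventually_eventually_nhds.2 h.right_inv)] with x a b c d
  exact ⟨a, b, c, d⟩

variable [FiniteDimensional ℝ E] [IsManifold I ∞ M] [FiniteDimensional ℝ B]

/-- A map vanishing on `S` whose derivative kills only tangent vectors of `S` becomes a local
defining map of `S` after composition with a suitable linear map. -/
theorem IsDefiningAt.exists_clm_comp [FiniteDimensional ℝ F] {S : Set M} {h : M → B} {p : M}
    (hd : IsDefiningAt I S h p) (hp : I.IsInteriorPoint p) {w : M → F}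
    (hw : SmoothNear I 𝓘(ℝ, F) w p) (h0 : ∀ᶠ x in 𝓝 p, x ∈ S → w x = 0)
    (hker : ∀ v : TangentSpace I p, vderiv I w p v = 0 → v ∈ subTangent I S p) :
    ∃ C : F →L[ℝ] B, IsDefiningAt I S (fun x => C (w x)) p := by
  obtain ⟨K, k, θ, c⟩ := exists_isLocalCoordinates hp hd.smooth hd.surjective
  have htan := hd.vderiv_cderiv_tangential c hw.mdifferentiableAt h0
  set N : B →L[ℝ] F := ((vderiv I w p).comp (cderiv I θ (h p, k p))).comp
    (ContinuousLinearMap.inl ℝ B K) with hN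
  have hNinj : LinearMap.ker (N : B →ₗ[ℝ] F) = ⊥ := by
    rw [LinearMap.ker_eq_bot']
    intro b hb
    have h1 := (hd.mem_subTangent_iff hp _).1 (hker _ hb)
    exact (c.vderiv_fst_cderiv (b, 0)).symm.trans h1
  obtain ⟨L, hL⟩ := LinearMap.exists_leftInverse_of_injective (N : B →ₗ[ℝ] F) hNinj
  set C : F →L[ℝ] B := LinearMap.toContinuousLinearMap L
  have hCN (b : B) : C (N b) = b := LinearMap.congr_fun hL b
  have hwC : SmoothNear I 𝓘(ℝ, B) (fun x => C (w x)) p := hw.clm C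
  have hder (y : B × K) : vderiv I (fun x => C (w x)) p (cderiv I θ (h p, k p) y) = y.1 := by
    rw [vderiv_clm C hw.mdifferentiableAt]
    have hy : y = (y.1, 0) + (0, y.2) := by simp
    calc C (vderiv I w p (cderiv I θ (h p, k p) y))
        = C (N y.1) := by
          conv_lhs => rw [hy]
          rw [map_add, map_add, htan, add_zero]; rfl
      _ = y.1 := hCN _
  have h0' : ∀ᶠ x in 𝓝 p, x ∈ S → C (w x) = 0 :=
    h0.mono fun x hx hxS => by rw [hx hxS, map_zero]
  have hmem := hd.eventually_mem_of_ker_le hp hwC h0' fun v hv => by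
    rw [hd.mem_subTangent_iff hp]
    have h1 := hder (vderiv I h p v, vderiv I k p v)
    have h2 : cderiv I θ (h p, k p) (vderiv I h p v, vderiv I k p v) = v := c.cderiv_vderiv v
    rw [h2] at h1
    exact h1.symm.trans hv
  refine ⟨C, hd.mem, hwC, ?_, fun b => ⟨_, hder (b, 0)⟩⟩
  filter_upwards [h0', hmem] with x h1 h2 using ⟨h1, h2⟩

variable (I) in
/-- The data from which a tubular neighbourhood of `S` is built: a retraction `π` onto `S`, and a
vector-valued map `w` vanishing on `S`, which identifies the normal spaces of `S` with the ranges of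
its derivatives and takes its value at `x` in the range belonging to `π x`. -/
structure IsTubularData (S : Set M) (π : M → M) (w : M → F) : Prop where
  retraction : ∀ p ∈ S, IsRetractionAt I S (fun _ => ()) (fun _ => ()) π p
  smooth : ∀ p ∈ S, SmoothNear I 𝓘(ℝ, F) w p
  map_eq_zero : ∀ p ∈ S, w p = 0
  mem_range : ∀ p ∈ S, ∀ᶠ x in 𝓝 p, ∃ v : E, vderiv I w (π x) v = w x
  ker_le : ∀ p ∈ S, ∀ v : TangentSpace I p, vderiv I w p v = 0 → v ∈ subTangent I S p

namespace IsTubularData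

variable {S : Set M} {π : M → M} {w : M → F}

/-- Near a point of `S`, the pair `(π, w)` is described by normal charts, and has smooth lifts to
the tangent bundle. -/
theorem exists_isNormalChart [FiniteDimensional ℝ F] (hT : IsTubularData I S π w)
    (hint : S ⊆ I.interior M) {p : M} {h : M → B} (hd : IsDefiningAt I S h p) :
    ∃ (K : Submodule ℝ E) (k : M → K) (C : F →L[ℝ] B) (J : B × K → M),
      IsNormalChart I S π w k C J p ∧
      ∀ᶠ x₁ in 𝓝 p, ∃ σ : M → TangentBundle I M, SmoothNear I I.tangent σ x₁ ∧
        ∀ᶠ x in 𝓝 x₁, (σ x).proj = π x ∧ vderiv I w (σ x).proj (σ x).2 = w x := by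
  have hpS := hd.mem
  have hw := hT.smooth p hpS
  have hr := hT.retraction p hpS
  have hwS : ∀ᶠ x in 𝓝 p, x ∈ S → w x = 0 := Eventually.of_forall hT.map_eq_zero
  obtain ⟨C, hC⟩ := hd.exists_clm_comp (hint hpS) hw hwS (hT.ker_le p hpS)
  obtain ⟨K, k, θ, c⟩ := exists_isLocalCoordinates (hint hpS) hC.smooth hC.surjective
  have hπp : π p = p := hr.map_self hpS
  have hπt := hr.tendsto hpS
  have hkπ : SmoothNear I 𝓘(ℝ, K) (fun x => k (π x)) p :=
    c.smooth_snd.comp_of_eq hr.smoothNear hπp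
  have hCw0 : C (w p) = 0 := hC.map_eq_zero
  have hGs : SmoothNear I 𝓘(ℝ, B × K) (fun x => (C (w x), k (π x))) p := hC.smooth.prodMk hkπ
  -- `k ∘ π` and `k` agree on `S`, hence so do their derivatives in tangential directions
  have htan (κ : K) : vderiv I (fun x => k (π x)) p (cderiv I θ (C (w p), k p) (0, κ)) = κ := by
    have hsub : SmoothNear I 𝓘(ℝ, K × K) (fun x => (k (π x), k x)) p := hkπ.prodMk c.smooth_snd
    set D : K × K →L[ℝ] K := ContinuousLinearMap.fst ℝ K K - ContinuousLinearMap.snd ℝ K K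
    have h1 := hC.vderiv_cderiv_tangential c (f := fun x => D (k (π x), k x))
      (hsub.clm D).mdifferentiableAt (hr.mono fun x hx hxS => by simp [D, hx.2.2.2 hxS]) κ
    rw [vderiv_clm D hsub.mdifferentiableAt, vderiv_prodMk hkπ.mdifferentiableAt
      c.smooth_snd.mdifferentiableAt, c.vderiv_snd_cderiv] at h1
    exact sub_eq_zero.1 h1
  have hder (u : E) : vderiv I (fun x => (C (w x), k (π x))) p u =
      (vderiv I (fun x => C (w x)) p u, vderiv I (fun x => k (π x)) p u) :=
    vderiv_prodMk hC.smooth.mdifferentiableAt hkπ.mdifferentiableAt u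
  have hbij : Function.Bijective (vderiv I (fun x => (C (w x), k (π x))) p) := by
    constructor
    · rw [injective_iff_map_eq_zero]
      intro u hu
      rw [hder, Prod.mk_eq_zero] at hu
      have h1 := c.cderiv_vderiv u
      rw [hu.1] at h1
      have h2 := htan (vderiv I k p u)
      rw [h1, hu.2] at h2
      rw [← h1, ← h2]
      exact map_zero _
    · rintro ⟨β, κ⟩
      set κ' := κ - vderiv I (fun x => k (π x)) p (cderiv I θ (C (w p), k p) (β, 0))
      refine ⟨cderiv I θ (C (w p), k p) (β, κ'), ?_⟩
      rw [hder, c.vderiv_fst_cderiv]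
      refine Prod.ext rfl ?_
      have h1 : ((β, κ') : B × K) = (β, 0) + (0, κ') := by simp
      change vderiv I (fun x => k (π x)) p (cderiv I θ (C (w p), k p) (β, κ')) = κ
      rw [h1, map_add, map_add, htan]
      simp [κ']
  obtain ⟨J, hJ0, hJs, hJl, hJr⟩ := exists_smoothNear_inverse_of_bijective (hint hpS) hGs hbij
  simp only [hπp, hCw0] at hJ0 hJs hJr
  have hθ := c.left_inv
  -- on the range of the derivative of `w` at a point of `S` near `p`, the map `C` is injective
  have hinj : ∀ᶠ s in 𝓝 p, s ∈ S → ∀ v v' : E,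
      C (vderiv I w s v) = C (vderiv I w s v') → vderiv I w s v = vderiv I w s v' := by
    filter_upwards [hC.eventually (hint hpS), hw.eventually] with s h1 h2 hs v v' hv
    have h3 : vderiv I (fun x => C (w x)) s (v - v') = 0 := by
      rw [vderiv_clm C h2.mdifferentiableAt, map_sub, map_sub, hv, sub_self]
    have h4 := ((h1 hs).mem_subTangent_iff (hint hs) (v - v' : E)).2 h3
    have h5 := vderiv_eq_zero_of_mem_subTangent (f := w) h2.contMDiffAt
      (eventually_mem_nhdsWithin.mono fun x hx => hT.map_eq_zero x hx) h4
    exact sub_eq_zero.1 ((map_sub (vderiv I w s) v v').symm.trans h5)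
  refine ⟨K, k, C, J, ⟨by rw [hπp]; exact c.smooth_snd, by rw [hπp, hCw0]; exact hJs, hJl, ?_⟩, ?_⟩
  · rw [hπp, hCw0]
    have t1 : Tendsto (fun z : M × B => z.1) (𝓝 (p, 0)) (𝓝 p) := continuous_fst.continuousAt
    have t2 : Tendsto (fun z : M × B => (z.2, k z.1)) (𝓝 (p, 0)) (𝓝 (0, k p)) :=
      (continuous_snd.tendsto _).prodMk_nhds (c.smooth_snd.continuousAt.tendsto.comp t1)
    have t3 : Tendsto (fun z : M × B => J (z.2, k z.1)) (𝓝 (p, 0)) (𝓝 p) := by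
      have := hJs.continuousAt.tendsto
      rw [hJ0] at this
      exact this.comp t2
    filter_upwards [t2.eventually hJr, t1.eventually hθ, t1.eventually hinj,
      t3.eventually hr, t3.eventually (hπt.eventually hθ),
      t3.eventually (hT.mem_range p hpS)] with z a b d e f g hz v hv
    obtain ⟨a1, a2⟩ := Prod.ext_iff.1 a
    simp only at a1 a2
    have e1 : π (J (z.2, k z.1)) = z.1 := by
      rw [hT.map_eq_zero _ e.2.1, a2] at f
      rw [hT.map_eq_zero _ hz] at b
      exact f.symm.trans b
    refine ⟨e1, ?_⟩
    obtain ⟨v', hv'⟩ := g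
    rw [e1] at hv'
    rw [← hv'] at a1 ⊢
    exact d hz _ _ (a1.trans hv.symm)
  · have hπS : ∀ᶠ x in 𝓝 p, π x ∈ S := hr.mono fun x hx => hx.2.1
    have hcθ : SmoothNear 𝓘(ℝ, B × K) I θ (0, k p) := by
      have := c.smooth_inv
      rwa [hCw0] at this
    have ht : Tendsto (fun x => ((0 : B), k (π x))) (𝓝 p) (𝓝 (0, k p)) :=
      tendsto_const_nhds.prodMk_nhds (c.smooth_snd.continuousAt.tendsto.comp hπt)
    filter_upwards [ht.eventually hcθ.eventually, hkπ.eventually, hC.smooth.eventually,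
      eventually_eventually_nhds.2 (hπt.eventually hθ), eventually_eventually_nhds.2 hπS,
      eventually_eventually_nhds.2 (hπt.eventually hinj),
      eventually_eventually_nhds.2 (hT.mem_range p hpS),
      eventually_eventually_nhds.2 (hπt.eventually c.eventually),
      eventually_eventually_nhds.2 (hπt.eventually hw.eventually)] with x₁ a b d e f g i j l
    refine ⟨fun x => tangentMap 𝓘(ℝ, B × K) I θ ⟨((0 : B), k (π x)), (C (w x), (0 : K))⟩,
      (a.tangentMap rfl).comp (((smoothNear_const (0 : B) x₁).prodMk b).tangentMk
        (d.prodMk (smoothNear_const (0 : K) x₁))), ?_⟩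
    filter_upwards [e, f, g, i, j, l] with x e f g i j l
    have h1 : θ (0, k (π x)) = π x := by
      rw [hT.map_eq_zero _ f, map_zero] at e; exact e
    refine ⟨h1, ?_⟩
    change vderiv I w (θ (0, k (π x))) (cderiv I θ (0, k (π x)) (C (w x), 0)) = w x
    rw [h1]
    obtain ⟨v, hv⟩ := i
    rw [← hv]
    refine g f _ _ ?_
    have h2 := j.vderiv_fst_cderiv (C (w x), 0)
    rw [vderiv_clm C l.mdifferentiableAt, hT.map_eq_zero _ f, map_zero] at h2
    rw [hv]
    exact h2

end IsTubularData

end Tubular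


section TubularGlobal

variable {E : Type*} [NormedAddCommGroup E] [NormedSpace ℝ E]
  {H : Type*} [TopologicalSpace H] {I : ModelWithCorners ℝ E H}
  {M : Type*} [TopologicalSpace M] [ChartedSpace H M]
  {F : Type*} [NormedAddCommGroup F] [NormedSpace ℝ F]

variable (I) in
/-- The normal vector `ξ` corresponds to the point `x` under `(π, w)`: it is based at `π x`, and the
derivative of `w` maps it to `w x`. -/
def IsNormalCoordinate {S : Set M} (π : M → M) (w : M → F) (ξ : NormalBundle I S) (x : M) : Prop :=
  π x = ξ.base ∧ ∀ v : TangentSpace I (ξ.base : M), normalClass I S ξ.base v = ξ.vec →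
    vderiv I w ξ.base v = w x

theorem normalClass_surjective (S : Set M) (p : M) :
    Function.Surjective (normalClass I S p) := Submodule.mkQ_surjective _

theorem normalClass_eq_iff {S : Set M} {p : M} {v v' : TangentSpace I p} :
    normalClass I S p v = normalClass I S p v' ↔ v - v' ∈ subTangent I S p :=
  Submodule.Quotient.eq _

namespace IsTubularData

variable {S : Set M} {π : M → M} {w : M → F}

theorem vderiv_eq_of_normalClass_eq (hT : IsTubularData I S π w) {p : M} (hp : p ∈ S)
    {v v' : TangentSpace I p} (h : normalClass I S p v = normalClass I S p v') :
    vderiv I w p v = vderiv I w p v' := by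
  have h1 := vderiv_eq_zero_of_mem_subTangent (f := w) (hT.smooth p hp).contMDiffAt
    (eventually_mem_nhdsWithin.mono fun x hx => hT.map_eq_zero x hx) (normalClass_eq_iff.1 h)
  exact sub_eq_zero.1 ((map_sub (vderiv I w p) (v : E) v').symm.trans h1)

theorem normalClass_eq_of_vderiv_eq (hT : IsTubularData I S π w) {p : M} (hp : p ∈ S)
    {v v' : TangentSpace I p} (h : vderiv I w p v = vderiv I w p v') :
    normalClass I S p v = normalClass I S p v' :=
  normalClass_eq_iff.2 (hT.ker_le p hp _
    ((map_sub (vderiv I w p) (v : E) v').trans (sub_eq_zero.2 h)))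

theorem isNormalCoordinate_mk (hT : IsTubularData I S π w) {p : M} (hp : p ∈ S)
    {v : TangentSpace I p} {x : M} :
    IsNormalCoordinate I π w (⟨⟨p, hp⟩, normalClass I S p v⟩ : NormalBundle I S) x ↔
      π x = p ∧ vderiv I w p v = w x :=
  ⟨fun h => ⟨h.1, h.2 v rfl⟩,
    fun h => ⟨h.1, fun _ hv' => (hT.vderiv_eq_of_normalClass_eq hp hv').trans h.2⟩⟩

/-- A point corresponds to at most one normal vector. -/
theorem eq_of_isNormalCoordinate (hT : IsTubularData I S π w) {ξ ξ' : NormalBundle I S} {x : M}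
    (h : IsNormalCoordinate I π w ξ x) (h' : IsNormalCoordinate I π w ξ' x) : ξ = ξ' := by
  obtain ⟨⟨p, hp⟩, n⟩ := ξ
  obtain ⟨⟨p', hp'⟩, n'⟩ := ξ'
  obtain rfl : p = p' := h.1.symm.trans h'.1
  obtain ⟨v, rfl⟩ := normalClass_surjective S p n
  obtain ⟨v', rfl⟩ := normalClass_surjective S p n'
  have h2 : vderiv I w p v = vderiv I w p v' := (h.2 v rfl).trans (h'.2 v' rfl).symm
  rw [hT.normalClass_eq_of_vderiv_eq hp h2]

/-- Near `S`, the correspondence between normal vectors and points given by `(π, w)` is a tubular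
neighbourhood embedding. -/
theorem exists_isTubularEmbedding [FiniteDimensional ℝ E] [FiniteDimensional ℝ F]
    [IsManifold I ∞ M] [T2Space M]
    (hT : IsTubularData I S π w) (hS : IsCompact S) (hne : S.Nonempty) (hint : S ⊆ I.interior M)
    (hsub : ∀ p ∈ S, ∃ c : ℕ, IsSubmanifoldAt I c S p) {U₀ : Set M} (hU₀ : U₀ ∈ 𝓝ˢ S) :
    ∃ (Ut : Set (NormalBundle I S)) (U : Set M) (Φ : NormalBundle I S → M),
      IsTubularEmbedding S Ut U Φ ∧ U ⊆ U₀ ∧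
      ∀ ξ ∈ Ut, IsNormalCoordinate I π w ξ (Φ ξ) := by
  classical
  -- the properties of a point required of all points of the tubular neighbourhood
  let Q : M → Prop := fun x₁ => x₁ ∈ U₀ ∧ π x₁ ∈ S ∧ (∃ v : E, vderiv I w (π x₁) v = w x₁) ∧
    (∃ (c : ℕ) (K : Submodule ℝ E) (k : M → K) (C : F →L[ℝ] EuclideanSpace ℝ (Fin c))
      (J : EuclideanSpace ℝ (Fin c) × K → M), IsNormalChart I S π w k C J x₁) ∧
    ∃ σ : M → TangentBundle I M, SmoothNear I I.tangent σ x₁ ∧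
      ∀ᶠ x in 𝓝 x₁, (σ x).proj = π x ∧ vderiv I w (σ x).proj (σ x).2 = w x
  have hQ : ∀ p ∈ S, ∀ᶠ x in 𝓝 p, Q x := by
    intro p hp
    obtain ⟨c, hc⟩ := hsub p hp
    obtain ⟨h, hd⟩ := hc.exists_isDefiningAt hp
    obtain ⟨K, k, C, J, hN, hσ⟩ := hT.exists_isNormalChart hint hd
    filter_upwards [mem_nhdsSet_iff_forall.1 hU₀ p hp, hT.retraction p hp, hT.mem_range p hp,
      hN.eventually (hT.retraction p hp).smoothNear.continuousAt (hT.smooth p hp).continuousAt,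
      hσ] with x h1 h2 h3 h4 h5
    exact ⟨h1, h2.2.1, h3, ⟨c, K, k, C, J, h4⟩, h5⟩
  have hπ : ∀ p ∈ S, π p = p := fun p hp => (hT.retraction p hp).map_self hp
  -- `(π, w)` is injective on `S` and locally injective, hence injective near the compact set `S`
  obtain ⟨U₁, hU₁o, hSU₁, hU₁⟩ := Set.InjOn.exists_isOpen_superset (f := fun x => (π x, w x))
    (s := S) (fun p hp p' hp' h => by
      have this : π p = π p' := (Prod.ext_iff.1 h).1
      rwa [hπ p hp, hπ p' hp'] at this) hS
    (fun p hp => (hT.retraction p hp).smoothNear.continuousAt.prodMk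
      (hT.smooth p hp).continuousAt)
    (fun p hp => by
      obtain ⟨-, -, -, ⟨c, K, k, C, J, hN⟩, -⟩ := (hQ p hp).self_of_nhds
      refine ⟨_, hN.left_inv, fun x hx x' hx' h => ?_⟩
      obtain ⟨h1, h2⟩ := Prod.ext_iff.1 h
      simp only at h1 h2
      rw [← show J (C (w x), k (π x)) = x from hx, ← show J (C (w x'), k (π x')) = x' from hx',
        h1, h2])
  obtain ⟨U₂, hU₂o, hSU₂, hU₂⟩ := mem_nhdsSet_iff_exists.1 (eventually_nhdsSet_iff_forall.2 hQ)
  set U := U₁ ∩ U₂ with hU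
  have hUo : IsOpen U := hU₁o.inter hU₂o
  have hSU : S ⊆ U := subset_inter hSU₁ hSU₂
  have huniq : ∀ {ξ : NormalBundle I S} {x x' : M}, x ∈ U → x' ∈ U →
      IsNormalCoordinate I π w ξ x → IsNormalCoordinate I π w ξ x' → x = x' := by
    intro ξ x x' hx hx' h h'
    obtain ⟨v, hv⟩ := normalClass_surjective S ξ.base.1 ξ.vec
    exact hU₁ hx.1 hx'.1 (Prod.ext (h.1.trans h'.1.symm) ((h.2 v hv).symm.trans (h'.2 v hv)))
  have hex : ∀ x ∈ U, ∃ ξ : NormalBundle I S, IsNormalCoordinate I π w ξ x := by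
    intro x hx
    obtain ⟨-, h1, ⟨v, hv⟩, -⟩ := hU₂ hx.2
    exact ⟨⟨⟨π x, h1⟩, normalClass I S (π x) v⟩, (hT.isNormalCoordinate_mk h1).2 ⟨rfl, hv⟩⟩
  let Ut : Set (NormalBundle I S) := {ξ | ∃ x ∈ U, IsNormalCoordinate I π w ξ x}
  let Φ : NormalBundle I S → M := fun ξ =>
    if h : ∃ x ∈ U, IsNormalCoordinate I π w ξ x then h.choose else ξ.base
  have hΦ : ∀ ξ ∈ Ut, Φ ξ ∈ U ∧ IsNormalCoordinate I π w ξ (Φ ξ) := by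
    intro ξ hξ
    have h : ∃ x ∈ U, IsNormalCoordinate I π w ξ x := hξ
    simp only [Φ, dif_pos h]
    exact h.choose_spec
  have hΦeq : ∀ {ξ : NormalBundle I S} {x : M}, x ∈ U → IsNormalCoordinate I π w ξ x → Φ ξ = x :=
    fun {ξ x} hx h => huniq (hΦ ξ ⟨x, hx, h⟩).1 hx (hΦ ξ ⟨x, hx, h⟩).2 h
  obtain ⟨s₀, hs₀⟩ := hne
  let Ψ : M → NormalBundle I S := fun x =>
    if h : ∃ ξ : NormalBundle I S, IsNormalCoordinate I π w ξ x then h.choose else ⟨⟨s₀, hs₀⟩, 0⟩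
  have hΨ : ∀ x ∈ U, IsNormalCoordinate I π w (Ψ x) x := by
    intro x hx
    have h := hex x hx
    simp only [Ψ, dif_pos h]
    exact h.choose_spec
  have hzero : ∀ p : S, IsNormalCoordinate I π w (⟨p, 0⟩ : NormalBundle I S) p := fun p =>
    (hT.isNormalCoordinate_mk (v := 0) p.2).2 ⟨hπ p p.2, by
      rw [hT.map_eq_zero p p.2]; exact map_zero (vderiv I w p)⟩
  -- the local smooth lifts of `Φ` to the tangent bundle
  have hlift : ∀ (v₀ : TangentBundle I M) (hv₀ : v₀.proj ∈ S) (x₁ : M), x₁ ∈ U →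
      IsNormalCoordinate I π w (toNormal v₀ hv₀) x₁ → ∃ R : TangentBundle I M → M,
        SmoothNear I.tangent I R v₀ ∧ ∀ᶠ v in 𝓝 v₀, ∀ hv : v.proj ∈ S,
          R v ∈ U ∧ IsNormalCoordinate I π w (toNormal v hv) (R v) := by
    intro v₀ hv₀ x₁ hx₁ hN₀
    obtain ⟨-, -, -, ⟨c, K, k, C, J, hN⟩, -⟩ := hU₂ hx₁.2
    obtain ⟨e1, e2⟩ := (hT.isNormalCoordinate_mk hv₀).1 hN₀
    have hd := (hT.smooth _ hv₀).vderiv_apply (v := v₀) rfl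
    have hk : SmoothNear I.tangent 𝓘(ℝ, K) (fun v : TangentBundle I M => k v.proj) v₀ :=
      hN.smooth_coord.comp_of_eq (smoothNear_proj v₀) e1.symm
    have hCd : SmoothNear I.tangent 𝓘(ℝ, EuclideanSpace ℝ (Fin c))
        (fun v : TangentBundle I M => C (vderiv I w v.proj v.2)) v₀ := hd.clm C
    have hval : (C (vderiv I w v₀.proj v₀.2), k v₀.proj) = (C (w x₁), k (π x₁)) := by
      rw [e1]; exact Prod.ext (congrArg C e2) rfl
    have hR : SmoothNear I.tangent I
        (fun v : TangentBundle I M => J (C (vderiv I w v.proj v.2), k v.proj)) v₀ :=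
      hN.smooth_inv.comp_of_eq (hCd.prodMk hk) hval
    refine ⟨_, hR, ?_⟩
    have hR0 : Tendsto (fun v : TangentBundle I M => J (C (vderiv I w v.proj v.2), k v.proj))
        (𝓝 v₀) (𝓝 x₁) := by
      have h1 := hR.continuousAt.tendsto
      rwa [hval, hN.left_inv.self_of_nhds] at h1
    have ht : Tendsto (fun v : TangentBundle I M => (v.proj, C (vderiv I w v.proj v.2)))
        (𝓝 v₀) (𝓝 (π x₁, C (w x₁))) := by
      have h1 := ((smoothNear_proj v₀).continuousAt.prodMk hCd.continuousAt).tendsto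
      have h2 : (v₀.proj, C (vderiv I w v₀.proj v₀.2)) = (π x₁, C (w x₁)) :=
        Prod.ext e1.symm (congrArg C e2)
      rwa [h2] at h1
    filter_upwards [hR0.eventually (hUo.mem_nhds hx₁), ht.eventually hN.right_inv] with v h1 h2 hv
    have h3 := h2 hv v.2 rfl
    exact ⟨h1, (hT.isNormalCoordinate_mk hv).2 ⟨h3.1, h3.2.symm⟩⟩
  refine ⟨Ut, U, Φ, ⟨?_, hUo, fun p => ⟨p, hSU p.2, hzero p⟩,
    fun p => hΦeq (hSU p.2) (hzero p), fun ξ hξ => (hΦ ξ hξ).1, ?_, ?_, ?_⟩,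
    fun x hx => (hU₂ hx.2).1, fun ξ hξ => (hΦ ξ hξ).2⟩
  · refine isOpen_coinduced.2 (isOpen_iff_mem_nhds.2 fun v₀ hv₀ => ?_)
    obtain ⟨x₁, hx₁, hN⟩ := hv₀
    obtain ⟨R, -, hR⟩ := hlift v₀.1 v₀.2 x₁ hx₁ hN
    filter_upwards [continuous_subtype_val.continuousAt.eventually hR] with v hv
    exact ⟨R v.1, hv v.2⟩
  · refine ⟨fun v => if hv : v.proj ∈ S then Φ (toNormal v hv) else v.proj, fun v₀ hv₀ => ?_,
      fun v hv _ => dif_pos hv⟩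
    obtain ⟨hv₀, x₁, hx₁, hN⟩ := hv₀
    obtain ⟨R, hRs, hR⟩ := hlift v₀ hv₀ x₁ hx₁ hN
    have heq : ∀ᶠ v in 𝓝 v₀, ∀ hv : v.proj ∈ S, Φ (toNormal v hv) = R v := by
      filter_upwards [hR] with v hv hv' using hΦeq (hv hv').1 (hv hv').2
    refine hRs.contMDiffAt.contMDiffWithinAt.congr_of_eventuallyEq ?_ ?_
    · filter_upwards [heq.filter_mono nhdsWithin_le_nhds, self_mem_nhdsWithin] with v hv hv'
      obtain ⟨h1, -⟩ := hv'
      rw [dif_pos h1, hv h1]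
    · rw [dif_pos hv₀, heq.self_of_nhds hv₀]
  · refine ⟨Ψ, fun x hx => ?_, fun x hx => ⟨x, hx, hΨ x hx⟩, fun ξ hξ => ?_, fun x hx => ?_⟩
    · obtain ⟨-, -, -, -, σ, hσ, hσN⟩ := hU₂ hx.2
      obtain ⟨W, hW, hWo, hxW⟩ := eventually_nhds_iff.1 ((hσ.and hσN).and (hUo.mem_nhds hx))
      refine ⟨W, σ, hWo, hxW, fun y hy => (hW y hy).2,
        fun y hy => (hW y hy).1.1.contMDiffWithinAt, fun y hy => ?_⟩
      obtain ⟨⟨-, h1, h2⟩, h3⟩ := hW y hy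
      have h4 : (σ y).proj ∈ S := by rw [h1]; exact (hU₂ h3.2).2.1
      exact ⟨h4, hT.eq_of_isNormalCoordinate ((hT.isNormalCoordinate_mk h4).2 ⟨h1.symm, h2⟩)
        (hΨ y h3)⟩
    · exact hT.eq_of_isNormalCoordinate (hΨ _ (hΦ ξ hξ).1) (hΦ ξ hξ).2
    · exact hΦeq hx (hΨ x hx)
  · intro p v
    -- along the ray through the class of `v` the map `Φ` is the curve `t ↦ J (t • C a, k p)`, on
    -- which `w` is `t ↦ t • a`
    obtain ⟨-, -, -, ⟨c, K, k, C, J, hN⟩, -⟩ := hU₂ (hSU p.2).2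
    have hp := p.2
    set a := vderiv I w (p : M) v with ha
    have hπp := hπ p hp
    have hwp := hT.map_eq_zero p hp
    have hcs : SmoothNear 𝓘(ℝ, ℝ) 𝓘(ℝ, EuclideanSpace ℝ (Fin c) × K)
        (fun t : ℝ => (t • C a, k p)) 0 :=
      ((contDiff_id.smul contDiff_const).prodMk contDiff_const).smoothNear 0
    have hval : ((0 : ℝ) • C a, k p) = (C (w p), k (π p)) := by
      rw [zero_smul, hwp, map_zero, hπp]
    have hγ : SmoothNear 𝓘(ℝ, ℝ) I (fun t : ℝ => J (t • C a, k p)) 0 :=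
      hN.smooth_inv.comp_of_eq hcs hval
    have hγ0 : J ((0 : ℝ) • C a, k p) = p := by rw [hval, hN.left_inv.self_of_nhds]
    have hγt : Tendsto (fun t : ℝ => J (t • C a, k p)) (𝓝 0) (𝓝 (p : M)) := by
      have h1 := hγ.continuousAt.tendsto
      rwa [hγ0] at h1
    have ht : Tendsto (fun t : ℝ => ((p : M), t • C a)) (𝓝 0) (𝓝 (π p, C (w p))) := by
      rw [hπp, hwp, map_zero]
      have h1 : Continuous fun t : ℝ => ((p : M), t • C a) := by fun_prop
      have h2 := h1.tendsto 0
      rwa [zero_smul] at h2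
    have hγN : ∀ᶠ t in 𝓝 (0 : ℝ), J (t • C a, k p) ∈ U ∧ π (J (t • C a, k p)) = p ∧
        w (J (t • C a, k p)) = t • a := by
      filter_upwards [hγt.eventually (hUo.mem_nhds (hSU hp)), ht.eventually hN.right_inv]
        with t h1 h2
      have h3 : vderiv I w (p : M) (t • (v : E)) = t • a := map_smul _ _ _
      have h4 := h2 hp (t • (v : E)) (by rw [h3, map_smul])
      exact ⟨h1, h4.1, h4.2.trans h3⟩
    have hΦγ : ∀ᶠ t in 𝓝 (0 : ℝ), Φ ⟨p, t • normalClass I S (p : M) v⟩ = J (t • C a, k p) := by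
      filter_upwards [hγN] with t h1
      refine hΦeq h1.1 ?_
      exact (hT.isNormalCoordinate_mk (v := t • v) hp).2 ⟨h1.2.1,
        (map_smul (vderiv I w (p : M)) t (v : E)).trans h1.2.2.symm⟩
    set u : E := cderiv I (fun t : ℝ => J (t • C a, k p)) 0 1 with hu
    have hwu : vderiv I w (p : M) u = vderiv I w (p : M) v := by
      have h1 := fderiv_comp_eq (f := w) (θ := fun t : ℝ => J (t • C a, k p)) (y := (0 : ℝ))
        (by rw [hγ0]; exact (hT.smooth p hp).mdifferentiableAt) hγ.mdifferentiableAt 1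
      rw [hγ0] at h1
      have h2 : (fun t : ℝ => w (J (t • C a, k p))) =ᶠ[𝓝 0] fun t => t • a :=
        hγN.mono fun t h => h.2.2
      have h3 : HasFDerivAt (fun t : ℝ => t • a) (ContinuousLinearMap.toSpanSingleton ℝ a) 0 :=
        (ContinuousLinearMap.toSpanSingleton ℝ a).hasFDerivAt
      rw [h2.fderiv_eq, h3.fderiv] at h1
      rw [← h1]
      simp [ha]
    refine ⟨u, hT.normalClass_eq_of_vderiv_eq hp hwu, ?_⟩
    have h1 := (hγ.mdifferentiableAt.hasMFDerivAt).congr_of_eventuallyEq hΦγ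
    have h2 : ContinuousLinearMap.toSpanSingleton ℝ u =
        cderiv I (fun t : ℝ => J (t • C a, k p)) 0 := by
      ext
      simp [hu]
    exact (congrArg (fun L : ℝ →L[ℝ] E => HasMFDerivAt 𝓘(ℝ, ℝ) I
      (fun t : ℝ => Φ ⟨p, t • normalClass I S (p : M) v⟩) 0 L) h2).mpr h1

end IsTubularData

end TubularGlobal


/-! ### Components of submanifolds and fibred coordinates -/

section Locality

variable {E : Type*} [NormedAddCommGroup E] [NormedSpace ℝ E]
  {H : Type*} [TopologicalSpace H] {I : ModelWithCorners ℝ E H}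
  {M : Type*} [TopologicalSpace M] [ChartedSpace H M]
  {B : Type*} [NormedAddCommGroup B] [NormedSpace ℝ B]

theorem subTangent_congr {S S' : Set M} {p : M} (h : ∀ᶠ x in 𝓝 p, (x ∈ S ↔ x ∈ S')) :
    subTangent I S p = subTangent I S' p := by
  have h1 : 𝓝[S] p = 𝓝[S'] p := nhdsWithin_eq_iff_eventuallyEq.2 (h.mono fun x hx => propext hx)
  ext v
  change (∀ g, _ → _ → _) ↔ (∀ g, _ → _ → _)
  rw [h1]

theorem IsDefiningAt.congr_set {S S' : Set M} {h : M → B} {p : M} (hd : IsDefiningAt I S h p)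
    (hS : ∀ᶠ x in 𝓝 p, (x ∈ S ↔ x ∈ S')) : IsDefiningAt I S' h p where
  mem := hS.self_of_nhds.1 hd.mem
  smooth := hd.smooth
  zero_iff := by filter_upwards [hd.zero_iff, hS] with x h1 h2 using h2.symm.trans h1
  surjective := hd.surjective

theorem IsDefiningAt.comp_equiv {B' : Type*} [NormedAddCommGroup B'] [NormedSpace ℝ B']
    {S : Set M} {h : M → B} {p : M} (hd : IsDefiningAt I S h p) (e : B ≃L[ℝ] B') :
    IsDefiningAt I S (fun x => e (h x)) p where
  mem := hd.mem
  smooth := hd.smooth.clm (e : B →L[ℝ] B')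
  zero_iff := by
    filter_upwards [hd.zero_iff] with x hx
    rw [hx, EmbeddingLike.map_eq_zero_iff]
  surjective := fun b => by
    obtain ⟨v, hv⟩ := hd.surjective (e.symm b)
    refine ⟨v, ?_⟩
    have := vderiv_clm (e : B →L[ℝ] B') hd.smooth.mdifferentiableAt v
    rw [hv] at this
    exact this.trans (e.apply_symm_apply b)

variable [FiniteDimensional ℝ E] [FiniteDimensional ℝ B] [IsManifold I ∞ M]

/-- A map that is defining for `S` at various points is defining on an open set containing them. -/
theorem exists_isDefiningMap (S : Set M) (h : M → B) :
    ∃ V, IsDefiningMap I S V h ∧ ∀ p, I.IsInteriorPoint p → IsDefiningAt I S h p → p ∈ V := by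
  refine ⟨interior {x | ContMDiffAt I 𝓘(ℝ, B) ∞ h x ∧ (x ∈ S ↔ h x = 0) ∧
    (x ∈ S → Function.Surjective (vderiv I h x))}, ⟨isOpen_interior, ?_, ?_, ?_⟩, ?_⟩
  · exact fun x hx => (interior_subset hx).1.contMDiffWithinAt
  · exact fun x hx => (interior_subset hx).2.1
  · exact fun x hx => (interior_subset hx.1).2.2 hx.2
  · intro p hp hd
    rw [mem_interior_iff_mem_nhds]
    filter_upwards [hd.smooth, hd.zero_iff, hd.eventually hp] with x h1 h2 h3
    exact ⟨h1, h2, fun h => (h3 h).surjective⟩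

theorem IsDefiningAt.isSubmanifoldAt {S : Set M} {p : M} {c : ℕ}
    {h : M → EuclideanSpace ℝ (Fin c)} (hd : IsDefiningAt I S h p) (hp : I.IsInteriorPoint p) :
    IsSubmanifoldAt I c S p :=
  let ⟨V, hV, hV'⟩ := exists_isDefiningMap (I := I) S h
  ⟨V, h, hV' p hp hd, hV⟩

/-- Submanifolds are locally connected: the nearby points of `S` lie in the same component. -/
theorem IsDefiningAt.eventually_mem_connectedComponentIn {S : Set M} {h : M → B} {p : M}
    (hd : IsDefiningAt I S h p) (hp : I.IsInteriorPoint p) :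
    ∀ᶠ x in 𝓝 p, x ∈ S → x ∈ connectedComponentIn S p := by
  obtain ⟨K, k, θ, c⟩ := exists_isLocalCoordinates hp hd.smooth hd.surjective
  have hmem := hd.eventually_inv_mem c
  have hcont : ∀ᶠ κ in 𝓝 (k p), ContinuousAt (fun κ => θ ((0 : B), κ)) κ := by
    have h1 : ∀ᶠ y in 𝓝 (h p, k p), ContinuousAt θ y :=
      c.smooth_inv.mono fun y hy => hy.continuousAt
    rw [hd.map_eq_zero] at h1
    filter_upwards [(Continuous.prodMk_right (0 : B)).continuousAt.eventually h1] with κ hκ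
    exact ContinuousAt.comp (f := fun κ => ((0 : B), κ)) hκ
      (Continuous.prodMk_right (0 : B)).continuousAt
  obtain ⟨ε, hε, hball⟩ := Metric.eventually_nhds_iff_ball.1 (hmem.and hcont)
  have hpre : IsPreconnected ((fun κ => θ ((0 : B), κ)) '' Metric.ball (k p) ε) :=
    (convex_ball (k p) ε).isPreconnected.image _ fun κ hκ =>
      (hball κ hκ).2.continuousWithinAt
  have hinv := c.inv_self
  rw [hd.map_eq_zero] at hinv
  have hsub := hpre.subset_connectedComponentIn ⟨k p, Metric.mem_ball_self hε, hinv⟩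
    (image_subset_iff.2 fun κ hκ => (hball κ hκ).1)
  filter_upwards [c.smooth_snd.continuousAt.eventually (Metric.ball_mem_nhds _ hε), c.left_inv,
    hd.zero_iff] with x h1 h2 h3 hx
  refine hsub ⟨k x, h1, ?_⟩
  rw [h3.1 hx] at h2
  exact h2

end Locality

section Fibred

variable {E : Type*} [NormedAddCommGroup E] [NormedSpace ℝ E] [FiniteDimensional ℝ E]
  {H : Type*} [TopologicalSpace H] {I : ModelWithCorners ℝ E H}
  {M : Type*} [TopologicalSpace M] [ChartedSpace H M] [IsManifold I ∞ M]
  {E' : Type*} [NormedAddCommGroup E'] [NormedSpace ℝ E'] [FiniteDimensional ℝ E']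
  {H' : Type*} [TopologicalSpace H'] {J : ModelWithCorners ℝ E' H'}
  {N : Type*} [TopologicalSpace N] [ChartedSpace H' N] [IsManifold J ∞ N]
  {B : Type*} [NormedAddCommGroup B] [NormedSpace ℝ B] [FiniteDimensional ℝ B]
  {C : Type*} [NormedAddCommGroup C] [NormedSpace ℝ C] [FiniteDimensional ℝ C]

/-- If `f` restricts to a submersion `S → T`, a defining map of `S` together with the pullback by
`f` of coordinates along `T` extends to coordinates. -/
theorem IsDefiningAt.exists_fibred_coordinates {S : Set M} {T : Set N} {f : M → N} {p : M}
    {b : M → B} {h : N → C} (hb : IsDefiningAt I S b p) (hh : IsDefiningAt J T h (f p))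
    (hp : I.IsInteriorPoint p) (hfp : J.IsInteriorPoint (f p)) (hf : SmoothNear I J f p)
    (hfib : ∀ w ∈ subTangent J T (f p), ∃ v ∈ subTangent I S p, mfderiv I J f p v = w) :
    ∃ (L : Submodule ℝ E') (k : N → L) (θ : C × L → N) (K : Submodule ℝ E) (m : M → K)
      (Θ : (B × L) × K → M), IsLocalCoordinates J (f p) h k θ ∧
        IsLocalCoordinates I p (fun x => (b x, k (f x))) m Θ := by
  obtain ⟨L, k, θ, c⟩ := exists_isLocalCoordinates hfp hh.smooth hh.surjective
  have hkf : SmoothNear I 𝓘(ℝ, L) (fun x => k (f x)) p := c.smooth_snd.comp hf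
  have hs : SmoothNear I 𝓘(ℝ, B × L) (fun x => (b x, k (f x))) p := hb.smooth.prodMk hkf
  obtain ⟨K, m, Θ, c'⟩ := exists_isLocalCoordinates hp hs (by
    rintro ⟨β, κ⟩
    obtain ⟨u, hu⟩ : ∃ u : E, vderiv I b p u = β := hb.surjective β
    set κ' := κ - vderiv I (fun x => k (f x)) p u with hκ'
    have hw : (cderiv J θ (h (f p), k (f p)) ((0 : C), κ') : TangentSpace J (f p)) ∈
        subTangent J T (f p) :=
      (hh.mem_subTangent_iff hfp _).2 (c.vderiv_fst_cderiv ((0 : C), κ'))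
    obtain ⟨v, hv, hfv⟩ := hfib _ hw
    have h1 : vderiv I b p v = 0 := (hb.mem_subTangent_iff hp v).1 hv
    have h2 : vderiv I (fun x => k (f x)) p v = κ' := by
      rw [vderiv_comp_eq c.smooth_snd.mdifferentiableAt hf.mdifferentiableAt, hfv]
      exact c.vderiv_snd_cderiv ((0 : C), κ')
    obtain ⟨v, rfl⟩ : ∃ v' : E, v' = v := ⟨v, rfl⟩
    refine ⟨u + v, ?_⟩
    rw [vderiv_prodMk hb.smooth.mdifferentiableAt hkf.mdifferentiableAt, map_add, map_add]
    refine Prod.ext ?_ ?_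
    · exact (congrArg₂ (· + ·) hu h1).trans (add_zero β)
    · refine (congrArg (vderiv I (fun x => k (f x)) p u + ·) h2).trans ?_
      simp [κ'])
  exact ⟨L, k, θ, K, m, Θ, c, c'⟩

/-- If `f` restricts to a submersion `S → T`, the points of `T` near `f p` are images of points of
`S` near `p`. -/
theorem IsDefiningAt.eventually_mem_image {S : Set M} {T : Set N} {f : M → N} {p : M}
    {b : M → B} {h : N → C} (hb : IsDefiningAt I S b p) (hh : IsDefiningAt J T h (f p))
    (hp : I.IsInteriorPoint p) (hfp : J.IsInteriorPoint (f p)) (hf : SmoothNear I J f p)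
    (hfib : ∀ w ∈ subTangent J T (f p), ∃ v ∈ subTangent I S p, mfderiv I J f p v = w)
    (hST : MapsTo f S T) {W : Set M} (hW : W ∈ 𝓝 p) :
    ∀ᶠ y in 𝓝 (f p), y ∈ T → y ∈ f '' (S ∩ W) := by
  obtain ⟨L, k, θ, K, m, Θ, c, c'⟩ := hb.exists_fibred_coordinates hh hp hfp hf hfib
  have h0 := hb.map_eq_zero
  have hΘ := c'.tendsto_inv
  have hr := c'.right_inv
  simp only [h0] at hΘ hr
  have ht : Tendsto (fun y => (((0 : B), k y), m p)) (𝓝 (f p)) (𝓝 ((0, k (f p)), m p)) :=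
    (tendsto_const_nhds.prodMk_nhds c.smooth_snd.continuousAt).prodMk_nhds tendsto_const_nhds
  have ht2 := hΘ.comp ht
  filter_upwards [ht.eventually hr, ht2.eventually hW, ht2.eventually hb.zero_iff, c.left_inv,
    (hf.continuousAt.tendsto.comp ht2).eventually c.left_inv, hh.zero_iff,
    (hf.continuousAt.tendsto.comp ht2).eventually hh.zero_iff] with y h1 h2 h3 h4 h5 h6 h7 hy
  obtain ⟨h8, h9⟩ := Prod.ext_iff.1 h1.1
  have hS : Θ ((0, k y), m p) ∈ S := h3.2 h8
  refine ⟨Θ ((0, k y), m p), ⟨hS, h2⟩, ?_⟩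
  simp only [Function.comp_apply] at h5 h7 h8 h9
  rw [h7.1 (hST hS), h9] at h5
  rw [h6.1 hy] at h4
  exact h5.symm.trans h4

end Fibred

/-! ### Defining functions from coorientations -/

section Coorientation

variable {E : Type*} [NormedAddCommGroup E] [NormedSpace ℝ E]
  {H : Type*} [TopologicalSpace H] {I : ModelWithCorners ℝ E H}
  {M : Type*} [TopologicalSpace M] [ChartedSpace H M]
  {F : Type*} [NormedAddCommGroup F] [NormedSpace ℝ F]

theorem vderiv_smul_of_eq_zero {χ : M → ℝ} {f : M → F} {p : M}
    (hχ : MDifferentiableAt I 𝓘(ℝ, ℝ) χ p) (hf : MDifferentiableAt I 𝓘(ℝ, F) f p) (h0 : f p = 0)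
    (u : E) : vderiv I (fun x => χ x • f x) p u = χ p • vderiv I f p u := by
  have h1 : HasFDerivAt (fun y : ℝ × F => y.1 • y.2)
      ((χ p) • (ContinuousLinearMap.snd ℝ ℝ F) +
        (ContinuousLinearMap.fst ℝ ℝ F).smulRight (f p)) (χ p, f p) :=
    HasFDerivAt.fun_smul (x := (χ p, f p)) (c := fun y : ℝ × F => y.1) (f := fun y : ℝ × F => y.2)
      (hasFDerivAt_fst (𝕜 := ℝ)) (hasFDerivAt_snd (𝕜 := ℝ))
  have h2 := vderiv_fderiv_comp (q := fun x => (χ x, f x)) h1.differentiableAt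
    (hχ.prodMk_space hf) u
  rw [h1.fderiv, vderiv_prodMk hχ hf] at h2
  refine h2.trans ?_
  simp [h0]

theorem vderiv_add {f g : M → F} {p : M} (hf : MDifferentiableAt I 𝓘(ℝ, F) f p)
    (hg : MDifferentiableAt I 𝓘(ℝ, F) g p) (u : E) :
    vderiv I (fun x => f x + g x) p u = vderiv I f p u + vderiv I g p u := by
  have h2 := vderiv_clm (ContinuousLinearMap.fst ℝ F F + ContinuousLinearMap.snd ℝ F F)
    (hf.prodMk_space hg) u
  rw [vderiv_prodMk hf hg] at h2
  exact h2

variable [FiniteDimensional ℝ E] [IsManifold I ∞ M]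

/-- A function vanishing on the hypersurface `S` is a defining function near a point if its
derivative there is nonzero. -/
theorem IsDefiningAt.of_vderiv_ne_zero {S : Set M} {h z : M → ℝ} {p : M}
    (hh : IsDefiningAt I S h p) (hp : I.IsInteriorPoint p) (hz : SmoothNear I 𝓘(ℝ, ℝ) z p)
    (h0 : ∀ᶠ x in 𝓝 p, x ∈ S → z x = 0) {e : E} (he : vderiv I z p e ≠ 0) :
    IsDefiningAt I S z p := by
  have htan (v : E) (hv : vderiv I h p v = 0) : vderiv I z p v = 0 :=
    vderiv_eq_zero_of_mem_subTangent (f := z) hz.contMDiffAt (eventually_nhdsWithin_iff.2 h0)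
      ((hh.mem_subTangent_iff hp v).2 hv)
  have he' : vderiv I h p e ≠ 0 := fun h => he (htan e h)
  have hker (v : E) (hv : vderiv I z p v = 0) : vderiv I h p v = 0 := by
    have h1 := htan (v - (vderiv I h p v / vderiv I h p e) • e) (by
      rw [map_sub, map_smul, smul_eq_mul, div_mul_cancel₀ _ he']
      exact sub_self _)
    rw [map_sub, map_smul, smul_eq_mul, sub_eq_zero] at h1
    have h2 := (h1.symm.trans hv)
    simpa [he, he'] using h2
  have hmem := hh.eventually_mem_of_ker_le hp hz h0 fun v hv =>
    (hh.mem_subTangent_iff hp v).2 (hker v hv)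
  refine ⟨hh.mem, hz, ?_, fun a => ⟨(a / vderiv I z p e) • e, ?_⟩⟩
  · filter_upwards [h0, hmem] with x h1 h2 using ⟨h1, h2⟩
  · rw [map_smul, smul_eq_mul, div_mul_cancel₀ _ he]

/-- A coorientable compact hypersurface has a global defining function: local ones, with signs fixed
by the coorientation, are added up. -/
theorem IsCoorientable.exists_isDefiningAt [T2Space M] {S : Set M} (hco : IsCoorientable I S)
    (hS : IsCompact S) (hint : S ⊆ I.interior M)
    (hloc : ∀ p ∈ S, ∃ h : M → ℝ, IsDefiningAt I S h p) :
    ∃ z : M → ℝ, ContMDiff I 𝓘(ℝ, ℝ) ∞ z ∧ ∀ p ∈ S, IsDefiningAt I S z p := by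
  obtain ⟨ξ, hξ, hξT⟩ := hco
  suffices h : ∃ z : M → ℝ, ContMDiff I 𝓘(ℝ, ℝ) ∞ z ∧ (∀ p ∈ S, z p = 0) ∧
      (∀ p ∈ S, 0 ≤ vderiv I z p (ξ p)) ∧ ∀ p ∈ S ∩ S, 0 < vderiv I z p (ξ p) by
    obtain ⟨z, hz, hz0, -, hzp⟩ := h
    refine ⟨z, hz, fun p hp => ?_⟩
    obtain ⟨h, hh⟩ := hloc p hp
    exact hh.of_vderiv_ne_zero (hint hp) (hz.smoothNear p) (Eventually.of_forall hz0)
      (hzp p ⟨hp, hp⟩).ne'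
  refine hS.induction_on (p := fun t => ∃ z : M → ℝ, ContMDiff I 𝓘(ℝ, ℝ) ∞ z ∧
    (∀ p ∈ S, z p = 0) ∧ (∀ p ∈ S, 0 ≤ vderiv I z p (ξ p)) ∧
      ∀ p ∈ t ∩ S, 0 < vderiv I z p (ξ p)) ?_ ?_ ?_ ?_
  · refine ⟨fun _ => 0, contMDiff_const, fun _ _ => rfl, fun p _ => ?_, by simp⟩
    rw [vderiv_const]
    exact le_rfl
  · rintro s t hst ⟨z, h1, h2, h3, h4⟩
    exact ⟨z, h1, h2, h3, fun p hp => h4 p ⟨hst hp.1, hp.2⟩⟩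
  · rintro s t ⟨z, h1, h2, h3, h4⟩ ⟨z', h1', h2', h3', h4'⟩
    have hadd (p : M) : vderiv I (fun x => z x + z' x) p (ξ p) =
        vderiv I z p (ξ p) + vderiv I z' p (ξ p) :=
      vderiv_add (h1.mdifferentiable (by simp) p) (h1'.mdifferentiable (by simp) p) _
    refine ⟨fun x => z x + z' x, h1.add h1', fun p hp => by simp only [h2 p hp, h2' p hp, add_zero],
      fun p hp => ?_, fun p hp => ?_⟩
    · rw [hadd]; exact add_nonneg (h3 p hp) (h3' p hp)
    · rw [hadd]
      rcases hp.1 with hs | ht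
      · exact add_pos_of_pos_of_nonneg (h4 p ⟨hs, hp.2⟩) (h3' p hp.2)
      · exact add_pos_of_nonneg_of_pos (h3 p hp.2) (h4' p ⟨ht, hp.2⟩)
  · intro p hp
    obtain ⟨h, hh, hpos⟩ : ∃ h : M → ℝ, IsDefiningAt I S h p ∧ 0 < vderiv I h p (ξ p) := by
      obtain ⟨h, hh⟩ := hloc p hp
      have hne : vderiv I h p (ξ p) ≠ 0 := fun h0 =>
        hξT p hp ((hh.mem_subTangent_iff (hint hp) _).2 h0)
      rcases lt_or_gt_of_ne hne with hneg | hpos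
      · refine ⟨_, hh.comp_equiv (ContinuousLinearEquiv.neg ℝ), ?_⟩
        have := vderiv_clm ((ContinuousLinearEquiv.neg ℝ : ℝ ≃L[ℝ] ℝ) : ℝ →L[ℝ] ℝ)
          hh.smooth.mdifferentiableAt (ξ p)
        refine lt_of_lt_of_eq (neg_pos.2 hneg) this.symm
      · exact ⟨h, hh, hpos⟩
    have hcont : ContinuousWithinAt (fun x => vderiv I h x (ξ x)) S p := by
      have h1 := (hh.smooth.vderiv_apply (v := ⟨p, ξ p⟩) rfl).continuousAt
      exact ContinuousAt.comp_continuousWithinAt (f := fun x => (⟨x, ξ x⟩ : TangentBundle I M))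
        h1 (hξ p hp)
    have hposn : ∀ᶠ x in 𝓝 p, x ∈ S → 0 < vderiv I h x (ξ x) :=
      eventually_nhdsWithin_iff.1 (hcont.eventually_const_lt hpos)
    obtain ⟨χ, hχ, hχ1, hχU, hχ0⟩ := exists_smooth_cutoff I (hh.smooth.and (hposn.and hh.zero_iff))
    have hder (q : M) (hq : q ∈ S) :
        vderiv I (fun x => χ x • h x) q (ξ q) = χ q • vderiv I h q (ξ q) := by
      by_cases hsupp : q ∈ tsupport χ
      · obtain ⟨h1, -, h2⟩ := hχU hsupp
        exact vderiv_smul_of_eq_zero (hχ.mdifferentiable (by simp) q)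
          (h1.mdifferentiableAt (by simp)) (h2.1 hq) _
      · have h1 : ∀ᶠ x in 𝓝 q, χ x • h x = 0 := by
          filter_upwards [(isClosed_tsupport χ).isOpen_compl.mem_nhds hsupp] with x hx
          rw [image_eq_zero_of_notMem_tsupport hx, zero_smul]
        rw [vderiv_congr h1, vderiv_const, image_eq_zero_of_notMem_tsupport hsupp, zero_smul]
        rfl
    have hsub (q : M) (hq : χ q ≠ 0) := hχU (subset_tsupport χ hq)
    refine ⟨_, mem_nhdsWithin_of_mem_nhds hχ1, fun x => χ x • h x,
      hχ.smul_of_tsupport_subset I hχU fun x hx => hx.1, fun q hq => ?_, fun q hq => ?_,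
      fun q hq => ?_⟩
    · by_cases h0 : χ q = 0
      · simp only [h0, zero_smul]
      · simp only [(hsub q h0).2.2.1 hq, smul_zero]
    · rw [hder q hq]
      by_cases h0 : χ q = 0
      · rw [h0, zero_smul]
      · exact smul_nonneg (hχ0 q) ((hsub q h0).2.1 hq).le
    · have h1 : χ q = 1 := hq.1
      have h2 : χ q ≠ 0 := by rw [h1]; exact one_ne_zero
      rw [hder q hq.2, h1, one_smul]
      exact (hsub q h2).2.1 hq.2

end Coorientation


/-! ### The normal Hessian along a connected submanifold -/

section NormalHessian

variable {E : Type*} [NormedAddCommGroup E] [NormedSpace ℝ E]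
  {H : Type*} [TopologicalSpace H] {I : ModelWithCorners ℝ E H}
  {M : Type*} [TopologicalSpace M] [ChartedSpace H M]

theorem hessianAt_neg (g : M → ℝ) (p : M) (v w : TangentSpace I p) :
    hessianAt I (-g) p v w = -hessianAt I g p v w := by
  have h1 : fderiv ℝ ((-g) ∘ (extChartAt I p).symm) = -fderiv ℝ (g ∘ (extChartAt I p).symm) := by
    funext x
    exact fderiv_neg
  have h2 : fderiv ℝ (fderiv ℝ ((-g) ∘ (extChartAt I p).symm)) (extChartAt I p p) =
      -fderiv ℝ (fderiv ℝ (g ∘ (extChartAt I p).symm)) (extChartAt I p p) := by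
    rw [h1]; exact fderiv_neg
  exact congrArg (fun L : E →L[ℝ] E →L[ℝ] ℝ => L v w) h2

variable [FiniteDimensional ℝ E] [IsManifold I ∞ M]

/-- A function whose zero set is a submanifold of codimension at least two is critical there, since
otherwise its zero set would be a hypersurface. -/
theorem IsDefiningAt.vderiv_eq_zero_of_two_le {S : Set M} {p : M} {c : ℕ} (hc : 2 ≤ c)
    {b : M → EuclideanSpace ℝ (Fin c)} (hb : IsDefiningAt I S b p) (hp : I.IsInteriorPoint p)
    {g : M → ℝ} (hg : SmoothNear I 𝓘(ℝ, ℝ) g p) (h0 : ∀ᶠ x in 𝓝 p, (x ∈ S ↔ g x = 0)) :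
    vderiv I g p = 0 := by
  by_contra hne
  obtain ⟨e, he⟩ : ∃ e, vderiv I g p e ≠ 0 := by
    by_contra! h
    exact hne (ContinuousLinearMap.ext h)
  have hgd : IsDefiningAt I S g p := ⟨hb.mem, hg, h0, fun a => ⟨(a / vderiv I g p e) • e, by
    rw [map_smul, smul_eq_mul, div_mul_cancel₀ _ he]⟩⟩
  have hker (v : E) (hv : vderiv I g p v = 0) : vderiv I b p v = 0 :=
    (hb.mem_subTangent_iff hp v).1 ((hgd.mem_subTangent_iff hp v).2 hv)
  have h1 : Module.finrank ℝ (EuclideanSpace ℝ (Fin c)) ≤ 1 := by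
    refine finrank_le_one (vderiv I b p e) fun β => ?_
    obtain ⟨v, rfl⟩ : ∃ v : E, vderiv I b p v = β := hb.surjective β
    refine ⟨vderiv I g p v / vderiv I g p e, ?_⟩
    have h2 := hker (v - (vderiv I g p v / vderiv I g p e) • e) (by
      rw [map_sub, map_smul, smul_eq_mul, div_mul_cancel₀ _ he, sub_self])
    rw [map_sub, map_smul, sub_eq_zero] at h2
    exact h2.symm
  rw [finrank_euclideanSpace_fin] at h1
  omega

/-- The sign of a definite normal Hessian does not change along a connected submanifold. -/
theorem IsPreconnected.normal_hessian_pos_or_neg {S : Set M} (hS : IsPreconnected S)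
    (hint : S ⊆ I.interior M)
    (hloc : ∀ p ∈ S, ∃ c, 2 ≤ c ∧ ∃ b : M → EuclideanSpace ℝ (Fin c), IsDefiningAt I S b p)
    {g : M → ℝ} (hg : ∀ p ∈ S, SmoothNear I 𝓘(ℝ, ℝ) g p) (h0 : ∀ p ∈ S, g p = 0)
    (h1 : ∀ p ∈ S, vderiv I g p = 0)
    (hdef : ∀ p ∈ S, IsNormallyDefinite I S p (fun v => hessianAt I g p v v)) :
    (∀ p ∈ S, ∀ v ∉ subTangent I S p, 0 < hessianAt I g p v v) ∨
      ∀ p ∈ S, ∀ v ∉ subTangent I S p, hessianAt I g p v v < 0 := by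
  set pos : M → Prop := fun p => ∀ v ∉ subTangent I S p, 0 < hessianAt I g p v v with hpos
  have key : ∀ p ∈ S, ∀ᶠ q in 𝓝[S] p, (pos p ↔ pos q) := by
    intro p hp
    obtain ⟨c, hc, b, hb⟩ := hloc p hp
    obtain ⟨A, hA, -, hgA⟩ := hb.exists_half_quadratic (hint hp) (hg p hp)
      (Eventually.of_forall h0) (Eventually.of_forall h1)
    have : Nontrivial (EuclideanSpace ℝ (Fin c)) := by
      have : Nonempty (Fin c) := ⟨⟨0, by omega⟩⟩
      infer_instance
    obtain ⟨e, he⟩ := exists_ne (0 : EuclideanSpace ℝ (Fin c))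
    -- along `S` near `p`, the sign of the Hessian is the sign of `A q e e`
    have hsign : ∀ᶠ q in 𝓝 p, q ∈ S → A q e e ≠ 0 ∧ (pos q ↔ 0 < A q e e) := by
      filter_upwards [hb.eventually (hint hp), hA.eventually, eventually_eventually_nhds.2 hgA]
        with q h2 h3 h4 hq
      obtain ⟨u, hu⟩ : ∃ u : E, vderiv I b q u = e := (h2 hq).surjective e
      have huT : (u : TangentSpace I q) ∉ subTangent I S q := fun h =>
        he (hu.symm.trans (((h2 hq).mem_subTangent_iff (hint hq) u).1 h))
      have hess := hessianAt_half_quadratic (hint hq) h3 (h2 hq).smooth (h2 hq).map_eq_zero h4 u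
      rw [hu] at hess
      rcases hdef q hq with h | h
      · have : 0 < A q e e := lt_of_lt_of_eq (h u huT) hess
        exact ⟨this.ne', fun _ => this, fun _ => h⟩
      · have : A q e e < 0 := lt_of_eq_of_lt hess.symm (h u huT)
        exact ⟨this.ne, fun h' => lt_of_lt_of_eq (h' u huT) hess, fun h' => absurd h' this.not_gt⟩
    have hcont : ContinuousAt (fun q => A q e e) p :=
      ((hA.clm_apply (smoothNear_const e p)).clm_apply (smoothNear_const e p)).continuousAt
    obtain ⟨hne, hp'⟩ := hsign.self_of_nhds hp
    rw [eventually_nhdsWithin_iff]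
    rcases lt_or_gt_of_ne hne with hneg | hpos'
    · filter_upwards [hsign, hcont.eventually_lt_const hneg] with q h2 h3 hq
      rw [hp', (h2 hq).2]
      exact ⟨fun h => absurd h hneg.not_gt, fun h => absurd h h3.not_gt⟩
    · filter_upwards [hsign, hcont.eventually_const_lt hpos'] with q h2 h3 hq
      rw [hp', (h2 hq).2]
      exact ⟨fun _ => h3, fun _ => hpos'⟩
  rcases S.eq_empty_or_nonempty with rfl | ⟨p₀, hp₀⟩
  · exact Or.inl (by simp)
  have hconst (q : M) (hq : q ∈ S) : pos p₀ ↔ pos q :=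
    hS.induction₂ (fun p q => pos p ↔ pos q) key (fun _ _ _ _ _ _ h h' => h.trans h')
      (fun _ _ _ _ h => h.symm) hp₀ hq
  by_cases hp : pos p₀
  · exact Or.inl fun q hq => (hconst q hq).1 hp
  · refine Or.inr fun q hq => (hdef q hq).resolve_left fun h => hp ((hconst q hq).2 h)

end NormalHessian

/-! ### Compatible retractions onto source and target -/

section CompatibleRetractions

variable {E : Type*} [NormedAddCommGroup E] [NormedSpace ℝ E] [FiniteDimensional ℝ E]
  {H : Type*} [TopologicalSpace H] {I : ModelWithCorners ℝ E H}
  {M : Type*} [TopologicalSpace M] [ChartedSpace H M] [IsManifold I ∞ M]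
  {E' : Type*} [NormedAddCommGroup E'] [NormedSpace ℝ E'] [FiniteDimensional ℝ E']
  {H' : Type*} [TopologicalSpace H'] {J : ModelWithCorners ℝ E' H'}
  {N : Type*} [TopologicalSpace N] [ChartedSpace H' N] [IsManifold J ∞ N]

/-- A compact submanifold is a smooth retract of a neighbourhood. -/
theorem exists_retraction [T2Space M] {S : Set M} (hS : IsCompact S) (hint : S ⊆ I.interior M)
    (hloc : ∀ p ∈ S, ∃ c, ∃ b : M → EuclideanSpace ℝ (Fin c), IsDefiningAt I S b p) :
    ∃ π : M → M, ∀ p ∈ S, IsRetractionAt I S (fun _ => ()) (fun _ => ()) π p := by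
  refine exists_isRetractionAt hS (fun _ _ => rfl) fun p hp => ?_
  obtain ⟨c, b, hb⟩ := hloc p hp
  obtain ⟨K, k, θ, hc⟩ := exists_isLocalCoordinates (hint hp) hb.smooth hb.surjective
  have hθ := hc.smooth_inv
  rw [hb.map_eq_zero] at hθ
  refine ⟨K, k, fun y => θ (0, y.2), hc.smooth_snd, ?_, ?_, ?_⟩
  · exact hθ.comp (f := fun y : M × K => ((0 : EuclideanSpace ℝ (Fin c)), y.2))
      ((smoothNear_const (0 : EuclideanSpace ℝ (Fin c)) (p, k p)).prodMk
        (contMDiff_snd.smoothNear (p, k p)))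
  · have h1 : Tendsto (fun y : M × K => y.2) (𝓝 (p, k p)) (𝓝 (k p)) := continuous_snd.continuousAt
    filter_upwards [h1.eventually (hb.eventually_inv_mem hc)] with y hy using ⟨hy, rfl⟩
  · have h1 : Tendsto (fun y : M × M => y.2) (𝓝 (p, p)) (𝓝 p) := continuous_snd.continuousAt
    filter_upwards [h1.eventually hc.left_inv, h1.eventually hb.zero_iff] with y h2 h3 hy _
    rw [h3.1 hy] at h2
    exact h2

/-- If `f` restricts to a submersion `S → T`, a retraction `π` onto `T` lifts to a retraction onto
`S`, i.e. to one which covers `π`. -/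
theorem exists_lift_retraction [T2Space M] {S : Set M} {T : Set N} {f : M → N} (hS : IsCompact S)
    (hSint : S ⊆ I.interior M) (hTint : T ⊆ J.interior N) (hf : ContMDiff I J ∞ f)
    (hST : MapsTo f S T)
    (hSloc : ∀ p ∈ S, ∃ c, ∃ b : M → EuclideanSpace ℝ (Fin c), IsDefiningAt I S b p)
    (hTloc : ∀ p ∈ T, ∃ c, ∃ h : N → EuclideanSpace ℝ (Fin c), IsDefiningAt J T h p)
    (hfib : ∀ p ∈ S, ∀ w ∈ subTangent J T (f p), ∃ v ∈ subTangent I S p, mfderiv I J f p v = w)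
    {π : N → N} (hπ : ∀ p ∈ T, IsRetractionAt J T (fun _ => ()) (fun _ => ()) π p) :
    ∃ ρ : M → M, ∀ p ∈ S, IsRetractionAt I S f (fun x => π (f x)) ρ p := by
  refine exists_isRetractionAt hS (fun p hp => ((hπ _ (hST hp)).map_self (hST hp)).symm)
    fun p hp => ?_
  obtain ⟨c, b, hb⟩ := hSloc p hp
  obtain ⟨c', h, hh⟩ := hTloc (f p) (hST hp)
  obtain ⟨L, k, θ, K, m, Θ, hc, hc'⟩ := hb.exists_fibred_coordinates hh (hSint hp)
    (hTint (hST hp)) (hf.smoothNear p) (hfib p hp)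
  have hfs : SmoothNear I J f p := hf.smoothNear p
  have hr := hπ _ (hST hp)
  have hπf : π (f p) = f p := hr.map_self (hST hp)
  have hq : SmoothNear I J (fun x => π (f x)) p := hr.smoothNear.comp hfs
  have hkq : SmoothNear I 𝓘(ℝ, L) (fun x => k (π (f x))) p := hc.smooth_snd.comp_of_eq hq hπf
  have hΘ := hc'.smooth_inv
  have hΘt := hc'.tendsto_inv
  have hΘr := hc'.right_inv
  simp only [hb.map_eq_zero] at hΘ hΘt hΘr
  have hP : SmoothNear (I.prod 𝓘(ℝ, K)) 𝓘(ℝ, (EuclideanSpace ℝ (Fin c) × L) × K)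
      (fun y : M × K => (((0 : EuclideanSpace ℝ (Fin c)), k (π (f y.1))), y.2)) (p, m p) :=
    ((smoothNear_const (0 : EuclideanSpace ℝ (Fin c)) (p, m p)).prodMk
      (SmoothNear.comp (f := fun y : M × K => y.1) hkq
        (contMDiff_fst.smoothNear (p, m p)))).prodMk (contMDiff_snd.smoothNear (p, m p))
  have hPt : Tendsto (fun y : M × K => (((0 : EuclideanSpace ℝ (Fin c)), k (π (f y.1))), y.2))
      (𝓝 (p, m p)) (𝓝 ((0, k (f p)), m p)) := by
    have := hP.continuousAt.tendsto
    simpa only [hπf] using this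
  have h1 : Tendsto (fun y : M × K => y.1) (𝓝 (p, m p)) (𝓝 p) := continuous_fst.continuousAt
  refine ⟨K, m, fun y => Θ ((0, k (π (f y.1))), y.2), hc'.smooth_snd, ?_, ?_, ?_⟩
  · exact hΘ.comp_of_eq hP (by simp only [hπf])
  · have h2 := hΘt.comp hPt
    have h3 := hfs.continuousAt.tendsto.comp h2
    have h4 : Tendsto (fun y : M × K => π (f y.1)) (𝓝 (p, m p)) (𝓝 (f p)) :=
      ((hr.tendsto (hST hp)).comp hfs.continuousAt.tendsto).comp h1
    filter_upwards [hPt.eventually hΘr, h2.eventually hb.zero_iff, h3.eventually hc.left_inv,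
      h3.eventually hh.zero_iff, h4.eventually hc.left_inv, h4.eventually hh.zero_iff,
      (hfs.continuousAt.tendsto.comp h1).eventually hr] with y a1 a2 a3 a4 a5 a6 a7
    obtain ⟨b1, b2⟩ := Prod.ext_iff.1 a1.1
    simp only [Function.comp_apply] at a2 a3 a4 a5 a6 a7 b1 b2
    have hmem := a2.2 b1
    refine ⟨hmem, ?_⟩
    rw [a4.1 (hST hmem), b2] at a3
    rw [a6.1 a7.2.1] at a5
    exact a3.symm.trans a5
  · have h2 : Tendsto (fun y : M × M => y.2) (𝓝 (p, p)) (𝓝 p) := continuous_snd.continuousAt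
    filter_upwards [h2.eventually hc'.left_inv, h2.eventually hb.zero_iff] with y a1 a2 hy hfy
    rw [← hfy]
    rw [a2.1 hy] at a1
    exact a1

end CompatibleRetractions


/-! ### Models of the normal bundle inside a trivial bundle -/

section NormalModel

variable {E : Type*} [NormedAddCommGroup E] [NormedSpace ℝ E]
  {H : Type*} [TopologicalSpace H] {I : ModelWithCorners ℝ E H}
  {M : Type*} [TopologicalSpace M] [ChartedSpace H M]
  {F : Type*} [NormedAddCommGroup F] [InnerProductSpace ℝ F]
  {B : Type*} [NormedAddCommGroup B] [InnerProductSpace ℝ B]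

theorem vderiv_clm_apply_of_eq_zero {A : M → F →L[ℝ] B} {f : M → F} {p : M}
    (hA : MDifferentiableAt I 𝓘(ℝ, F →L[ℝ] B) A p) (hf : MDifferentiableAt I 𝓘(ℝ, F) f p)
    (h0 : f p = 0) (u : E) : vderiv I (fun x => A x (f x)) p u = A p (vderiv I f p u) := by
  have h1 := HasFDerivAt.clm_apply (x := (A p, f p)) (c := fun y : (F →L[ℝ] B) × F => y.1)
    (u := fun y : (F →L[ℝ] B) × F => y.2) (hasFDerivAt_fst (𝕜 := ℝ)) (hasFDerivAt_snd (𝕜 := ℝ))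
  have h2 := vderiv_fderiv_comp (q := fun x => (A x, f x)) h1.differentiableAt
    (hA.prodMk_space hf) u
  rw [h1.fderiv, vderiv_prodMk hA hf] at h2
  refine h2.trans ?_
  simp [h0]

theorem SmoothNear.adjoint [CompleteSpace F] [CompleteSpace B] {A : M → F →L[ℝ] B} {p : M}
    (hA : SmoothNear I 𝓘(ℝ, F →L[ℝ] B) A p) :
    SmoothNear I 𝓘(ℝ, B →L[ℝ] F) (fun x => (A x).adjoint) p := by
  have h : ContDiff ℝ ∞ (fun A : F →L[ℝ] B => A.adjoint) :=
    IsBoundedLinearMap.contDiff ⟨⟨fun _ _ => map_add _ _ _, fun c A => by simp⟩, 1, one_pos,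
      fun A => by simp⟩
  exact (h.smoothNear (A p)).comp hA

/-- The Riesz isomorphism of a real Hilbert space, as a continuous linear map. -/
noncomputable def rieszMap (F : Type*) [NormedAddCommGroup F] [InnerProductSpace ℝ F]
    [CompleteSpace F] : (F →L[ℝ] ℝ) →L[ℝ] F where
  toFun := (InnerProductSpace.toDual ℝ F).symm
  map_add' := map_add _
  map_smul' := by simp
  cont := (InnerProductSpace.toDual ℝ F).symm.continuous

theorem inner_rieszMap [CompleteSpace F] (l : F →L[ℝ] ℝ) (v : F) : inner ℝ (rieszMap F l) v = l v :=
  InnerProductSpace.toDual_symm_apply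

theorem ContinuousLinearMap.isInvertible_of_injective [FiniteDimensional ℝ F] {A : F →L[ℝ] F}
    (hA : ∀ v, A v = 0 → v = 0) : A.IsInvertible :=
  ⟨(LinearEquiv.ofInjectiveEndo (A : F →ₗ[ℝ] F)
    ((injective_iff_map_eq_zero _).2 hA)).toContinuousLinearEquiv, by ext; rfl⟩

theorem ContinuousLinearMap.isInvertible_adjoint_comp_self [FiniteDimensional ℝ B]
    [FiniteDimensional ℝ F] {A : B →L[ℝ] F} (hA : ∀ v, A v = 0 → v = 0) :
    (A.adjoint.comp A).IsInvertible := by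
  refine isInvertible_of_injective fun v hv => hA v ?_
  have h1 : inner ℝ (A.adjoint (A v)) v = (0 : ℝ) := by
    rw [show A.adjoint (A v) = 0 from hv, inner_zero_left]
  rw [ContinuousLinearMap.adjoint_inner_left] at h1
  exact inner_self_eq_zero.1 h1

/-- The orthogonal projection onto the range of an injective linear map `A` is `A (A* A)⁻¹ A*`. -/
theorem ContinuousLinearMap.starProjection_range_eq [FiniteDimensional ℝ B]
    [FiniteDimensional ℝ F] {A : B →L[ℝ] F} (hA : ∀ v, A v = 0 → v = 0) :
    A.range.starProjection = A.comp ((A.adjoint.comp A).inverse.comp A.adjoint) := by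
  ext u
  refine Submodule.eq_starProjection_of_mem_orthogonal ⟨_, rfl⟩ ?_
  rw [Submodule.mem_orthogonal]
  rintro _ ⟨b, rfl⟩
  have h1 := (isInvertible_adjoint_comp_self hA).self_comp_inverse
  have h2 := congrArg (fun L : B →L[ℝ] B => L (A.adjoint u)) h1
  change inner ℝ (A b) (u - A ((A.adjoint.comp A).inverse (A.adjoint u))) = (0 : ℝ)
  have h3 : A.adjoint (A ((A.adjoint.comp A).inverse (A.adjoint u))) = A.adjoint u := h2
  rw [← ContinuousLinearMap.adjoint_inner_right, map_sub, h3, sub_self, inner_zero_right]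

variable (I) in
/-- `w` vanishes on `S` and its derivatives along `S` are injective on the normal spaces: these
derivatives identify the normal bundle of `S` with a subbundle of the trivial bundle with fibre
`F`. -/
structure IsNormalMap (S : Set M) (w : M → F) : Prop where
  smooth : ∀ p ∈ S, SmoothNear I 𝓘(ℝ, F) w p
  map_eq_zero : ∀ p ∈ S, w p = 0
  ker_le : ∀ p ∈ S, ∀ v : TangentSpace I p, vderiv I w p v = 0 → v ∈ subTangent I S p

/-- A smooth family of linear maps which along `S` act as the identity on the images of the normal
spaces can be applied to a normal map without changing its derivative along `S`. -/
theorem IsNormalMap.clm_apply {S : Set M} {w : M → F} (hw : IsNormalMap I S w) {A : M → F →L[ℝ] F}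
    (hA : ∀ p ∈ S, SmoothNear I 𝓘(ℝ, F →L[ℝ] F) A p)
    (hAw : ∀ p ∈ S, ∀ u : E, A p (vderiv I w p u) = vderiv I w p u) :
    IsNormalMap I S (fun x => A x (w x)) ∧
      ∀ p ∈ S, vderiv I (fun x => A x (w x)) p = vderiv I w p := by
  have h (p : M) (hp : p ∈ S) : vderiv I (fun x => A x (w x)) p = vderiv I w p := by
    ext u
    rw [vderiv_clm_apply_of_eq_zero (hA p hp).mdifferentiableAt (hw.smooth p hp).mdifferentiableAt
      (hw.map_eq_zero p hp), hAw p hp]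
  refine ⟨⟨fun p hp => (hA p hp).clm_apply (hw.smooth p hp), fun p hp => ?_, fun p hp v hv => ?_⟩, h⟩
  · simp only [hw.map_eq_zero p hp, map_zero]
  · rw [h p hp] at hv
    exact hw.ker_le p hp v hv

variable (I) in
/-- The orthogonal projection onto the image in `F` of the normal space at `p`. -/
noncomputable def normalProjection [FiniteDimensional ℝ F] (w : M → F) (p : M) : F →L[ℝ] F :=
  (vderiv I w p).range.starProjection

theorem normalProjection_vderiv [FiniteDimensional ℝ F] (w : M → F) (p : M) (u : E) :
    normalProjection I w p (vderiv I w p u) = vderiv I w p u :=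
  Submodule.starProjection_eq_self_iff.2 ⟨u, rfl⟩

theorem exists_vderiv_eq_normalProjection [FiniteDimensional ℝ F] (w : M → F) (p : M) (a : F) :
    ∃ u : E, vderiv I w p u = normalProjection I w p a :=
  Submodule.starProjection_apply_mem (vderiv I w p).range a

theorem normalProjection_mul_self [FiniteDimensional ℝ F] (w : M → F) (p : M) :
    normalProjection I w p * normalProjection I w p = normalProjection I w p :=
  Submodule.isIdempotentElem_starProjection _

theorem star_normalProjection [FiniteDimensional ℝ F] (w : M → F) (p : M) :
    star (normalProjection I w p) = normalProjection I w p :=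
  isSelfAdjoint_starProjection _

variable [FiniteDimensional ℝ E] [FiniteDimensional ℝ F] [FiniteDimensional ℝ B]
  [IsManifold I ∞ M]

theorem IsNormalMap.smoothNear_normalProjection {S : Set M} {w : M → F} (hw : IsNormalMap I S w)
    (hint : S ⊆ I.interior M) {p : M} {b : M → B} (hb : IsDefiningAt I S b p) {r : M → M}
    (hr : SmoothNear I I r p) (hrp : r p = p) (hrS : ∀ᶠ x in 𝓝 p, r x ∈ S) :
    SmoothNear I 𝓘(ℝ, F →L[ℝ] F) (fun x => normalProjection I w (r x)) p := by
  obtain ⟨K, k, θ, c⟩ := exists_isLocalCoordinates (hint hb.mem) hb.smooth hb.surjective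
  have hθ := c.smooth_inv
  have hpp := c.inv_self
  rw [hb.map_eq_zero] at hθ hpp
  have hwθ : SmoothNear 𝓘(ℝ, B × K) 𝓘(ℝ, F) (fun y => w (θ y)) (0, k p) :=
    (hw.smooth p hb.mem).comp_of_eq hθ hpp
  -- the derivative of `w` in the normal coordinate directions
  set A : K → B →L[ℝ] F := fun κ =>
    (fderiv ℝ (fun y => w (θ y)) (0, κ)).comp (ContinuousLinearMap.inl ℝ B K) with hA
  have hkr : SmoothNear I 𝓘(ℝ, K) (fun x => k (r x)) p := c.smooth_snd.comp_of_eq hr hrp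
  have hAs : SmoothNear I 𝓘(ℝ, B →L[ℝ] F) (fun x => A (k (r x))) p :=
    (hwθ.fderiv.comp_of_eq ((smoothNear_const (0 : B) p).prodMk hkr) (by rw [hrp])).clm_comp
      (smoothNear_const _ p)
  have hk : Tendsto (fun x => ((0 : B), k x)) (𝓝 p) (𝓝 (0, k p)) :=
    tendsto_const_nhds.prodMk_nhds c.smooth_snd.continuousAt.tendsto
  have hAe : ∀ᶠ x in 𝓝 p, x ∈ S → (∀ v, A (k x) v = 0 → v = 0) ∧
      (vderiv I w x).range = (A (k x)).range := by
    filter_upwards [c.eventually, hb.eventually (hint hb.mem), hk.eventually hθ.eventually]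
      with x h1 h2 h3 hx
    have hx0 := (h2 hx).map_eq_zero
    have hxx := h1.inv_self
    rw [hx0] at hxx
    have hAx (v : B) : A (k x) v = vderiv I w x (cderiv I θ (b x, k x) (v, 0)) := by
      refine (fderiv_comp_eq (f := w) (θ := θ) (y := (0, k x))
        (by rw [hxx]; exact (hw.smooth x hx).mdifferentiableAt) h3.mdifferentiableAt (v, 0)).trans ?_
      rw [hxx, hx0]
    have htan := (h2 hx).vderiv_cderiv_tangential h1 (hw.smooth x hx).mdifferentiableAt
      (Eventually.of_forall hw.map_eq_zero)
    refine ⟨fun v hv => ?_, ?_⟩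
    · rw [hAx] at hv
      have h4 := ((h2 hx).mem_subTangent_iff (hint hx) _).1 (hw.ker_le x hx _ hv)
      exact (h1.vderiv_fst_cderiv (v, 0)).symm.trans h4
    · apply le_antisymm
      · rintro _ ⟨u, rfl⟩
        refine ⟨vderiv I b x u, ?_⟩
        refine (hAx _).trans ?_
        conv_rhs => rw [← h1.cderiv_vderiv u]
        rw [show ((vderiv I b x u, vderiv I k x u) : B × K) =
          (vderiv I b x u, 0) + (0, vderiv I k x u) by simp, map_add]
        exact ((map_add (vderiv I w x) _ _).trans (by rw [htan, add_zero])).symm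
      · rintro _ ⟨v, rfl⟩
        exact ⟨_, (hAx v).symm⟩
  have hrt : Tendsto r (𝓝 p) (𝓝 p) := by
    have := hr.continuousAt.tendsto
    rwa [hrp] at this
  have hinv : ((A (k (r p))).adjoint.comp (A (k (r p)))).IsInvertible :=
    ContinuousLinearMap.isInvertible_adjoint_comp_self (by
      rw [hrp]; exact (hAe.self_of_nhds hb.mem).1)
  refine (hAs.clm_comp (((hAs.adjoint.clm_comp hAs).clm_inverse hinv).clm_comp hAs.adjoint)).congr ?_
  filter_upwards [hrt.eventually hAe, hrS] with x h1 h2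
  rw [normalProjection, ← ContinuousLinearMap.starProjection_range_eq (h1 h2).1]
  simp only [(h1 h2).2]

/-- The normal bundle of a compact submanifold embeds into a trivial bundle. -/
theorem exists_isNormalMap [T2Space M] {S : Set M} (hS : IsCompact S) (hint : S ⊆ I.interior M)
    (hloc : ∀ p ∈ S, ∃ c, ∃ b : M → EuclideanSpace ℝ (Fin c), IsDefiningAt I S b p) :
    ∃ (n : ℕ) (w : M → EuclideanSpace ℝ (Fin n)), ContMDiff I 𝓘(ℝ, EuclideanSpace ℝ (Fin n)) ∞ w ∧
      IsNormalMap I S w := by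
  suffices h : ∃ (n : ℕ) (w : M → EuclideanSpace ℝ (Fin n)),
      ContMDiff I 𝓘(ℝ, EuclideanSpace ℝ (Fin n)) ∞ w ∧ (∀ p ∈ S, w p = 0) ∧
      ∀ p ∈ S ∩ S, ∀ v : TangentSpace I p, vderiv I w p v = 0 → v ∈ subTangent I S p by
    obtain ⟨n, w, h1, h2, h3⟩ := h
    exact ⟨n, w, h1, fun p _ => h1.smoothNear p, h2, fun p hp => h3 p ⟨hp, hp⟩⟩
  refine hS.induction_on (p := fun t => ∃ (n : ℕ) (w : M → EuclideanSpace ℝ (Fin n)),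
      ContMDiff I 𝓘(ℝ, EuclideanSpace ℝ (Fin n)) ∞ w ∧ (∀ p ∈ S, w p = 0) ∧
      ∀ p ∈ t ∩ S, ∀ v : TangentSpace I p, vderiv I w p v = 0 → v ∈ subTangent I S p) ?_ ?_ ?_ ?_
  · exact ⟨0, fun _ => 0, contMDiff_const, fun _ _ => rfl, by simp⟩
  · rintro s t hst ⟨n, w, h1, h2, h3⟩
    exact ⟨n, w, h1, h2, fun p hp => h3 p ⟨hst hp.1, hp.2⟩⟩
  · rintro s t ⟨n, w, h1, h2, h3⟩ ⟨n', w', h1', h2', h3'⟩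
    set e : (EuclideanSpace ℝ (Fin n) × EuclideanSpace ℝ (Fin n')) ≃L[ℝ]
        EuclideanSpace ℝ (Fin (n + n')) := ContinuousLinearEquiv.ofFinrankEq (by simp)
    refine ⟨n + n', fun x => e (w x, w' x), e.contDiff.contMDiff.comp (h1.prodMk_space h1'),
      fun p hp => ?_, fun p hp v hv => ?_⟩
    · simp only [h2 p hp, h2' p hp]
      exact map_zero e
    · have h4 := vderiv_clm (e : _ →L[ℝ] EuclideanSpace ℝ (Fin (n + n')))
        ((h1.prodMk_space h1').mdifferentiable (by simp) p) v
      have h5 : e (vderiv I w p v, vderiv I w' p v) = 0 :=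
        (congrArg e (vderiv_prodMk (h1.mdifferentiable (by simp) p)
          (h1'.mdifferentiable (by simp) p) v)).symm.trans (h4.symm.trans hv)
      rw [EmbeddingLike.map_eq_zero_iff, Prod.mk_eq_zero] at h5
      rcases hp.1 with hs | ht
      · exact h3 p ⟨hs, hp.2⟩ v h5.1
      · exact h3' p ⟨ht, hp.2⟩ v h5.2
  · intro p hp
    obtain ⟨c, b, hb⟩ := hloc p hp
    obtain ⟨χ, hχ, hχ1, hχU, -⟩ := exists_smooth_cutoff I (hb.smooth.and hb.zero_iff)
    have hd := hb.eventually (hint hp)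
    refine ⟨{x | (∀ᶠ y in 𝓝 x, χ y = 1) ∧ (x ∈ S → IsDefiningAt I S b x)},
      mem_nhdsWithin_of_mem_nhds ((eventually_eventually_nhds.2 hχ1).and hd), c,
      fun x => χ x • b x, hχ.smul_of_tsupport_subset I hχU fun x hx => hx.1, fun q hq => ?_,
      fun q hq v hv => ?_⟩
    · by_cases h0 : χ q = 0
      · simp only [h0, zero_smul]
      · simp only [(hχU (subset_tsupport χ h0)).2.1 hq, smul_zero]
    · have h1 : ∀ᶠ x in 𝓝 q, χ x • b x = b x := by
        filter_upwards [hq.1.1] with x hx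
        rw [hx, one_smul]
      rw [vderiv_congr h1] at hv
      exact ((hq.1.2 hq.2).mem_subTangent_iff (hint hq.2) v).2 hv

end NormalModel


/-! ### A Morse–Bott lemma -/

section SquareRootAlgebra

variable {R : Type*} [Ring R]

/-- The conjugate by `N` of the adjoint of a square root of `N⁻¹ G` is again a square root, if `N`
and `G` are self-adjoint. -/
theorem sq_conj_star_eq [StarRing R] {N N' G A : R} (h1 : N * N' = 1) (h2 : N' * N = 1)
    (hN : star N = N) (hG : star G = G) (hA : A * A = N' * G) :
    N' * star A * N * (N' * star A * N) = N' * G := by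
  have hN' : star N' = N' := by
    have h3 : star N' * N = 1 := by rw [← hN, ← star_mul, h1, star_one]
    rw [← mul_one (star N'), ← h1, ← mul_assoc, h3, one_mul]
  calc N' * star A * N * (N' * star A * N) = N' * star A * (N * N') * star A * N := by noncomm_ring
    _ = N' * star (A * A) * N := by rw [h1, star_mul]; noncomm_ring
    _ = N' * G * (N' * N) := by rw [hA, star_mul, hG, hN']; noncomm_ring
    _ = N' * G := by rw [h2, mul_one]

theorem sq_conj_involution_eq {σ T A : R} (hσ : σ * σ = 1) (hT : σ * T = T * σ) (hA : A * A = T) :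
    σ * A * σ * (σ * A * σ) = T := by
  calc σ * A * σ * (σ * A * σ) = σ * A * (σ * σ) * A * σ := by noncomm_ring
    _ = σ * (A * A) * σ := by rw [hσ]; noncomm_ring
    _ = T * (σ * σ) := by rw [hA, hT]; noncomm_ring
    _ = T := by rw [hσ, mul_one]

end SquareRootAlgebra

section QuadraticRepresentation

variable {M : Type*}
  {F : Type*} [NormedAddCommGroup F] [InnerProductSpace ℝ F] [FiniteDimensional ℝ F]

/-- The conditions on an endomorphism `G` of `F`, at a point `x` near `S`, under which `½ ⟨G v, v⟩`
represents the function `g` by a family of quadratic forms, positive along `S`, that is compatible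
with the projection `P`. -/
structure IsQuadraticRepresentation (S : Set M) (g : M → ℝ) (P : M → F →L[ℝ] F) (v : M → F)
    (x : M) (G : F →L[ℝ] F) : Prop where
  star_eq : star G = G
  comm : P x * G = G * P x
  eq : inner ℝ (G (v x)) (v x) = 2 * g x
  pos : x ∈ S → ∀ u, u ≠ 0 → 0 < (inner ℝ (G u) u : ℝ)

theorem convex_isQuadraticRepresentation (S : Set M) (g : M → ℝ) (P : M → F →L[ℝ] F)
    (v : M → F) (x : M) : Convex ℝ {G | IsQuadraticRepresentation S g P v x G} := by
  intro G hG G' hG' a b ha hb hab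
  refine ⟨?_, ?_, ?_, fun hx u hu => ?_⟩
  · rw [star_add, star_smul, star_smul, hG.star_eq, hG'.star_eq, star_trivial, star_trivial]
  · rw [mul_add, add_mul, mul_smul_comm, mul_smul_comm, smul_mul_assoc, smul_mul_assoc, hG.comm,
      hG'.comm]
  · have h : inner ℝ ((a • G + b • G') (v x)) (v x) =
        a * inner ℝ (G (v x)) (v x) + b * inner ℝ (G' (v x)) (v x) := by
      simp [inner_add_left, inner_smul_left]
    rw [h, hG.eq, hG'.eq, ← add_mul, hab, one_mul]
  · have h : inner ℝ ((a • G + b • G') u) u = a * inner ℝ (G u) u + b * inner ℝ (G' u) u := by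
      simp [inner_add_left, inner_smul_left]
    rw [h]
    exact convex_Ioi (0 : ℝ) (hG.pos hx u hu) (hG'.pos hx u hu) ha hb hab

end QuadraticRepresentation

section MorseBott

variable {E : Type*} [NormedAddCommGroup E] [NormedSpace ℝ E] [FiniteDimensional ℝ E]
  {H : Type*} [TopologicalSpace H] {I : ModelWithCorners ℝ E H}
  {M : Type*} [TopologicalSpace M] [ChartedSpace H M] [IsManifold I ∞ M]
  {F : Type*} [NormedAddCommGroup F] [InnerProductSpace ℝ F] [FiniteDimensional ℝ F]

variable [T2Space M] [SigmaCompactSpace M]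

namespace IsNormalMap

variable {S : Set M} {w : M → F}

/-- A function vanishing to first order along `S`, with positive definite normal Hessian, is
represented by a smooth family of quadratic forms on the normal spaces. -/
theorem exists_isQuadraticRepresentation (hw : IsNormalMap I S w) (hS : IsCompact S)
    (hint : S ⊆ I.interior M)
    (hloc : ∀ p ∈ S, ∃ c, ∃ b : M → EuclideanSpace ℝ (Fin c), IsDefiningAt I S b p)
    {g : M → ℝ} (hg : ∀ p ∈ S, SmoothNear I 𝓘(ℝ, ℝ) g p) (h0 : ∀ p ∈ S, g p = 0)
    (h1 : ∀ p ∈ S, vderiv I g p = 0)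
    (hpos : ∀ p ∈ S, ∀ v ∉ subTangent I S p, 0 < hessianAt I g p v v) {P : M → F →L[ℝ] F}
    (hP : ∀ p ∈ S, SmoothNear I 𝓘(ℝ, F →L[ℝ] F) P p)
    (hP1 : ∀ x, P x * P x = P x) (hP2 : ∀ x, star (P x) = P x)
    (hPw : ∀ p ∈ S, ∀ᶠ x in 𝓝 p, P x (w x) = w x)
    (hPr : ∀ p ∈ S, ∀ a, ∃ u : E, vderiv I w p u = P p a) :
    ∃ G : M → F →L[ℝ] F, ContMDiff I 𝓘(ℝ, F →L[ℝ] F) ∞ G ∧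
      ∀ p ∈ S, ∀ᶠ x in 𝓝 p, IsQuadraticRepresentation S g P w x (G x) := by
  refine exists_smoothNear_forall_mem_convex I hS
    (convex_isQuadraticRepresentation S g P w) fun p hp => ?_
  obtain ⟨c, b, hb⟩ := hloc p hp
  obtain ⟨C, hC⟩ := hb.exists_clm_comp (hint hp) (hw.smooth p hp)
    (Eventually.of_forall hw.map_eq_zero) (hw.ker_le p hp)
  obtain ⟨A, hA, hsymm, hgA⟩ := hC.exists_half_quadratic (hint hp) (hg p hp)
    (Eventually.of_forall h0) (Eventually.of_forall h1)
  -- the operator of the bilinear form `A x (C ·) (C ·)`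
  set Q : M → F →L[ℝ] F := fun x =>
    C.adjoint.comp ((rieszMap (EuclideanSpace ℝ (Fin c))).comp ((A x).comp C))
  have hQ (x : M) (u u' : F) : inner ℝ (Q x u) u' = A x (C u) (C u') :=
    (ContinuousLinearMap.adjoint_inner_left C _ _).trans (inner_rieszMap _ _)
  have hQs : SmoothNear I 𝓘(ℝ, F →L[ℝ] F) Q p :=
    (smoothNear_const _ p).clm_comp
      ((smoothNear_const _ p).clm_comp (hA.clm_comp (smoothNear_const C p)))
  have hQstar (x : M) : star (Q x) = Q x := by
    refine ContinuousLinearMap.ext fun u => ext_inner_right ℝ fun u' => ?_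
    rw [ContinuousLinearMap.star_eq_adjoint, ContinuousLinearMap.adjoint_inner_left, hQ,
      real_inner_comm, hQ, hsymm]
  have hPinner (x : M) (u u' : F) : inner ℝ (P x u) u' = inner ℝ u (P x u') := by
    conv_lhs => rw [← hP2 x]
    rw [ContinuousLinearMap.star_eq_adjoint, ContinuousLinearMap.adjoint_inner_left]
  have hPP (x : M) (u : F) : P x (P x u) = P x u := congrArg (fun L : F →L[ℝ] F => L u) (hP1 x)
  refine ⟨fun x => (P x).comp ((Q x).comp (P x)) + (ContinuousLinearMap.id ℝ F - P x),
    ((hP p hp).clm_comp (hQs.clm_comp (hP p hp))).add ((smoothNear_const _ p).sub (hP p hp)), ?_⟩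
  have hinner (x : M) (u : F) :
      inner ℝ (((P x).comp ((Q x).comp (P x)) + (ContinuousLinearMap.id ℝ F - P x)) u) u =
        A x (C (P x u)) (C (P x u)) + inner ℝ (u - P x u) (u - P x u) := by
    change inner ℝ (P x (Q x (P x u)) + (u - P x u)) u = _
    rw [inner_add_left, hPinner, hQ]
    congr 1
    rw [inner_sub_right (u - P x u) u (P x u), ← hPinner, map_sub, hPP, sub_self, inner_zero_left,
      sub_zero]
  filter_upwards [hgA, hPw p hp, hC.eventually (hint hp), hA.eventually,
    eventually_eventually_nhds.2 hgA] with x h2 h3 h4 h5 h6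
  refine ⟨?_, ?_, ?_, fun hx u hu => ?_⟩
  · change star (P x * (Q x * P x) + (1 - P x)) = P x * (Q x * P x) + (1 - P x)
    rw [star_add, star_mul, star_mul, star_sub, star_one, hP2, hQstar, mul_assoc]
  · change P x * (P x * (Q x * P x) + (1 - P x)) = (P x * (Q x * P x) + (1 - P x)) * P x
    simp only [mul_add, add_mul, mul_sub, sub_mul, ← mul_assoc, hP1, mul_one, one_mul]
    simp only [mul_assoc, hP1]
  · rw [hinner, h3, h2, sub_self, inner_zero_left]
    ring
  · rw [hinner]
    obtain ⟨a, ha⟩ := hPr x hx u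
    have hess := hessianAt_half_quadratic (hint hx) h5 (h4 hx).smooth (h4 hx).map_eq_zero h6 a
    rw [vderiv_clm C (hw.smooth x hx).mdifferentiableAt, ha] at hess
    rw [← hess]
    by_cases haT : (a : TangentSpace I x) ∈ subTangent I S x
    · have h7 : P x u = 0 := ha.symm.trans (vderiv_eq_zero_of_mem_subTangent (f := w)
        (hw.smooth x hx).contMDiffAt
        (eventually_mem_nhdsWithin.mono fun y hy => hw.map_eq_zero y hy) haT)
      rw [h7, map_zero, map_zero] at hess
      rw [hess, h7, sub_zero, zero_add]
      exact real_inner_self_pos.2 hu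
    · exact add_pos_of_pos_of_nonneg (hpos x hx a haT) real_inner_self_nonneg

end IsNormalMap

/-- The Morse–Bott lemma, for a positive definite normal Hessian and a given retraction `π`: a
normal map `w` can be chosen such that near `S` the function `g` is half the normal Hessian, in the
normal coordinate `(π, w)`. -/
theorem exists_isTubularData_hessian {S : Set M} (hS : IsCompact S) (hint : S ⊆ I.interior M)
    (hloc : ∀ p ∈ S, ∃ c, ∃ b : M → EuclideanSpace ℝ (Fin c), IsDefiningAt I S b p)
    {g : M → ℝ} (hg : ∀ p ∈ S, SmoothNear I 𝓘(ℝ, ℝ) g p) (h0 : ∀ p ∈ S, g p = 0)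
    (h1 : ∀ p ∈ S, vderiv I g p = 0)
    (hpos : ∀ p ∈ S, ∀ v ∉ subTangent I S p, 0 < hessianAt I g p v v) {π : M → M}
    (hπ : ∀ p ∈ S, IsRetractionAt I S (fun _ => ()) (fun _ => ()) π p) :
    ∃ (n : ℕ) (w : M → EuclideanSpace ℝ (Fin n)), IsTubularData I S π w ∧
      ∀ p ∈ S, ∀ᶠ x in 𝓝 p, ∀ u : TangentSpace I (π x), vderiv I w (π x) u = w x →
        g x = (1 / 2 : ℝ) * hessianAt I g (π x) u u := by
  obtain ⟨n, w₀, -, hw₀⟩ := exists_isNormalMap hS hint hloc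
  have hπp (p : M) (hp : p ∈ S) : π p = p := (hπ p hp).map_self hp
  set P : M → EuclideanSpace ℝ (Fin n) →L[ℝ] EuclideanSpace ℝ (Fin n) :=
    fun x => normalProjection I w₀ (π x) with hPdef
  have hP : ∀ p ∈ S, SmoothNear I 𝓘(ℝ, EuclideanSpace ℝ (Fin n) →L[ℝ] EuclideanSpace ℝ (Fin n))
      P p := fun p hp => by
    obtain ⟨c, b, hb⟩ := hloc p hp
    exact hw₀.smoothNear_normalProjection hint hb (hπ p hp).smoothNear (hπp p hp)
      ((hπ p hp).mono fun x hx => hx.2.1)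
  have hP1 (x : M) : P x * P x = P x := normalProjection_mul_self _ _
  set v : M → EuclideanSpace ℝ (Fin n) := fun x => P x (w₀ x)
  have hPv (x : M) : P x (v x) = v x :=
    congrArg (fun L : EuclideanSpace ℝ (Fin n) →L[ℝ] EuclideanSpace ℝ (Fin n) => L (w₀ x)) (hP1 x)
  obtain ⟨hv, hdv⟩ : IsNormalMap I S v ∧ ∀ p ∈ S, vderiv I v p = vderiv I w₀ p :=
    hw₀.clm_apply hP fun p hp u => by
      simp only [hPdef, hπp p hp, normalProjection_vderiv]
  obtain ⟨G, hG, hGq⟩ := hv.exists_isQuadraticRepresentation hS hint hloc hg h0 h1 hpos hP hP1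
    (fun x => star_normalProjection _ _) (fun p _ => Eventually.of_forall hPv) (fun p hp a => by
      rw [hdv p hp]
      simp only [hPdef, hπp p hp]
      exact exists_vderiv_eq_normalProjection w₀ p a)
  obtain ⟨s, hs1, hs, hss, hsl⟩ := exists_smooth_local_sqrt (EuclideanSpace ℝ (Fin n))
  -- `T` compares the quadratic form at `x` with the one at `π x`; the normal map is `A v` with `A`
  -- the square root of `T`
  set T : M → EuclideanSpace ℝ (Fin n) →L[ℝ] EuclideanSpace ℝ (Fin n) :=
    fun x => (G (π x)).inverse.comp (G x) with hT
  set A : M → EuclideanSpace ℝ (Fin n) →L[ℝ] EuclideanSpace ℝ (Fin n) := fun x => s (T x) with hAdef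
  have hGinv (p : M) (hp : p ∈ S) : (G p).IsInvertible := by
    refine ContinuousLinearMap.isInvertible_of_injective fun u hu => ?_
    by_contra hne
    have := (hGq p hp).self_of_nhds.pos hp u hne
    rw [hu, inner_zero_left] at this
    exact this.false
  have hN (p : M) (hp : p ∈ S) : SmoothNear I
      𝓘(ℝ, EuclideanSpace ℝ (Fin n) →L[ℝ] EuclideanSpace ℝ (Fin n)) (fun x => G (π x)) p :=
    (hG.smoothNear (π p)).comp (hπ p hp).smoothNear
  have hN' (p : M) (hp : p ∈ S) : SmoothNear I
      𝓘(ℝ, EuclideanSpace ℝ (Fin n) →L[ℝ] EuclideanSpace ℝ (Fin n))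
      (fun x => (G (π x)).inverse) p :=
    (hN p hp).clm_inverse (by rw [hπp p hp]; exact hGinv p hp)
  have hTp (p : M) (hp : p ∈ S) : T p = 1 := by
    simp only [hT, hπp p hp]
    exact (hGinv p hp).inverse_comp_self
  have hTs (p : M) (hp : p ∈ S) := (hN' p hp).clm_comp (hG.smoothNear p)
  have hAs (p : M) (hp : p ∈ S) : SmoothNear I
      𝓘(ℝ, EuclideanSpace ℝ (Fin n) →L[ℝ] EuclideanSpace ℝ (Fin n)) A p :=
    hs.comp_of_eq (hTs p hp) (hTp p hp)
  have hAp (p : M) (hp : p ∈ S) : A p = 1 := by rw [hAdef]; simp only [hTp p hp, hs1]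
  obtain ⟨hw, hdw⟩ : IsNormalMap I S (fun x => A x (v x)) ∧
      ∀ p ∈ S, vderiv I (fun x => A x (v x)) p = vderiv I v p :=
    hv.clm_apply hAs fun p hp u => by rw [hAp p hp]; rfl
  -- uniqueness of square roots near `1` gives the compatibility of `A` with the form and with `P`
  have key (p : M) (hp : p ∈ S) : ∀ᶠ x in 𝓝 p, P x (A x (v x)) = A x (v x) ∧
      2 * g x = inner ℝ (G (π x) (A x (v x))) (A x (v x)) := by
    set Φ : M → EuclideanSpace ℝ (Fin n) →L[ℝ] EuclideanSpace ℝ (Fin n) :=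
      fun x => (G (π x)).inverse * star (A x) * G (π x)
    -- commuting with `P` is the same as commuting with the reflection `σ`
    set σ : M → EuclideanSpace ℝ (Fin n) →L[ℝ] EuclideanSpace ℝ (Fin n) :=
      fun x => P x + P x - 1 with hσ
    have hσσ (x : M) : σ x * σ x = 1 := by
      simp only [hσ, mul_sub, sub_mul, mul_add, add_mul, hP1, mul_one, one_mul]
      abel
    have hΦ : Tendsto Φ (𝓝 p) (𝓝 1) := by
      have h2 : ContinuousAt Φ p :=
        (((hN' p hp).clm_comp (hAs p hp).adjoint).clm_comp (hN p hp)).continuousAt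
      have h3 : Φ p = 1 := by
        simp only [Φ, hAp p hp, star_one, mul_one, hπp p hp]
        exact (hGinv p hp).inverse_comp_self
      rw [← h3]
      exact h2
    have hσA : Tendsto (fun x => σ x * A x * σ x) (𝓝 p) (𝓝 1) := by
      have h2 : SmoothNear I 𝓘(ℝ, EuclideanSpace ℝ (Fin n) →L[ℝ] EuclideanSpace ℝ (Fin n)) σ p :=
        ((hP p hp).add (hP p hp)).sub (smoothNear_const _ p)
      have h3 : ContinuousAt (fun x => σ x * A x * σ x) p :=
        ((h2.clm_comp (hAs p hp)).clm_comp h2).continuousAt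
      have h4 : σ p * A p * σ p = 1 := by rw [hAp p hp, mul_one, hσσ]
      rw [← h4]
      exact h3
    have hT1 : Tendsto T (𝓝 p) (𝓝 1) := by
      rw [← hTp p hp]
      exact (hTs p hp).continuousAt
    filter_upwards [hGq p hp, ((hπ p hp).tendsto hp).eventually (hGq p hp), hπ p hp,
      hT1.eventually hss, hΦ.eventually hsl, hσA.eventually hsl] with x e1 e2 e3 e4 e5 e6
    have hinv := hGinv _ e3.2.1
    have i1 : G (π x) * (G (π x)).inverse = 1 := hinv.self_comp_inverse
    have i2 : (G (π x)).inverse * G (π x) = 1 := hinv.inverse_comp_self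
    have hPN : P x * G (π x) = G (π x) * P x := by
      have := e2.comm
      simp only [hPdef, hπp _ e3.2.1] at this
      exact this
    have hPN' : P x * (G (π x)).inverse = (G (π x)).inverse * P x := by
      calc P x * (G (π x)).inverse
          = (G (π x)).inverse * (G (π x) * P x) * (G (π x)).inverse := by
            rw [← mul_assoc, i2, one_mul]
        _ = (G (π x)).inverse * P x := by
            rw [← hPN, mul_assoc, mul_assoc, i1, mul_one]
    have hPT : P x * T x = T x * P x := by
      change P x * ((G (π x)).inverse * G x) = (G (π x)).inverse * G x * P x
      rw [← mul_assoc, hPN', mul_assoc, e1.comm, mul_assoc]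
    have hσT : σ x * T x = T x * σ x := by
      simp only [hσ, mul_sub, sub_mul, mul_add, add_mul, hPT, mul_one, one_mul]
    rw [sq_conj_star_eq i1 i2 e2.star_eq e1.star_eq e4] at e5
    rw [sq_conj_involution_eq (hσσ x) hσT e4] at e6
    have hAΦ : G (π x) * A x = star (A x) * G (π x) := by
      have h2 : A x = (G (π x)).inverse * star (A x) * G (π x) := e5
      conv_lhs => rw [h2]
      rw [← mul_assoc, ← mul_assoc, i1, one_mul]
    have hσA' : σ x * A x = A x * σ x := by
      have h2 : A x = σ x * A x * σ x := e6
      conv_rhs => rw [h2]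
      rw [mul_assoc, hσσ, mul_one]
    have hσv : σ x (v x) = v x := by
      change P x (v x) + P x (v x) - v x = v x
      rw [hPv, add_sub_cancel_right]
    constructor
    · have h2 : σ x (A x (v x)) = A x (σ x (v x)) := DFunLike.congr_fun hσA' (v x)
      rw [hσv] at h2
      have h3 : P x (A x (v x)) + P x (A x (v x)) - A x (v x) = A x (v x) := h2
      have h4 : (2 : ℝ) • P x (A x (v x)) = (2 : ℝ) • A x (v x) := by
        rw [two_smul, two_smul]
        exact sub_eq_iff_eq_add.1 h3
      exact smul_right_injective _ two_ne_zero h4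
    · have h2 : G x = star (A x) * (G (π x) * A x) := by
        have h3 : A x * A x = (G (π x)).inverse * G x := e4
        rw [← mul_assoc, ← hAΦ, mul_assoc, h3, ← mul_assoc, i1, one_mul]
      rw [← e1.eq, h2]
      exact ContinuousLinearMap.adjoint_inner_left (A x) (v x) (G (π x) (A x (v x)))
  refine ⟨n, fun x => A x (v x), ⟨hπ, hw.smooth, hw.map_eq_zero, fun p hp => ?_, hw.ker_le⟩,
    fun p hp => ?_⟩
  · filter_upwards [key p hp, hπ p hp] with x hx hx'
    rw [hdw _ hx'.2.1, hdv _ hx'.2.1, ← hx.1]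
    exact exists_vderiv_eq_normalProjection w₀ (π x) _
  · filter_upwards [key p hp, hπ p hp] with x hx hx' u hu
    have hS' := hx'.2.1
    have hvu : vderiv I v (π x) u = A x (v x) :=
      (congrArg (fun L : E →L[ℝ] EuclideanSpace ℝ (Fin n) => L u) (hdw _ hS')).symm.trans hu
    have hess : hessianAt I g (π x) u u =
        inner ℝ (G (π x) (vderiv I v (π x) u)) (vderiv I v (π x) u) :=
      hessianAt_half_quadratic (g := g)
        (A := fun x => (innerSL ℝ : EuclideanSpace ℝ (Fin n) →L[ℝ] _ →L[ℝ] ℝ).comp (G x))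
        (hint hS') ((smoothNear_const _ _).clm_comp (hG.smoothNear (π x))) (hv.smooth _ hS')
        (hv.map_eq_zero _ hS') ((hGq _ hS').mono fun y hy => by
          have h2 : inner ℝ (G y (v y)) (v y) = 2 * g y := hy.eq
          change g y = 1 / 2 * inner ℝ (G y (v y)) (v y)
          rw [h2]; ring) u
    rw [hess, hvu, ← hx.2]
    ring

end MorseBott


/-! ### Simultaneous normal forms near a component -/

section NormalForm

variable {E : Type*} [NormedAddCommGroup E] [NormedSpace ℝ E] [FiniteDimensional ℝ E]
  {H : Type*} [TopologicalSpace H] {I : ModelWithCorners ℝ E H}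
  {X : Type*} [TopologicalSpace X] [ChartedSpace H X] [IsManifold I ∞ X] [T2Space X]
  {E' : Type*} [NormedAddCommGroup E'] [NormedSpace ℝ E'] [FiniteDimensional ℝ E']
  {H' : Type*} [TopologicalSpace H'] {J : ModelWithCorners ℝ E' H'}
  {Y : Type*} [TopologicalSpace Y] [ChartedSpace H' Y] [IsManifold J ∞ Y]

theorem isCompact_connectedComponentIn {α : Type*} [TopologicalSpace α] [T2Space α] {K : Set α}
    (hK : IsCompact K) (x : α) : IsCompact (connectedComponentIn K x) := by
  refine hK.of_isClosed_subset ?_ (connectedComponentIn_subset K x)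
  rw [connectedComponentIn]
  split_ifs
  · exact hK.isClosed.isClosedEmbedding_subtypeVal.isClosedMap _ isClosed_connectedComponent
  · exact isClosed_empty

variable (I J) in
/-- The part of the structure of a boundary map near a component `S` of its critical set that enters
the normal form, with respect to a defining function `z` of the hypersurface `T = f(S)`: the map
restricts to a submersion `S → T`, and `z ∘ f` is positive definite in the normal directions. -/
structure IsFibredMinimum (f : X → Y) (S : Set X) (T : Set Y) (z : Y → ℝ) : Prop where
  smooth : ContMDiff I J ∞ f
  isCompact_source : IsCompact S
  isCompact_target : IsCompact T
  source_subset_interior : S ⊆ I.interior X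
  target_subset_interior : T ⊆ J.interior Y
  mapsTo : MapsTo f S T
  source_submanifold : ∀ p ∈ S, ∃ c, ∃ b : X → EuclideanSpace ℝ (Fin c), IsDefiningAt I S b p
  target_submanifold : ∀ y ∈ T, ∃ c, ∃ h : Y → EuclideanSpace ℝ (Fin c), IsDefiningAt J T h y
  fibrating : ∀ p ∈ S, ∀ w ∈ subTangent J T (f p), ∃ v ∈ subTangent I S p, mfderiv I J f p v = w
  smooth_function : ContMDiff J 𝓘(ℝ, ℝ) ∞ z
  isDefiningAt : ∀ y ∈ T, IsDefiningAt J T z y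
  critical : ∀ p ∈ S, vderiv I (z ∘ f) p = 0
  hessian_pos : ∀ p ∈ S, ∀ v ∉ subTangent I S p, 0 < hessianAt I (z ∘ f) p v v

/-- A component of the critical set of a fibrating boundary map is a fibred minimum of `z ∘ f` for a
suitable defining function `z` of its image, if the latter is coorientable. -/
theorem IsFibratingBoundaryMap.exists_isFibredMinimum [T2Space Y] {f : X → Y} {D : Set X} {Z : Set Y}
    (hf : IsFibratingBoundaryMap I J f D Z) (hD : IsCompact D) (hDint : D ⊆ I.interior X)
    (hfDint : f '' D ⊆ J.interior Y) (x₀ : X)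
    (hco : IsCoorientable J (f '' connectedComponentIn D x₀)) :
    ∃ z : Y → ℝ, IsFibredMinimum I J f (connectedComponentIn D x₀)
      (f '' connectedComponentIn D x₀) z := by
  set S := connectedComponentIn D x₀ with hSdef
  set T := f '' S with hTdef
  have hSD : S ⊆ D := connectedComponentIn_subset D x₀
  have hS : IsCompact S := isCompact_connectedComponentIn hD x₀
  have hT : IsCompact T := hS.image hf.smooth.continuous
  have hDZ (x : X) : x ∈ D ↔ f x ∈ Z := by rw [← hf.preimage_eq, mem_preimage]
  have hTZ : T ⊆ Z := image_subset_iff.2 fun x hx => (hDZ x).1 (hSD hx)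
  have hTint : T ⊆ J.interior Y := (image_mono hSD).trans hfDint
  have hST : MapsTo f S T := mapsTo_image f S
  have hDloc (p : X) (hp : p ∈ S) : ∃ c, 2 ≤ c ∧ ∃ b : X → EuclideanSpace ℝ (Fin c),
      IsDefiningAt I D b p :=
    let ⟨c, hc, hc'⟩ := hf.source_submanifold p (hSD hp)
    ⟨c, hc, hc'.exists_isDefiningAt (hSD hp)⟩
  have hSe (p : X) (hp : p ∈ S) : ∀ᶠ x in 𝓝 p, (x ∈ D ↔ x ∈ S) := by
    obtain ⟨c, -, b, hb⟩ := hDloc p hp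
    filter_upwards [hb.eventually_mem_connectedComponentIn (hDint (hSD hp))] with x hx
    rw [← connectedComponentIn_eq hp] at hx
    exact ⟨hx, fun h => hSD h⟩
  have hSloc (p : X) (hp : p ∈ S) : ∃ c, 2 ≤ c ∧ ∃ b : X → EuclideanSpace ℝ (Fin c),
      IsDefiningAt I S b p :=
    let ⟨c, hc, b, hb⟩ := hDloc p hp
    ⟨c, hc, b, hb.congr_set (hSe p hp)⟩
  have hTe (p : X) (hp : p ∈ S) : ∀ᶠ y in 𝓝 (f p), (y ∈ Z ↔ y ∈ T) := by
    obtain ⟨c, -, b, hb⟩ := hDloc p hp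
    obtain ⟨h, hh⟩ := (hf.target_hypersurface _ (hTZ (hST hp))).exists_isDefiningAt (hTZ (hST hp))
    filter_upwards [hb.eventually_mem_image hh (hDint (hSD hp)) (hTint (hST hp))
      (hf.smooth.smoothNear p) (hf.fibrating p (hSD hp)) (fun x hx => (hDZ x).1 hx) (hSe p hp)]
      with y hy
    refine ⟨fun h => ?_, fun h => hTZ h⟩
    obtain ⟨x, hx, rfl⟩ := hy h
    exact hST (hx.2.1 hx.1)
  have hTloc (y : Y) (hy : y ∈ T) :
      ∃ h : Y → EuclideanSpace ℝ (Fin 1), IsDefiningAt J T h y := by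
    obtain ⟨p, hp, rfl⟩ := hy
    obtain ⟨h, hh⟩ := (hf.target_hypersurface _ (hTZ (hST hp))).exists_isDefiningAt (hTZ (hST hp))
    exact ⟨h, hh.congr_set (hTe p hp)⟩
  have hfib (p : X) (hp : p ∈ S) :
      ∀ w ∈ subTangent J T (f p), ∃ v ∈ subTangent I S p, mfderiv I J f p v = w := by
    rw [← subTangent_congr (hSe p hp), ← subTangent_congr (hTe p hp)]
    exact hf.fibrating p (hSD hp)
  obtain ⟨z, hz, hzd⟩ := hco.exists_isDefiningAt hT hTint fun y hy =>
    let ⟨_, hh⟩ := hTloc y hy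
    ⟨_, hh.comp_equiv (ContinuousLinearEquiv.ofFinrankEq (by simp) :
      EuclideanSpace ℝ (Fin 1) ≃L[ℝ] ℝ)⟩
  have hcrit {z : Y → ℝ} (hz : ContMDiff J 𝓘(ℝ, ℝ) ∞ z) (hzd : ∀ y ∈ T, IsDefiningAt J T z y)
      (p : X) (hp : p ∈ S) : vderiv I (z ∘ f) p = 0 := by
    obtain ⟨c, hc, b, hb⟩ := hSloc p hp
    refine hb.vderiv_eq_zero_of_two_le hc (hDint (hSD hp)) ((hz.comp hf.smooth).smoothNear p) ?_
    filter_upwards [(hf.smooth.continuous.tendsto p).eventually (hzd _ (hST hp)).zero_iff,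
      hSe p hp] with x h1 h2
    exact ⟨fun h => h1.1 (hST h), fun h => h2.1 ((hDZ x).2 (hTZ (h1.2 h)))⟩
  have hdef : ∀ p ∈ S, IsNormallyDefinite I S p (fun v => hessianAt I (z ∘ f) p v v) := by
    intro p hp
    obtain ⟨V, hV, hV'⟩ := exists_isDefiningMap (I := J) Z z
    have h1 := hf.normal_hessian_definite p (hSD hp) V z (hV' _ (hTint (hST hp))
      ((hzd _ (hST hp)).congr_set ((hTe p hp).mono fun y hy => hy.symm))) hV
    rw [IsNormallyDefinite] at h1 ⊢
    rwa [subTangent_congr (hSe p hp)] at h1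
  have hSloc' : ∀ p ∈ S, ∃ c, ∃ b : X → EuclideanSpace ℝ (Fin c), IsDefiningAt I S b p :=
    fun p hp => let ⟨c, _, hb⟩ := hSloc p hp; ⟨c, hb⟩
  have hTloc' : ∀ y ∈ T, ∃ c, ∃ h : Y → EuclideanSpace ℝ (Fin c), IsDefiningAt J T h y :=
    fun y hy => ⟨1, hTloc y hy⟩
  have hSint : S ⊆ I.interior X := hSD.trans hDint
  rcases (isPreconnected_connectedComponentIn : IsPreconnected S).normal_hessian_pos_or_neg hSint
    hSloc (fun p _ => (hz.comp hf.smooth).smoothNear p) (fun p hp => (hzd _ (hST hp)).map_eq_zero)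
    (hcrit hz hzd) hdef with hpos | hneg
  · exact ⟨z, hf.smooth, hS, hT, hSint, hTint, hST, hSloc', hTloc', hfib, hz, hzd, hcrit hz hzd,
      hpos⟩
  · have hz' : ContMDiff J 𝓘(ℝ, ℝ) ∞ (-z) := hz.neg
    have hzd' : ∀ y ∈ T, IsDefiningAt J T (-z) y := fun y hy =>
      (hzd y hy).comp_equiv (ContinuousLinearEquiv.neg ℝ)
    refine ⟨-z, hf.smooth, hS, hT, hSint, hTint, hST, hSloc', hTloc', hfib, hz', hzd',
      hcrit hz' hzd', fun p hp v hv => ?_⟩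
    exact lt_of_lt_of_eq (neg_pos.2 (hneg p hp v hv)) (hessianAt_neg (I := I) (z ∘ f) p v v).symm

/-- Compatible tubular neighbourhoods: the one of `T` has normal coordinate `(π, z)`, and that of `S`
has normal coordinate `(ρ, w)`, where the retraction `ρ` lifts `π` and `w` is given by the
Morse–Bott lemma for `z ∘ f`. -/
theorem IsFibredMinimum.exists_isTubularEmbedding [T2Space Y] [SigmaCompactSpace X] {f : X → Y}
    {S : Set X} {T : Set Y} {z : Y → ℝ} (h : IsFibredMinimum I J f S T z) (hne : S.Nonempty) :
    ∃ (Ut : Set (NormalBundle I S)) (U : Set X) (ΦS : NormalBundle I S → X)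
      (Vt : Set (NormalBundle J T)) (V : Set Y) (ΦT : NormalBundle J T → Y),
      T ⊆ V ∧ IsDefiningMap J T V z ∧ IsTubularEmbedding S Ut U ΦS ∧
      IsTubularEmbedding T Vt V ΦT ∧ MapsTo f U V ∧
      (∀ (p : S) (v : TangentSpace I (p : X)),
        (⟨p, normalClass I S (p : X) v⟩ : NormalBundle I S) ∈ Ut →
        z (f (ΦS ⟨p, normalClass I S (p : X) v⟩)) =
          (1 / 2 : ℝ) * hessianAt I (z ∘ f) (p : X) v v) ∧
      (∀ ξ ∈ Ut, ∀ η ∈ Vt, ΦT η = f (ΦS ξ) → (η.base : Y) = f (ξ.base : X)) := by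
  have hSint := h.source_subset_interior
  have hTint := h.target_subset_interior
  obtain ⟨π, hπ⟩ := exists_retraction h.isCompact_target hTint h.target_submanifold
  obtain ⟨ρ, hρ⟩ := exists_lift_retraction h.isCompact_source hSint hTint h.smooth h.mapsTo
    h.source_submanifold h.target_submanifold h.fibrating hπ
  have hρ' : ∀ p ∈ S, IsRetractionAt I S (fun _ => ()) (fun _ => ()) ρ p := fun p hp =>
    (hρ p hp).mono fun x hx => ⟨hx.1, hx.2.1, rfl, hx.2.2.2⟩
  have hTz : IsTubularData J T π z :=
    { retraction := hπ
      smooth := fun p _ => h.smooth_function.smoothNear p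
      map_eq_zero := fun p hp => (h.isDefiningAt p hp).map_eq_zero
      mem_range := fun p hp => (hπ p hp).mono fun x hx => (h.isDefiningAt _ hx.2.1).surjective _
      ker_le := fun p hp v hv => ((h.isDefiningAt p hp).mem_subTangent_iff (hTint hp) v).2 hv }
  obtain ⟨V₀, hV₀, hV₀'⟩ := exists_isDefiningMap (I := J) T z
  have hTV₀ : T ⊆ V₀ := fun y hy => hV₀' y (hTint hy) (h.isDefiningAt y hy)
  obtain ⟨Vt, V, ΦT, hΦT, hVV₀, hcT⟩ := hTz.exists_isTubularEmbedding h.isCompact_target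
    ((hne.image f).mono h.mapsTo.image_subset) hTint
    (fun y hy => let ⟨c, b, hb⟩ := h.target_submanifold y hy; ⟨c, hb.isSubmanifoldAt (hTint hy)⟩)
    (hV₀.isOpen.mem_nhdsSet.2 hTV₀)
  have hTV : T ⊆ V := fun y hy => by
    have h1 := hΦT.mapsTo (hΦT.zero_mem ⟨y, hy⟩)
    rwa [hΦT.map_zero] at h1
  obtain ⟨n, w, hw, hwg⟩ := exists_isTubularData_hessian h.isCompact_source hSint
    h.source_submanifold (g := z ∘ f) (fun p _ => (h.smooth_function.comp h.smooth).smoothNear p)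
    (fun p hp => (h.isDefiningAt _ (h.mapsTo hp)).map_eq_zero) h.critical h.hessian_pos hρ'
  have hU₀ : {x | f x ∈ V ∧ f (ρ x) = π (f x) ∧ ∀ u : TangentSpace I (ρ x),
      vderiv I w (ρ x) u = w x → (z ∘ f) x = (1 / 2 : ℝ) * hessianAt I (z ∘ f) (ρ x) u u} ∈ 𝓝ˢ S :=
    mem_nhdsSet_iff_forall.2 fun p hp => by
      filter_upwards [(h.smooth.continuous.tendsto p).eventually
        (hΦT.isOpen_target.mem_nhds (hTV (h.mapsTo hp))), hρ p hp, hwg p hp] with x h1 h2 h3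
      exact ⟨h1, h2.2.2.1, h3⟩
  obtain ⟨Ut, U, ΦS, hΦS, hUU₀, hcS⟩ := hw.exists_isTubularEmbedding h.isCompact_source hne hSint
    (fun y hy => let ⟨c, b, hb⟩ := h.source_submanifold y hy; ⟨c, hb.isSubmanifoldAt (hSint hy)⟩)
    hU₀
  refine ⟨Ut, U, ΦS, Vt, V, ΦT, hTV, ⟨hΦT.isOpen_target, hV₀.smooth.mono hVV₀,
    fun y hy => hV₀.zero_iff y (hVV₀ hy), fun y hy => hV₀.submersive y ⟨hVV₀ hy.1, hy.2⟩⟩, hΦS, hΦT,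
    fun x hx => (hUU₀ hx).1, fun p v hv => ?_, fun ξ hξ η hη he => ?_⟩
  · obtain ⟨-, -, h1⟩ := hUU₀ (hΦS.mapsTo hv)
    obtain ⟨h2, h3⟩ := hcS _ hv
    revert h1
    rw [h2]
    exact fun h1 => h1 v (h3 v rfl)
  · obtain ⟨-, h1, -⟩ := hUU₀ (hΦS.mapsTo hξ)
    rw [← (hcT η hη).1, he, ← h1, (hcS ξ hξ).1]

end NormalForm


theorem mainTheorem11
    {E : Type*} [NormedAddCommGroup E] [NormedSpace ℝ E] [FiniteDimensional ℝ E]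
    {H : Type*} [TopologicalSpace H] (I : ModelWithCorners ℝ E H)
    {X : Type*} [TopologicalSpace X] [ChartedSpace H X] [IsManifold I ∞ X]
    [T2Space X] [SigmaCompactSpace X]
    {E' : Type*} [NormedAddCommGroup E'] [NormedSpace ℝ E'] [FiniteDimensional ℝ E']
    {H' : Type*} [TopologicalSpace H'] (J : ModelWithCorners ℝ E' H')
    {Y : Type*} [TopologicalSpace Y] [ChartedSpace H' Y] [IsManifold J ∞ Y]
    [T2Space Y] [SigmaCompactSpace Y]
    (f : X → Y) (D : Set X) (Z : Set Y)
    (hf : IsFibratingBoundaryMap I J f D Z)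
    (hD : IsCompact D) (hDint : D ⊆ I.interior X) (hfDint : f '' D ⊆ J.interior Y)
    (Dj : Set X) (hDj : ∃ x₀ ∈ D, Dj = connectedComponentIn D x₀)
    (Zj : Set Y) (hZj : Zj = f '' Dj) (hco : IsCoorientable J Zj) :
    ∃ (z : Y → ℝ)
      (Ut : Set (NormalBundle I Dj)) (U : Set X) (ΦD : NormalBundle I Dj → X)
      (Vt : Set (NormalBundle J Zj)) (V : Set Y) (ΦZ : NormalBundle J Zj → Y),
      Zj ⊆ V ∧ IsDefiningMap J Zj V z ∧
      IsTubularEmbedding Dj Ut U ΦD ∧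
      IsTubularEmbedding Zj Vt V ΦZ ∧
      MapsTo f U V ∧
      (∀ (p : Dj) (v : TangentSpace I (p : X)),
        (⟨p, normalClass I Dj (p : X) v⟩ : NormalBundle I Dj) ∈ Ut →
        z (f (ΦD ⟨p, normalClass I Dj (p : X) v⟩)) =
          (1 / 2 : ℝ) * hessianAt I (z ∘ f) (p : X) v v) ∧
      (∀ ξ ∈ Ut, ∀ η ∈ Vt, ΦZ η = f (ΦD ξ) → (η.base : Y) = f (ξ.base : X)) := by
  obtain ⟨x₀, hx₀, rfl⟩ := hDj
  subst hZj
  obtain ⟨z, hz⟩ := hf.exists_isFibredMinimum hD hDint hfDint x₀ hco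
  exact ⟨z, hz.exists_isTubularEmbedding ⟨x₀, mem_connectedComponentIn hx₀⟩⟩
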